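/- Consider the semi-discrete chain $t_{1x}=f(t,t_1,t_x)$, where $f$ is a $C^\infty$ function on an open set $\Omega\subseteq\mathbb R^3$ with $\partial f/\partial t_x\neq 0$ on $\Omega$; here $t=t(n,x)$, $n\in\mathbb Z$, $x\in\mathbb R$, $t_k=t(n+k,x)$, $t_{[i]}=D_x^i t$. The statement is local: fix a background, i.e. a value $x_0$ of $x$ and values $t_{[i]}(n)$ ($n\in\mathbb Z$, $i\ge 0$) such that $(t(n),t(n+1),t_x(n))\in\Omega$ and $t_{[i+1]}(n+1)=(D_x^{i}f)(n)$ for all $n$ and $i\ge0$. "Function" means: for every $n\in\mathbb Z$, a germ, at the background at the site $n$, of a $C^\infty$ function of finitely many of the variables $x$, $t_k$ ($k\in\mathbb Z$), $t_{[i]}$ ($i\ge1$). The shift $$(Dh)(n,x,t_k,t_x,t_{xx},\dots)=h(n+1,x,t_{k+1},f,f_x,f_{xx},\dots)$$ is an automorphism of the algebra of functions. Put, for $j\ge1$, $$Y_j=D^{-j}\frac{\partial}{\partial t_1}D^{j}\ \text{ acting on functions of } x,n,t,t_x,t_{xx},\dots,\ \text{ i.e. }\ Y_j=\sum_{i\ge0}\Big(D^{-j}\frac{\partial}{\partial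 t_1}D^{j}t_{[i]}\Big)\frac{\partial}{\partial t_{[i]}},\qquad X_j=\frac{\partial}{\partial t_{-j}} .$$ Linear combinations of vector fields have functions as coefficients, and at each site $n$ an envelope or algebra has finite dimension if it is finitely generated as a module over the ring of germs at that site (its dimension being the rank of this module). An $n$-integral is a function $I=I(x,n,t,t_x,t_{xx},\dots)$ with $DI=I$; it is nontrivial if it is not a function of $x$ and $n$ only. Assume that the background is generic in the following sense: for each of the systems $\{Y_1,\dots,Y_k\}$ ($k\ge 1$), and for the Lie algebra generated by all $Y_j$ and $X_j$ ($j\ge1$), the rank of the matrix of coefficients at $\partial/\partial t,\partial/\partial t_x,\partial/\partial t_{xx},\dots$ is constant near the background and the same at all sites $n$ (if the rank is less than $r$ at the background at one site, then every $r\times r$ minor vanishes identically near the background at every site). Then the chain admits a nontrivial $n$-integral if and only if the following two conditions hold: 1) the linear envelope of the operators $\{Y_j\}_{j\ge1}$ has finite dimension (at each $n$, the same for all $n$); denote this dimension by $N$; 2) the Lie algebra $L_n$ generated by $Y_1,\dots,Y_N,X_1,\dots,X_N$ (the linear combinations, with functions as coefficients, of these operators and their multiple commutators) has finite dimension, for every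 $n$. -/

import Mathlib

open Filter Topology Set
open scoped ContDiff

namespace SemiDiscrete

/-- The independent dynamical variables at a site of the lattice: the continuous variable `x`, the
values `t k` of the unknown at the sites `k` steps away (so `t 0` is the unknown itself), and the
`x`-derivatives `d i = D_x^{i+1} t` of the unknown at the site itself. -/
inductive Var : Type
  | x : Var
  | t : ℤ → Var
  | d : ℕ → Var
  deriving DecidableEq

/-- A point of the space of all values of the dynamical variables (with the product topology). -/
abbrev Phase : Type := Var → ℝ

/-- The (raw) partial derivative of a function with respect to the variable `v`. -/
noncomputable def pd (v : Var) (h : Phase → ℝ) : Phase → ℝ :=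
  fun y => deriv (fun s => h (Function.update y v s)) (y v)

/-- Near `p`, the function `h` is a `C^∞` function of finitely many variables, all taken
from the set `V`. -/
def SmoothIn (V : Set Var) (p : Phase) (h : Phase → ℝ) : Prop :=
  ∃ s : Finset Var, (s : Set Var) ⊆ V ∧ ∃ H : (s → ℝ) → ℝ,
    (∀ᶠ z in 𝓝 (s.restrict p), ContDiffAt ℝ ∞ H z) ∧ h =ᶠ[𝓝 p] fun y => H (s.restrict y)

theorem continuous_restr (s : Finset Var) : Continuous (fun y : Phase => s.restrict y) :=
  continuous_pi fun i => continuous_apply i.1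

theorem SmoothIn.mono {V W : Set Var} {p : Phase} {h : Phase → ℝ} (hVW : V ⊆ W)
    (hh : SmoothIn V p h) : SmoothIn W p h := by
  obtain ⟨s, hs, H⟩ := hh
  exact ⟨s, hs.trans hVW, H⟩

theorem SmoothIn.congr {V : Set Var} {p : Phase} {h h' : Phase → ℝ}
    (hh : SmoothIn V p h) (e : h' =ᶠ[𝓝 p] h) : SmoothIn V p h' := by
  obtain ⟨s, hs, H, h1, h2⟩ := hh
  exact ⟨s, hs, H, h1, e.trans h2⟩

theorem SmoothIn.continuousAt {V : Set Var} {p : Phase} {h : Phase → ℝ}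
    (hh : SmoothIn V p h) : ContinuousAt h p := by
  obtain ⟨s, -, H, h1, h2⟩ := hh
  refine ContinuousAt.congr ?_ h2.symm
  exact ContinuousAt.comp (g := H) (f := fun y : Phase => s.restrict y)
    h1.self_of_nhds.continuousAt (continuous_restr s).continuousAt

theorem smoothIn_coord {V : Set Var} {v : Var} (hv : v ∈ V) (p : Phase) :
    SmoothIn V p (fun y => y v) := by
  refine ⟨{v}, by simpa using hv, fun z => z ⟨v, by simp⟩, Eventually.of_forall fun z => ?_,
    Eventually.of_forall fun y => rfl⟩
  fun_prop

/-- Smooth functions of finitely many smooth functions are smooth. -/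
theorem SmoothIn.comp_fin {ι : Type} [Fintype ι] {V : Set Var} {p : Phase}
    {φ : ι → Phase → ℝ} (hφ : ∀ i, SmoothIn V p (φ i)) {H : (ι → ℝ) → ℝ}
    (hH : ∀ᶠ z in 𝓝 (fun i => φ i p), ContDiffAt ℝ ∞ H z) :
    SmoothIn V p (fun y => H (fun i => φ i y)) := by
  classical
  choose s hs K hK he using hφ
  let S : Finset Var := Finset.univ.biUnion s
  have hsub : ∀ i, s i ⊆ S := fun i => Finset.subset_biUnion_of_mem s (Finset.mem_univ i)
  let r : ∀ i, (S → ℝ) → (s i → ℝ) := fun i z v => z ⟨v.1, hsub i v.2⟩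
  have hr : ∀ i, ContDiff ℝ ∞ (r i) := fun i => by
    refine contDiff_pi.2 fun v => ?_
    fun_prop
  have hrp : ∀ i (y : Phase), r i (S.restrict y) = (s i).restrict y := fun i y => rfl
  have hK' : ∀ i, ∀ᶠ z in 𝓝 (S.restrict p), ContDiffAt ℝ ∞ (K i) (r i z) := fun i =>
    (hr i).continuous.continuousAt.eventually (by rw [hrp]; exact hK i)
  have heq : ∀ᶠ y in 𝓝 p, ∀ i, φ i y = K i ((s i).restrict y) := by
    rw [eventually_all]; exact he
  have hKp : (fun i => K i (r i (S.restrict p))) = fun i => φ i p := by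
    funext i; rw [hrp, heq.self_of_nhds i]
  refine ⟨S, ?_, fun z => H (fun i => K i (r i z)), ?_, ?_⟩
  · intro v hv
    simp only [S, Finset.coe_biUnion, Set.mem_iUnion] at hv
    obtain ⟨i, -, hv⟩ := hv
    exact hs i hv
  · have hc : ∀ᶠ z in 𝓝 (S.restrict p),
        ContDiffAt ℝ ∞ (fun z => fun i => K i (r i z)) z := by
      have : ∀ᶠ z in 𝓝 (S.restrict p), ∀ i, ContDiffAt ℝ ∞ (K i) (r i z) := by
        rw [eventually_all]; exact hK'
      filter_upwards [this] with z hz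
      exact contDiffAt_pi.2 fun i => (hz i).comp z (hr i).contDiffAt
    have hcont : ContinuousAt (fun z => fun i => K i (r i z)) (S.restrict p) :=
      hc.self_of_nhds.continuousAt
    have hH' : ∀ᶠ z in 𝓝 (S.restrict p), ContDiffAt ℝ ∞ H (fun i => K i (r i z)) :=
      hcont.eventually (by
        change ∀ᶠ y in 𝓝 (fun i => K i (r i (S.restrict p))), ContDiffAt ℝ ∞ H y
        rw [hKp]; exact hH)
    filter_upwards [hc, hH'] with z h1 h2
    exact ContDiffAt.comp z h2 h1
  · filter_upwards [heq] with y hy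
    congr 1
    funext i
    rw [hy i, hrp]

theorem smoothIn_const {V : Set Var} (p : Phase) (c : ℝ) : SmoothIn V p (fun _ => c) :=
  SmoothIn.comp_fin (ι := Empty) (φ := fun i => i.elim) (fun i => i.elim) (H := fun _ => c)
    (Eventually.of_forall fun _ => contDiffAt_const)

theorem SmoothIn.comp₂ {V : Set Var} {p : Phase} {a b : Phase → ℝ} (ha : SmoothIn V p a)
    (hb : SmoothIn V p b) {H : ℝ × ℝ → ℝ} (hH : ∀ᶠ z in 𝓝 (a p, b p), ContDiffAt ℝ ∞ H z) :
    SmoothIn V p (fun y => H (a y, b y)) := by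
  refine SmoothIn.comp_fin (ι := Fin 2) (φ := ![a, b]) ?_ (H := fun z => H (z 0, z 1)) ?_
  · intro i; fin_cases i <;> assumption
  · have h1 : ContDiff ℝ ∞ (fun z : Fin 2 → ℝ => (z 0, z 1)) := by fun_prop
    have := h1.continuous.continuousAt (x := fun i => (![a, b] : Fin 2 → Phase → ℝ) i p)
    filter_upwards [this.eventually (p := fun z => ContDiffAt ℝ ∞ H z) hH] with z hz
    exact ContDiffAt.comp z hz h1.contDiffAt

theorem SmoothIn.comp₃ {V : Set Var} {p : Phase} {a b c : Phase → ℝ} (ha : SmoothIn V p a)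
    (hb : SmoothIn V p b) (hc : SmoothIn V p c) {H : ℝ × ℝ × ℝ → ℝ}
    (hH : ∀ᶠ z in 𝓝 (a p, b p, c p), ContDiffAt ℝ ∞ H z) :
    SmoothIn V p (fun y => H (a y, b y, c y)) := by
  refine SmoothIn.comp_fin (ι := Fin 3) (φ := ![a, b, c]) ?_ (H := fun z => H (z 0, z 1, z 2)) ?_
  · intro i; fin_cases i <;> assumption
  · have h1 : ContDiff ℝ ∞ (fun z : Fin 3 → ℝ => (z 0, z 1, z 2)) := by fun_prop
    have := h1.continuous.continuousAt (x := fun i => (![a, b, c] : Fin 3 → Phase → ℝ) i p)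
    filter_upwards [this.eventually (p := fun z => ContDiffAt ℝ ∞ H z) hH] with z hz
    exact ContDiffAt.comp z hz h1.contDiffAt

theorem SmoothIn.add {V : Set Var} {p : Phase} {a b : Phase → ℝ} (ha : SmoothIn V p a)
    (hb : SmoothIn V p b) : SmoothIn V p (fun y => a y + b y) :=
  ha.comp₂ hb (H := fun z => z.1 + z.2) (Eventually.of_forall fun _ => by fun_prop)

theorem SmoothIn.sub {V : Set Var} {p : Phase} {a b : Phase → ℝ} (ha : SmoothIn V p a)
    (hb : SmoothIn V p b) : SmoothIn V p (fun y => a y - b y) :=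
  ha.comp₂ hb (H := fun z => z.1 - z.2) (Eventually.of_forall fun _ => by fun_prop)

theorem SmoothIn.mul {V : Set Var} {p : Phase} {a b : Phase → ℝ} (ha : SmoothIn V p a)
    (hb : SmoothIn V p b) : SmoothIn V p (fun y => a y * b y) :=
  ha.comp₂ hb (H := fun z => z.1 * z.2) (Eventually.of_forall fun _ => by fun_prop)

theorem SmoothIn.div {V : Set Var} {p : Phase} {a b : Phase → ℝ} (ha : SmoothIn V p a)
    (hb : SmoothIn V p b) (h0 : b p ≠ 0) : SmoothIn V p (fun y => a y / b y) := by
  refine ha.comp₂ hb (H := fun z => z.1 / z.2) ?_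
  have : ∀ᶠ z : ℝ × ℝ in 𝓝 (a p, b p), z.2 ≠ 0 :=
    continuousAt_snd.eventually_ne h0
  filter_upwards [this] with z hz
  exact contDiffAt_fst.div contDiffAt_snd hz

theorem SmoothIn.sum {V : Set Var} {p : Phase} {ι : Type} (s : Finset ι) {a : ι → Phase → ℝ}
    (ha : ∀ i ∈ s, SmoothIn V p (a i)) : SmoothIn V p (fun y => ∑ i ∈ s, a i y) := by
  classical
  induction s using Finset.induction_on with
  | empty => simpa using smoothIn_const p 0
  | insert i s his ih =>
    simp only [Finset.sum_insert his]
    exact (ha i (by simp)).add (ih fun j hj => ha j (by simp [hj]))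

theorem tendsto_update (y : Phase) (v : Var) :
    Tendsto (fun s => Function.update y v s) (𝓝 (y v)) (𝓝 y) := by
  have : Continuous (fun s : ℝ => Function.update y v s) := continuous_const.update v continuous_id
  simpa using this.tendsto (y v)

theorem pd_congr {p : Phase} (v : Var) {h h' : Phase → ℝ} (e : h =ᶠ[𝓝 p] h') :
    pd v h =ᶠ[𝓝 p] pd v h' := by
  filter_upwards [e.eventuallyEq_nhds] with y hy
  exact EventuallyEq.deriv_eq ((tendsto_update y v).eventually hy)

/-- The partial derivatives of a locally smooth function, in terms of a representative. -/
theorem hasDerivAt_of_rep {p : Phase} {h : Phase → ℝ} {s : Finset Var} {H : (s → ℝ) → ℝ}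
    (h1 : ∀ᶠ z in 𝓝 (s.restrict p), ContDiffAt ℝ ∞ H z)
    (h2 : h =ᶠ[𝓝 p] fun y => H (s.restrict y)) (v : Var) :
    ∀ᶠ y in 𝓝 p, HasDerivAt (fun r => h (Function.update y v r))
      (if hv : v ∈ s then fderiv ℝ H (s.restrict y) (Pi.single ⟨v, hv⟩ 1) else 0) (y v) := by
  have h1' : ∀ᶠ y in 𝓝 p, ContDiffAt ℝ ∞ H (s.restrict y) :=
    (continuous_restr s).continuousAt.eventually (p := fun z => ContDiffAt ℝ ∞ H z) h1
  filter_upwards [h1', h2.eventuallyEq_nhds] with y hy1 hy2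
  have e : (fun r => h (Function.update y v r)) =ᶠ[𝓝 (y v)]
      fun r => H (s.restrict (Function.update y v r)) := (tendsto_update y v).eventually hy2
  refine HasDerivAt.congr_of_eventuallyEq ?_ e
  split_ifs with hv
  · have e2 : (fun r => H (s.restrict (Function.update y v r))) =
        fun r => H (Function.update (s.restrict y) ⟨v, hv⟩ r) := by
      funext r; congr 1; funext w
      by_cases hw : w = ⟨v, hv⟩
      · subst hw; simp
      · have : w.1 ≠ v := fun h => hw (Subtype.ext h)
        simp [hw, this, Finset.restrict]
    rw [e2]
    have hd : HasFDerivAt H (fderiv ℝ H (s.restrict y))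
        (Function.update (s.restrict y) ⟨v, hv⟩ (y v)) := by
      have : Function.update (s.restrict y) ⟨v, hv⟩ (y v) = s.restrict y := by
        have : y v = s.restrict y ⟨v, hv⟩ := rfl
        rw [this, Function.update_eq_self]
      rw [this]
      exact (hy1.differentiableAt (by simp)).hasFDerivAt
    exact hd.comp_hasDerivAt (y v) (hasDerivAt_update (s.restrict y) ⟨v, hv⟩ (y v))
  · have e2 : (fun r => H (s.restrict (Function.update y v r))) = fun _ => H (s.restrict y) := by
      funext r; congr 1; funext w
      have : w.1 ≠ v := fun h => hv (h ▸ w.2)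
      simp [this, Finset.restrict]
    rw [e2]
    exact hasDerivAt_const _ _

theorem SmoothIn.pd {V : Set Var} {p : Phase} {h : Phase → ℝ} (hh : SmoothIn V p h) (v : Var) :
    SmoothIn V p (pd v h) := by
  obtain ⟨s, hs, H, h1, h2⟩ := hh
  have key := hasDerivAt_of_rep h1 h2 v
  by_cases hv : v ∈ s
  · refine ⟨s, hs, fun z => fderiv ℝ H z (Pi.single ⟨v, hv⟩ 1), ?_, ?_⟩
    · filter_upwards [h1] with z hz
      exact (hz.fderiv_right (m := ∞) (by simp)).clm_apply contDiffAt_const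
    · filter_upwards [key] with y hy
      simp only [hv, dite_true] at hy
      exact hy.deriv
  · refine (smoothIn_const p 0).congr ?_
    filter_upwards [key] with y hy
    simp only [hv, dite_false] at hy
    exact hy.deriv

theorem SmoothIn.differentiable {V : Set Var} {p : Phase} {h : Phase → ℝ} (hh : SmoothIn V p h)
    (v : Var) :
    ∀ᶠ y in 𝓝 p, DifferentiableAt ℝ (fun r => h (Function.update y v r)) (y v) := by
  obtain ⟨s, hs, H, h1, h2⟩ := hh
  filter_upwards [hasDerivAt_of_rep h1 h2 v] with y hy
  exact hy.differentiableAt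

/-- Germs of real functions at a point form an `ℝ`-algebra. -/
noncomputable instance instAlgebraGerm (p : Phase) : Algebra ℝ (Germ (𝓝 p) ℝ) :=
  Algebra.ofModule
    (fun r a b => Germ.inductionOn₂ a b fun f g => by
      rw [← Germ.coe_smul, ← Germ.coe_mul, ← Germ.coe_mul, ← Germ.coe_smul, smul_mul_assoc])
    (fun r a b => Germ.inductionOn₂ a b fun f g => by
      rw [← Germ.coe_smul, ← Germ.coe_mul, ← Germ.coe_mul, ← Germ.coe_smul, mul_smul_comm])

/-- The algebra of germs at `p` of smooth functions of finitely many of the variables in `V`. -/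
noncomputable def smoothGerms (V : Set Var) (p : Phase) : Subalgebra ℝ (Germ (𝓝 p) ℝ) where
  carrier := {a | ∃ h : Phase → ℝ, SmoothIn V p h ∧ a = (h : Germ (𝓝 p) ℝ)}
  mul_mem' := by
    rintro _ _ ⟨h, hh, rfl⟩ ⟨k, hk, rfl⟩
    exact ⟨_, hh.mul hk, rfl⟩
  add_mem' := by
    rintro _ _ ⟨h, hh, rfl⟩ ⟨k, hk, rfl⟩
    exact ⟨_, hh.add hk, rfl⟩
  algebraMap_mem' := fun r => by
    refine ⟨_, smoothIn_const p r, ?_⟩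
    rw [Algebra.algebraMap_eq_smul_one, ← Germ.coe_one, ← Germ.coe_smul]
    congr 1
    funext y
    simp

/-- The algebra `O p` of germs at `p` of locally smooth functions (of finitely many variables). -/
abbrev O (p : Phase) : Type := smoothGerms Set.univ p

/-- The germ of a locally smooth function. -/
noncomputable def mkO {p : Phase} (h : Phase → ℝ) (hh : SmoothIn Set.univ p h) : O p :=
  ⟨(h : Germ (𝓝 p) ℝ), h, hh, rfl⟩

theorem O.ind {p : Phase} {P : O p → Prop}
    (H : ∀ (h : Phase → ℝ) (hh : SmoothIn Set.univ p h), P (mkO h hh)) (a : O p) : P a := by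
  obtain ⟨_, h, hh, rfl⟩ := a
  exact H h hh

theorem mkO_eq {p : Phase} {h k : Phase → ℝ} {hh : SmoothIn Set.univ p h}
    {hk : SmoothIn Set.univ p k} (e : h =ᶠ[𝓝 p] k) : mkO h hh = mkO k hk :=
  Subtype.ext (Germ.coe_eq.2 e)

/-- The value of a germ at its base point. -/
noncomputable def O.value {p : Phase} (a : O p) : ℝ := Germ.value a.1

/-- The germ of the coordinate function `v`. -/
noncomputable def coord (p : Phase) (v : Var) : O p :=
  mkO (fun y => y v) (smoothIn_coord (Set.mem_univ v) p)

/-- The partial derivative of a germ of a locally smooth function. -/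
noncomputable def pdO {p : Phase} (v : Var) (a : O p) : O p :=
  ⟨Germ.map' (pd v) (fun _ _ e => pd_congr v e) a.1, by
    obtain ⟨_, h, hh, rfl⟩ := a
    exact ⟨_, hh.pd v, rfl⟩⟩

theorem pdO_mk {p : Phase} (v : Var) (h : Phase → ℝ) (hh : SmoothIn Set.univ p h) :
    pdO v (mkO h hh) = mkO (pd v h) (hh.pd v) := rfl

/-- The partial derivative `∂/∂v` as a derivation of the algebra `O p`. -/
noncomputable def partialD {p : Phase} (v : Var) : Derivation ℝ (O p) (O p) :=
  Derivation.mk'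
    { toFun := pdO v
      map_add' := by
        intro a b
        induction a using O.ind with | H h hh => ?_
        induction b using O.ind with | H k hk => ?_
        refine mkO_eq (hh := (hh.add hk).pd v) (hk := (hh.pd v).add (hk.pd v)) ?_
        filter_upwards [hh.differentiable v, hk.differentiable v] with y h1 h2
        exact deriv_add h1 h2
      map_smul' := by
        intro r a
        induction a using O.ind with | H h hh => ?_
        have e : mkO (fun y => r * h y) ((smoothIn_const p r).mul hh) = r • mkO h hh := by
          apply Subtype.ext
          exact Germ.coe_smul (l := 𝓝 p) r h
        have e' : mkO (fun y => r * pd v h y) ((smoothIn_const p r).mul (hh.pd v))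
            = r • mkO (pd v h) (hh.pd v) := by
          apply Subtype.ext
          exact Germ.coe_smul (l := 𝓝 p) r (pd v h)
        rw [← e, pdO_mk, RingHom.id_apply, pdO_mk, ← e']
        refine mkO_eq ?_
        filter_upwards [hh.differentiable v] with y h1
        exact deriv_const_mul r h1 }
    (by
      intro a b
      induction a using O.ind with | H h hh => ?_
      induction b using O.ind with | H k hk => ?_
      refine mkO_eq (hh := (hh.mul hk).pd v)
        (hk := (hh.mul (hk.pd v)).add (hk.mul (hh.pd v))) ?_
      filter_upwards [hh.differentiable v, hk.differentiable v] with y h1 h2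
      have := deriv_fun_mul h1 h2
      simp only [Function.update_eq_self] at this
      change deriv (fun r => h (Function.update y v r) * k (Function.update y v r)) (y v) = _
      rw [this]
      simp only [pd]
      ring)

theorem finite_support_pd {p : Phase} (a : O p) : {v | partialD v a ≠ 0}.Finite := by
  induction a using O.ind with | H h hh => ?_
  obtain ⟨s, hs, H, h1, h2⟩ := hh
  refine s.finite_toSet.subset fun v hv => ?_
  by_contra hvs
  have hvs : v ∉ s := hvs
  refine hv (Subtype.ext (Germ.coe_eq.2 (?_ : pd v h =ᶠ[𝓝 p] fun _ => 0)))
  filter_upwards [hasDerivAt_of_rep h1 h2 v] with y hy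
  simp only [hvs, dite_false] at hy
  exact hy.deriv

theorem finite_support_mul_pd {p : Phase} (c : Var → O p) (a : O p) :
    (Function.support fun v => c v * partialD v a).Finite :=
  (finite_support_pd a).subset fun v hv h0 => hv (by simp [h0])

/-- The vector field `∑ v, c v ∂/∂v` with coefficients `c` (possibly infinitely many of them are
nonzero, but on each locally smooth function only finitely many terms of the sum are). -/
noncomputable def vectorField {p : Phase} (c : Var → O p) : Derivation ℝ (O p) (O p) :=
  Derivation.mk'
    { toFun := fun a => ∑ᶠ v, c v * partialD v a
      map_add' := fun a b => by
        rw [← finsum_add_distrib (finite_support_mul_pd c a) (finite_support_mul_pd c b)]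
        exact finsum_congr fun v => by rw [map_add, mul_add]
      map_smul' := fun r a => by
        rw [RingHom.id_apply, smul_finsum' _ (finite_support_mul_pd c a)]
        exact finsum_congr fun v => by rw [Derivation.map_smul, mul_smul_comm] }
    (fun a b => by
      change ∑ᶠ v, c v * partialD v (a * b) =
        a * (∑ᶠ v, c v * partialD v b) + b * (∑ᶠ v, c v * partialD v a)
      have h1 := mul_finsum' (fun v => c v * partialD v b) a (finite_support_mul_pd c b)
      have h2 := mul_finsum' (fun v => c v * partialD v a) b (finite_support_mul_pd c a)
      rw [h1, h2, ← finsum_add_distrib]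
      · refine finsum_congr fun v => ?_
        rw [Derivation.leibniz, smul_eq_mul, smul_eq_mul]
        ring
      · exact (finite_support_mul_pd c b).subset fun v hv h0 => hv (by simp [h0])
      · exact (finite_support_mul_pd c a).subset fun v hv h0 => hv (by simp [h0]))


/-- The semi-discrete chain `t_{1x} = f(t, t_1, t_x)`: a smooth function `f` on an open set `Ω` of
triples `(t, t_1, t_x)` with `∂f/∂t_x ≠ 0` on `Ω`. -/
structure Chain where
  Ω : Set (ℝ × ℝ × ℝ)
  f : ℝ × ℝ × ℝ → ℝ
  isOpen_Ω : IsOpen Ω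
  smooth : ContDiffOn ℝ ∞ f Ω
  nondegenerate : ∀ w ∈ Ω, deriv (fun s => f (w.1, w.2.1, s)) w.2.2 ≠ 0

namespace Chain

open Var

variable (C : Chain)

/-- `C.fJet i = D_x^i f`, as a function of `t, t_1, t_x, …, t_{[i+1]}`: the total `x`-derivative is
computed by the chain rule with `D_x t = t_x`, `D_x t_1 = f`, `D_x t_{[l]} = t_{[l+1]}`. -/
noncomputable def fJet : ℕ → Phase → ℝ
  | 0 => fun y => C.f (y (t 0), y (t 1), y (d 0))
  | i + 1 => fun y => y (d 0) * pd (t 0) (fJet i) y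
      + C.f (y (t 0), y (t 1), y (d 0)) * pd (t 1) (fJet i) y
      + ∑ l ∈ Finset.range (i + 1), y (d (l + 1)) * pd (d l) (fJet i) y

/-- The shift of the lattice in terms of the dynamical variables: the variable `t_k` at the next
site is `t_{k+1}`, and by the chain the derivatives at the next site are `f, f_x, f_xx, …`. -/
noncomputable def fwd (y : Phase) : Phase
  | x => y x
  | t k => y (t (k + 1))
  | d i => C.fJet i y

/-- The set of points at which `f` is defined. -/
def dom : Set Phase := {y | (y (t 0), y (t 1), y (d 0)) ∈ C.Ω}

theorem dom_mem_nhds {p : Phase} (hp : p ∈ C.dom) : C.dom ∈ 𝓝 p := by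
  have : Continuous fun y : Phase => (y (t 0), y (t 1), y (d 0)) := by fun_prop
  exact (C.isOpen_Ω.preimage this).mem_nhds hp

theorem contDiffAt_f {w : ℝ × ℝ × ℝ} (hw : w ∈ C.Ω) : ContDiffAt ℝ ∞ C.f w :=
  C.smooth.contDiffAt (C.isOpen_Ω.mem_nhds hw)

theorem eventually_contDiffAt_f {w : ℝ × ℝ × ℝ} (hw : w ∈ C.Ω) :
    ∀ᶠ z in 𝓝 w, ContDiffAt ℝ ∞ C.f z := by
  filter_upwards [C.isOpen_Ω.mem_nhds hw] with z hz using C.contDiffAt_f hz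

theorem smooth_fJet (i : ℕ) : ∀ p ∈ C.dom, SmoothIn Set.univ p (C.fJet i) := by
  have h0 : ∀ p ∈ C.dom,
      SmoothIn Set.univ p (fun y => C.f (y (t 0), y (t 1), y (d 0))) := fun p hp =>
    SmoothIn.comp₃ (smoothIn_coord (Set.mem_univ _) p) (smoothIn_coord (Set.mem_univ _) p)
      (smoothIn_coord (Set.mem_univ _) p) (C.eventually_contDiffAt_f hp)
  induction i with
  | zero => exact h0
  | succ i ih =>
    intro p hp
    have hc : ∀ v : Var, SmoothIn Set.univ p (fun y => y v) := fun v =>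
      smoothIn_coord (Set.mem_univ _) p
    exact (((hc _).mul ((ih p hp).pd _)).add ((h0 p hp).mul ((ih p hp).pd _))).add
      (SmoothIn.sum _ fun l _ => (hc _).mul ((ih p hp).pd _))

/-! The next facts say that `fJet (i + 1)` is affine in the highest derivative `d (i + 1)`, with
coefficient `∂f/∂t_x`; so the shift can be inverted one derivative at a time. -/

/-- The coefficient `∂f/∂t_x`. -/
noncomputable def lead : Phase → ℝ := pd (d 0) (C.fJet 0)

/-- The part of `fJet (i + 1)` that does not contain the highest derivative. -/
noncomputable def rest (i : ℕ) : Phase → ℝ := fun y =>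
  y (d 0) * pd (t 0) (C.fJet i) y
      + C.f (y (t 0), y (t 1), y (d 0)) * pd (t 1) (C.fJet i) y
      + ∑ l ∈ Finset.range i, y (d (l + 1)) * pd (d l) (C.fJet i) y

/-- The variables on which `fJet i` depends. -/
def low (i : ℕ) : Set Var := {v | v = t 0 ∨ v = t 1 ∨ ∃ l ≤ i, v = d l}

theorem _root_.SemiDiscrete.dependsOn_pd {V : Set Var} {h : Phase → ℝ} (hh : DependsOn h V)
    (v : Var) : DependsOn (pd v h) V := by
  intro y y' hy
  by_cases hv : v ∈ V
  · have : (fun s => h (Function.update y v s)) = fun s => h (Function.update y' v s) := by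
      funext s
      refine hh fun w hw => ?_
      by_cases hwv : w = v
      · subst hwv; simp
      · simp [hwv, hy w hw]
    simp only [pd, this, hy v hv]
  · have e : ∀ z : Phase, (fun s => h (Function.update z v s)) = fun _ => h z := by
      intro z
      funext s
      refine hh fun w hw => ?_
      have : w ≠ v := fun h => hv (h ▸ hw)
      simp [this]
    simp only [pd, e, deriv_const]

theorem fJet_dep (i : ℕ) : DependsOn (C.fJet i) (low i) := by
  induction i with
  | zero =>
    intro y y' h
    simp only [fJet]
    rw [h (t 0) (by simp [low]), h (t 1) (by simp [low]), h (d 0) (by simp [low])]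
  | succ i ih =>
    intro y y' h
    have hm : ∀ v ∈ low i, y v = y' v := fun v hv => h v (by
      rcases hv with hv | hv | ⟨l, hl, hv⟩
      · exact Or.inl hv
      · exact Or.inr (Or.inl hv)
      · exact Or.inr (Or.inr ⟨l, by omega, hv⟩))
    have hp : ∀ v, pd v (C.fJet i) y = pd v (C.fJet i) y' := fun v => dependsOn_pd ih v hm
    simp only [fJet, hp]
    rw [h (t 0) (by simp [low]), h (t 1) (by simp [low]), h (d 0) (by simp [low])]
    congr 1
    refine Finset.sum_congr rfl fun l hl => ?_
    rw [h (d (l + 1)) (by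
      refine Or.inr (Or.inr ⟨l + 1, ?_, rfl⟩)
      have := Finset.mem_range.1 hl
      omega)]

theorem lead_dep (i : ℕ) : DependsOn C.lead (low i) :=
  (dependsOn_pd (C.fJet_dep 0) _).mono (by
    rintro v (hv | hv | ⟨l, hl, hv⟩)
    · exact Or.inl hv
    · exact Or.inr (Or.inl hv)
    · exact Or.inr (Or.inr ⟨l, by omega, hv⟩))

theorem rest_dep (i : ℕ) : DependsOn (C.rest i) (low i) := by
  intro y y' h
  have hp : ∀ v, pd v (C.fJet i) y = pd v (C.fJet i) y' := fun v =>
    dependsOn_pd (C.fJet_dep i) v h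
  simp only [rest, hp]
  rw [h (t 0) (by simp [low]), h (t 1) (by simp [low]), h (d 0) (by simp [low])]
  congr 1
  refine Finset.sum_congr rfl fun l hl => ?_
  rw [h (d (l + 1)) (Or.inr (Or.inr ⟨l + 1, Finset.mem_range.1 hl, rfl⟩))]

theorem fJet_succ' (i : ℕ) (y : Phase) :
    C.fJet (i + 1) y = C.rest i y + y (d (i + 1)) * pd (d i) (C.fJet i) y := by
  simp only [fJet, rest, Finset.sum_range_succ]
  ring

theorem update_agree (i : ℕ) (y : Phase) (s : ℝ) :
    ∀ v ∈ low i, Function.update y (d (i + 1)) s v = y v := by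
  rintro v (hv | hv | ⟨l, hl, hv⟩)
  · exact Function.update_of_ne (by rw [hv]; simp) _ _
  · exact Function.update_of_ne (by rw [hv]; simp) _ _
  · exact Function.update_of_ne (by rw [hv]; simp; omega) _ _

theorem pd_top (i : ℕ) : pd (d i) (C.fJet i) = C.lead := by
  induction i with
  | zero => rfl
  | succ i ih =>
    funext y
    have : (fun s => C.fJet (i + 1) (Function.update y (d (i + 1)) s)) =
        fun s => C.rest i y + s * C.lead y := by
      funext s
      rw [fJet_succ', ih, C.rest_dep i (update_agree i y s), C.lead_dep i (update_agree i y s)]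
      simp
    simp [pd, this]

theorem fJet_succ (i : ℕ) (y : Phase) :
    C.fJet (i + 1) y = C.rest i y + y (d (i + 1)) * C.lead y := by
  rw [fJet_succ', pd_top]

theorem smooth_lead {p : Phase} (hp : p ∈ C.dom) : SmoothIn Set.univ p C.lead :=
  (C.smooth_fJet 0 p hp).pd _

theorem smooth_rest (i : ℕ) {p : Phase} (hp : p ∈ C.dom) : SmoothIn Set.univ p (C.rest i) := by
  have hc : ∀ v : Var, SmoothIn Set.univ p (fun y => y v) := fun v =>
    smoothIn_coord (Set.mem_univ _) p
  have ih := C.smooth_fJet i p hp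
  exact (((hc _).mul (ih.pd _)).add ((C.smooth_fJet 0 p hp).mul (ih.pd _))).add
    (SmoothIn.sum _ fun l _ => (hc _).mul (ih.pd _))

theorem lead_ne_zero {p : Phase} (hp : p ∈ C.dom) : C.lead p ≠ 0 := by
  have := C.nondegenerate _ hp
  simpa [lead, pd, fJet, Function.update_of_ne] using this

/-- Local solvability of `t_x = f(t_{-1}, t, t_{-1x})` with respect to `t_{-1x}`. -/
theorem exists_inverse {w : ℝ × ℝ × ℝ} (hw : w ∈ C.Ω) : ∃ g : ℝ × ℝ × ℝ → ℝ,
    (∀ᶠ z in 𝓝 (w.1, w.2.1, C.f w), ContDiffAt ℝ ∞ g z) ∧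
    (∀ᶠ z in 𝓝 (w.1, w.2.1, C.f w), C.f (z.1, z.2.1, g z) = z.2.2) ∧
    (∀ᶠ w' in 𝓝 w, g (w'.1, w'.2.1, C.f w') = w'.2.2) := by
  let Ψ : ℝ × ℝ × ℝ → ℝ × ℝ × ℝ := fun w => (w.1, w.2.1, C.f w)
  have hΨ : ∀ w ∈ C.Ω, ContDiffAt ℝ ∞ Ψ w := fun w hw =>
    contDiffAt_fst.prodMk ((contDiffAt_fst.comp w contDiffAt_snd).prodMk (C.contDiffAt_f hw))
  have hE : ∀ w ∈ C.Ω, ∃ E : (ℝ × ℝ × ℝ) ≃L[ℝ] (ℝ × ℝ × ℝ),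
      HasFDerivAt Ψ (E : (ℝ × ℝ × ℝ) →L[ℝ] (ℝ × ℝ × ℝ)) w := by
    intro w hw
    have hf : HasFDerivAt C.f (fderiv ℝ C.f w) w :=
      ((C.contDiffAt_f hw).differentiableAt (by simp)).hasFDerivAt
    have ha : fderiv ℝ C.f w (0, 0, 1) ≠ 0 := by
      have h1 : HasDerivAt (fun s : ℝ => ((w.1, w.2.1, s) : ℝ × ℝ × ℝ)) (0, 0, 1) w.2.2 :=
        (hasDerivAt_const _ _).prodMk ((hasDerivAt_const _ _).prodMk (hasDerivAt_id _))
      have h2 := HasFDerivAt.comp_hasDerivAt (f := fun s : ℝ => ((w.1, w.2.1, s) : ℝ × ℝ × ℝ))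
        w.2.2 (l := C.f) hf h1
      have h3 := C.nondegenerate w hw
      have h4 : deriv (fun s => C.f (w.1, w.2.1, s)) w.2.2 = fderiv ℝ C.f w (0, 0, 1) := h2.deriv
      rwa [h4] at h3
    let L : (ℝ × ℝ × ℝ) →L[ℝ] (ℝ × ℝ × ℝ) :=
      (ContinuousLinearMap.fst ℝ ℝ (ℝ × ℝ)).prod
        (((ContinuousLinearMap.fst ℝ ℝ ℝ).comp (ContinuousLinearMap.snd ℝ ℝ (ℝ × ℝ))).prod
          (fderiv ℝ C.f w))
    have hL : HasFDerivAt Ψ L w :=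
      hasFDerivAt_fst.prodMk ((hasFDerivAt_fst.comp w hasFDerivAt_snd).prodMk hf)
    have hinj : Function.Injective (L : (ℝ × ℝ × ℝ) →ₗ[ℝ] (ℝ × ℝ × ℝ)) := by
      rw [← LinearMap.ker_eq_bot, LinearMap.ker_eq_bot']
      rintro ⟨a, b, c⟩ h
      have h' : (a, b, fderiv ℝ C.f w (a, b, c)) = (0, 0, 0) := h
      simp only [Prod.mk.injEq] at h'
      obtain ⟨rfl, rfl, h3⟩ := h'
      have : ((0, 0, c) : ℝ × ℝ × ℝ) = c • (0, 0, 1) := by simp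
      rw [this, map_smul, smul_eq_mul, mul_eq_zero] at h3
      rcases h3 with rfl | h3
      · rfl
      · exact absurd h3 ha
    refine ⟨(LinearEquiv.ofInjectiveEndo _ hinj).toContinuousLinearEquiv, ?_⟩
    have hLE : ((LinearEquiv.ofInjectiveEndo _ hinj).toContinuousLinearEquiv :
        (ℝ × ℝ × ℝ) →L[ℝ] (ℝ × ℝ × ℝ)) = L := by
      exact ContinuousLinearMap.ext fun v => rfl
    rw [hLE]
    exact hL
  obtain ⟨E, hEw⟩ := hE w hw
  let e := (hΨ w hw).toOpenPartialHomeomorph Ψ hEw (by simp)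
  have hes : w ∈ e.source := (hΨ w hw).mem_toOpenPartialHomeomorph_source hEw (by simp)
  have he : ∀ z, e z = Ψ z := fun z => rfl
  have htgt : Ψ w ∈ e.target := e.map_source hes
  have hsymm : e.symm (Ψ w) = w := e.left_inv hes
  refine ⟨fun z => (e.symm z).2.2, ?_, ?_, ?_⟩
  · have h1 : ∀ᶠ z in 𝓝 (Ψ w), e.symm z ∈ C.Ω :=
      (e.symm.continuousAt htgt).eventually (by
        rw [hsymm]; exact C.isOpen_Ω.mem_nhds hw)
    filter_upwards [h1, e.open_target.mem_nhds htgt] with z hz hz'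
    obtain ⟨E', hE'⟩ := hE _ hz
    have h2 := e.contDiffAt_symm (n := ∞) hz' hE' (hΨ _ hz)
    exact contDiffAt_snd.comp z (contDiffAt_snd.comp z h2)
  · filter_upwards [e.open_target.mem_nhds htgt] with z hz
    have h1 : Ψ (e.symm z) = z := e.right_inv hz
    have h2 : (Ψ (e.symm z)).1 = z.1 := by rw [h1]
    have h3 : (Ψ (e.symm z)).2.1 = z.2.1 := by rw [h1]
    have h4 : (Ψ (e.symm z)).2.2 = z.2.2 := by rw [h1]
    rw [← h2, ← h3]
    exact h4
  · filter_upwards [e.open_source.mem_nhds hes] with w' hw'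
    have h1 : e.symm (Ψ w') = w' := e.left_inv hw'
    exact congrArg (fun q => q.2.2) h1

/-- Auxiliary points of the inverse shift: the derivatives up to order `i` are already solved. -/
noncomputable def bwdAux (g : ℝ × ℝ × ℝ → ℝ) : ℕ → Phase → Phase
  | 0 => fun y v => match v with
    | x => y x
    | t k => y (t (k - 1))
    | d 0 => g (y (t (-1)), y (t 0), y (d 0))
    | d (_ + 1) => 0
  | i + 1 => fun y => Function.update (bwdAux g i y) (d (i + 1))
      ((y (d (i + 1)) - C.rest i (bwdAux g i y)) / C.lead (bwdAux g i y))

/-- The inverse shift, where `g` solves `t_x = f(t_{-1}, t, t_{-1x})` for `t_{-1x}`. -/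
noncomputable def bwd (g : ℝ × ℝ × ℝ → ℝ) (y : Phase) : Phase
  | x => y x
  | t k => y (t (k - 1))
  | d i => C.bwdAux g i y (d i)

theorem bwdAux_agree (g : ℝ × ℝ × ℝ → ℝ) (y : Phase) (i : ℕ) :
    C.bwdAux g i y x = y x ∧ (∀ k, C.bwdAux g i y (t k) = y (t (k - 1))) ∧
      ∀ l ≤ i, C.bwdAux g i y (d l) = C.bwd g y (d l) := by
  induction i with
  | zero => exact ⟨rfl, fun _ => rfl, fun l hl => by obtain rfl : l = 0 := by omega
                                                     rfl⟩
  | succ i ih =>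
    refine ⟨by simp [bwdAux, ih.1], fun k => by simp [bwdAux, ih.2.1], fun l hl => ?_⟩
    rcases Nat.lt_or_ge i l with h | h
    · obtain rfl : l = i + 1 := by omega
      rfl
    · rw [← ih.2.2 l h]
      have : (d l) ≠ d (i + 1) := by simp; omega
      simp [bwdAux, this]

theorem bwd_low (g : ℝ × ℝ × ℝ → ℝ) (y : Phase) (i : ℕ) :
    ∀ v ∈ low i, C.bwdAux g i y v = C.bwd g y v := by
  rintro v (hv | hv | ⟨l, hl, hv⟩) <;> subst hv
  · exact (C.bwdAux_agree g y i).2.1 _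
  · exact (C.bwdAux_agree g y i).2.1 _
  · exact (C.bwdAux_agree g y i).2.2 l hl

theorem bwd_succ (g : ℝ × ℝ × ℝ → ℝ) (y : Phase) (i : ℕ) :
    C.bwd g y (d (i + 1)) =
      (y (d (i + 1)) - C.rest i (C.bwd g y)) / C.lead (C.bwd g y) := by
  rw [← C.rest_dep i (C.bwd_low g y i), ← C.lead_dep i (C.bwd_low g y i)]
  simp [bwd, bwdAux]

theorem fwd_bwd (g : ℝ × ℝ × ℝ → ℝ) (y : Phase) (h1 : C.bwd g y ∈ C.dom)
    (h2 : C.f (y (t (-1)), y (t 0), g (y (t (-1)), y (t 0), y (d 0))) = y (d 0)) :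
    C.fwd (C.bwd g y) = y := by
  funext v
  match v with
  | x => rfl
  | t k => simp [fwd, bwd]
  | d 0 => simpa [fwd, bwd, fJet, bwdAux] using h2
  | d (i + 1) =>
    have := C.lead_ne_zero h1
    change C.fJet (i + 1) (C.bwd g y) = _
    rw [fJet_succ, bwd_succ]
    field_simp
    ring

theorem bwd_fwd (g : ℝ × ℝ × ℝ → ℝ) (y : Phase) (h1 : y ∈ C.dom)
    (h2 : g (y (t 0), y (t 1), C.f (y (t 0), y (t 1), y (d 0))) = y (d 0)) :
    C.bwd g (C.fwd y) = y := by
  have ht : ∀ k, C.bwd g (C.fwd y) (t k) = y (t k) := fun k => by simp [fwd, bwd]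
  have hd : ∀ i, ∀ l ≤ i, C.bwd g (C.fwd y) (d l) = y (d l) := by
    intro i
    induction i with
    | zero =>
      intro l hl
      obtain rfl : l = 0 := by omega
      simpa [fwd, bwd, fJet, bwdAux] using h2
    | succ i ih =>
      intro l hl
      rcases Nat.lt_or_ge i l with h | h
      · obtain rfl : l = i + 1 := by omega
        have hlow : ∀ v ∈ low i, C.bwd g (C.fwd y) v = y v := by
          rintro v (hv | hv | ⟨l, hl, hv⟩) <;> subst hv
          · exact ht 0
          · exact ht 1
          · exact ih l hl
        have hne := C.lead_ne_zero h1
        rw [bwd_succ, C.rest_dep i hlow, C.lead_dep i hlow]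
        change (C.fJet (i + 1) y - _) / _ = _
        rw [fJet_succ]
        field_simp
        ring
      · exact ih l h
  funext v
  match v with
  | x => rfl
  | t k => exact ht k
  | d i => exact hd i i le_rfl

theorem smooth_fwd {p : Phase} (hp : p ∈ C.dom) (v : Var) :
    SmoothIn Set.univ p (fun y => C.fwd y v) :=
  match v with
  | x => smoothIn_coord (Set.mem_univ _) p
  | t _ => smoothIn_coord (Set.mem_univ _) p
  | d i => C.smooth_fJet i p hp

end Chain

theorem tendsto_of_smooth {p q : Phase} {φ : Phase → Phase}
    (hφ : ∀ v, SmoothIn Set.univ p (fun y => φ y v)) (hpq : φ p = q) :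
    Tendsto φ (𝓝 p) (𝓝 q) := by
  rw [← hpq]
  exact tendsto_pi_nhds.2 fun v => (hφ v).continuousAt

theorem SmoothIn.comp_map {p q : Phase} {φ : Phase → Phase}
    (hφ : ∀ v, SmoothIn Set.univ p (fun y => φ y v)) (hpq : φ p = q) {h : Phase → ℝ}
    (hh : SmoothIn Set.univ q h) : SmoothIn Set.univ p (fun y => h (φ y)) := by
  obtain ⟨s, -, H, h1, h2⟩ := hh
  refine SmoothIn.congr (SmoothIn.comp_fin (ι := s) (φ := fun v y => φ y v.1)
    (fun v => hφ v.1) (H := H) ?_) ((tendsto_of_smooth hφ hpq).eventually h2)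
  rw [← hpq] at h1
  exact h1

/-- The pullback of germs `h ↦ h ∘ φ` along a smooth map `φ` with `φ p = q`. -/
noncomputable def pullback {p q : Phase} (φ : Phase → Phase)
    (hφ : ∀ v, SmoothIn Set.univ p (fun y => φ y v)) (hpq : φ p = q) : O q →ₐ[ℝ] O p where
  toFun a := ⟨a.1.compTendsto φ (tendsto_of_smooth hφ hpq), by
    obtain ⟨_, h, hh, rfl⟩ := a
    exact ⟨_, hh.comp_map hφ hpq, rfl⟩⟩
  map_one' := rfl
  map_mul' a b := by
    induction a using O.ind with | H h hh => ?_
    induction b using O.ind with | H k hk => ?_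
    rfl
  map_zero' := rfl
  map_add' a b := by
    induction a using O.ind with | H h hh => ?_
    induction b using O.ind with | H k hk => ?_
    rfl
  commutes' r := by
    rw [Algebra.algebraMap_eq_smul_one, Algebra.algebraMap_eq_smul_one]
    rfl

namespace Chain

open Var

variable (C : Chain)

/-- The inverse shift at a point `p` as a germ at the shifted point `q`. -/
theorem exists_bwd {p q : Phase} (hp : p ∈ C.dom) (hpq : C.fwd p = q) : ∃ β : Phase → Phase,
    (∀ v, SmoothIn Set.univ q (fun y => β y v)) ∧ β q = p ∧
      (∀ᶠ y in 𝓝 q, C.fwd (β y) = y) ∧ (∀ᶠ y in 𝓝 p, β (C.fwd y) = y) := by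
  subst hpq
  obtain ⟨g, hg1, hg2, hg3⟩ := C.exists_inverse hp
  have hcp : Continuous fun y : Phase => (y (t 0), y (t 1), y (d 0)) := by fun_prop
  have hcq : Continuous fun y : Phase => (y (t (-1)), y (t 0), y (d 0)) := by fun_prop
  have hq : ((C.fwd p) (t (-1)), (C.fwd p) (t 0), (C.fwd p) (d 0)) =
    (p (t 0), p (t 1), C.f (p (t 0), p (t 1), p (d 0))) := by simp [fwd, fJet]
  have hleft : ∀ᶠ y in 𝓝 p, C.bwd g (C.fwd y) = y := by
    filter_upwards [C.dom_mem_nhds hp, hcp.continuousAt.eventually hg3] with y h1 h2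
    exact C.bwd_fwd g y h1 h2
  have hβq : C.bwd g (C.fwd p) = p := hleft.self_of_nhds
  have hcoord : ∀ v : Var, SmoothIn Set.univ (C.fwd p) (fun y => y v) := fun v =>
    smoothIn_coord (Set.mem_univ _) _
  have hdom : ∀ i, C.bwdAux g i (C.fwd p) ∈ C.dom := by
    intro i
    have h : ∀ v ∈ low i, C.bwdAux g i (C.fwd p) v = p v := fun v hv => by
      rw [C.bwd_low g _ i v hv, hβq]
    change (_, _, _) ∈ C.Ω
    rw [h (t 0) (by simp [low]), h (t 1) (by simp [low]), h (d 0) (by simp [low])]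
    exact hp
  have haux : ∀ i v, SmoothIn Set.univ (C.fwd p) (fun y => C.bwdAux g i y v) := by
    intro i
    induction i with
    | zero =>
      intro v
      match v with
      | x => exact hcoord _
      | t k => exact hcoord _
      | d 0 =>
        refine SmoothIn.comp₃ (hcoord _) (hcoord _) (hcoord _) ?_
        rw [hq]; exact hg1
      | d (_ + 1) => exact smoothIn_const _ 0
    | succ i ih =>
      intro v
      by_cases hv : v = d (i + 1)
      · subst hv
        simp only [bwdAux, Function.update_self]
        exact ((hcoord _).sub (SmoothIn.comp_map ih rfl (C.smooth_rest i (hdom i)))).div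
          (SmoothIn.comp_map ih rfl (C.smooth_lead (hdom i))) (C.lead_ne_zero (hdom i))
      · simp only [bwdAux, Function.update_of_ne hv]
        exact ih v
  have hβ : ∀ v, SmoothIn Set.univ (C.fwd p) (fun y => C.bwd g y v) := fun v =>
    match v with
    | x => hcoord _
    | t _ => hcoord _
    | d i => haux i (d i)
  refine ⟨C.bwd g, hβ, hβq, ?_, hleft⟩
  have h1 : ∀ᶠ y in 𝓝 (C.fwd p), C.bwd g y ∈ C.dom :=
    (tendsto_of_smooth hβ hβq).eventually (C.dom_mem_nhds hp)
  have h2 := (hcq.continuousAt (x := C.fwd p)).eventually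
    (p := fun z => C.f (z.1, z.2.1, g z) = z.2.2) (by
      change ∀ᶠ z in 𝓝 ((C.fwd p) (t (-1)), (C.fwd p) (t 0), (C.fwd p) (d 0)), _
      rw [hq]; exact hg2)
  filter_upwards [h1, h2] with y h1 h2
  exact C.fwd_bwd g y h1 h2

/-- The pullback along the shift is an isomorphism of algebras of germs. -/
theorem pullback_fwd_bijective {p q : Phase} (hp : p ∈ C.dom) (hpq : C.fwd p = q) :
    Function.Bijective (pullback C.fwd (C.smooth_fwd hp) hpq) := by
  obtain ⟨β, h1, h2, h3, h4⟩ := C.exists_bwd hp hpq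
  have ht := tendsto_of_smooth (C.smooth_fwd hp) hpq
  have ht' := tendsto_of_smooth h1 h2
  refine Function.bijective_iff_has_inverse.2 ⟨pullback β h1 h2, fun a => ?_, fun a => ?_⟩
  · induction a using O.ind with | H h hh => ?_
    refine Subtype.ext (Germ.coe_eq.2 ?_)
    filter_upwards [h3] with y hy
    exact congrArg h hy
  · induction a using O.ind with | H h hh => ?_
    refine Subtype.ext (Germ.coe_eq.2 ?_)
    filter_upwards [h4] with y hy
    exact congrArg h hy

/-- The germ of the shift as an isomorphism `h ↦ h ∘ fwd`. -/
noncomputable def shiftEquiv {p q : Phase} (hp : p ∈ C.dom) (hpq : C.fwd p = q) :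
    O q ≃ₐ[ℝ] O p :=
  AlgEquiv.ofBijective _ (C.pullback_fwd_bijective hp hpq)

/-- The point with coordinates `x = x₀`, `t_k = u (n + k) 0`, `t_{[i]} = u n i` (`i ≥ 1`). -/
def point (x₀ : ℝ) (u : ℤ → ℕ → ℝ) (n : ℤ) : Phase
  | x => x₀
  | t k => u (n + k) 0
  | d i => u n (i + 1)

/-- A background of the chain: a value `x₀` of `x` and values `u n i` of `D_x^i t(n, x)`, for all
`n : ℤ` and `i : ℕ`, compatible with the chain `t_{1x} = f(t, t_1, t_x)` and all its differential
consequences. The theory is local, in a neighbourhood of the background. -/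
structure Background where
  x₀ : ℝ
  u : ℤ → ℕ → ℝ
  mem_Ω : ∀ n, (u n 0, u (n + 1) 0, u n 1) ∈ C.Ω
  compatible : ∀ n i, u (n + 1) (i + 1) = C.fJet i (point x₀ u n)

namespace Background

variable {C} (B : C.Background)

/-- The background in the dynamical variables at the site `n`. -/
def pt (n : ℤ) : Phase := point B.x₀ B.u n

theorem pt_mem (n : ℤ) : B.pt n ∈ C.dom := by
  simpa [dom, pt, point] using B.mem_Ω n

theorem fwd_pt {m n : ℤ} (h : m = n + 1) : C.fwd (B.pt n) = B.pt m := by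
  subst h
  funext v
  match v with
  | x => rfl
  | t k => simp [fwd, pt, point]; congr 1; ring
  | d i => exact (B.compatible n i).symm

/-- Locally smooth functions of `n` and of the dynamical variables: for every `n`, a germ at the
background at the site `n`. -/
abbrev Fun : Type := ∀ n : ℤ, O (B.pt n)

/-- The shift operator `D`, `(D h)(n, x, t_k, t_x, t_xx, …) = h(n + 1, x, t_{k+1}, f, f_x, …)`. -/
noncomputable def D : B.Fun ≃ₐ[ℝ] B.Fun :=
  AlgEquiv.ofRingEquiv (f :=
    { toFun := fun h n => C.shiftEquiv (B.pt_mem n) (B.fwd_pt rfl) (h (n + 1))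
      invFun := fun h n =>
        (C.shiftEquiv (B.pt_mem (n - 1)) (B.fwd_pt (sub_add_cancel n 1).symm)).symm (h (n - 1))
      left_inv := fun h => by
        funext n
        have : ∀ m (hm : n = m + 1),
            (C.shiftEquiv (B.pt_mem m) (B.fwd_pt hm)).symm
              (C.shiftEquiv (B.pt_mem m) (B.fwd_pt rfl) (h (m + 1))) = h n := by
          rintro m rfl
          simp
        exact this (n - 1) (sub_add_cancel n 1).symm
      right_inv := fun h => by
        funext n
        have : ∀ m (hm : n + 1 = m + 1),
            C.shiftEquiv (B.pt_mem n) (B.fwd_pt rfl)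
              ((C.shiftEquiv (B.pt_mem m) (B.fwd_pt hm)).symm (h m)) = h n := by
          intro m hm
          obtain rfl : n = m := by omega
          simp
        exact this (n + 1 - 1) (sub_add_cancel (n + 1) 1).symm
      map_mul' := fun h k => by funext n; exact map_mul _ _ _
      map_add' := fun h k => by funext n; exact map_add _ _ _ })
    (fun r => by funext n; exact AlgEquiv.commutes (C.shiftEquiv (B.pt_mem n) (B.fwd_pt rfl)) r)

/-- The operator `∂/∂t_1`. -/
noncomputable def dt1 (h : B.Fun) : B.Fun := fun n => partialD (t 1) (h n)

/-- The operator `D^{-j} ∂/∂t_1 D^j`. -/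
noncomputable def conj (j : ℕ) (h : B.Fun) : B.Fun := B.D.symm^[j] (B.dt1 (B.D^[j] h))

/-- The coordinate function `v`, at all sites. -/
noncomputable def coordFun (v : Var) : B.Fun := fun n => coord (B.pt n) v

/-- The operator `Y_j = D^{-j} ∂/∂t_1 D^j` on functions of `x, n, t, t_x, t_xx, …`, as a vector
field (at the site `n`):
`Y_j = Y_j(t) ∂/∂t + Y_j(t_x) ∂/∂t_x + Y_j(t_xx) ∂/∂t_xx + ⋯`. -/
noncomputable def Y (n : ℤ) (j : ℕ) : Derivation ℝ (O (B.pt n)) (O (B.pt n)) :=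
  vectorField fun v => match v with
    | x => 0
    | t k => if k = 0 then B.conj j (B.coordFun (t 0)) n else 0
    | d i => B.conj j (B.coordFun (d i)) n

/-- The operator `X_j = ∂/∂t_{-j}` (at the site `n`). -/
noncomputable def X (n : ℤ) (j : ℕ) : Derivation ℝ (O (B.pt n)) (O (B.pt n)) :=
  partialD (t (-(j : ℤ)))

/-- The linear envelope of `Y_1, Y_2, …`: linear combinations with functional coefficients. -/
noncomputable def Yspan (n : ℤ) :
    Submodule (O (B.pt n)) (Derivation ℝ (O (B.pt n)) (O (B.pt n))) :=
  Submodule.span (O (B.pt n)) (B.Y n '' Set.Ici 1)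

/-- The Lie algebra `L_n` generated by `Y_1, …, Y_N, X_1, …, X_N`: all linear combinations, with
functional coefficients, of these operators and their multiple commutators. -/
noncomputable def charAlgebra (N : ℕ) (n : ℤ) :
    Submodule (O (B.pt n)) (Derivation ℝ (O (B.pt n)) (O (B.pt n))) :=
  Submodule.span (O (B.pt n))
    (LieSubalgebra.lieSpan ℝ (Derivation ℝ (O (B.pt n)) (O (B.pt n)))
      (B.Y n '' Set.Icc 1 N ∪ B.X n '' Set.Icc 1 N) :
        Set (Derivation ℝ (O (B.pt n)) (O (B.pt n))))

/-- An `n`-integral: a function `I = I(x, n, t, t_x, t_xx, …)` with `D I = I`. -/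
def IsNIntegral (I : B.Fun) : Prop :=
  (∀ n, (I n : Germ (𝓝 (B.pt n)) ℝ) ∈ smoothGerms ({x, t 0} ∪ Set.range d) (B.pt n)) ∧ B.D I = I

/-- An `n`-integral is trivial if it is a function of `x` (and `n`) only. -/
def IsTrivial (I : B.Fun) : Prop :=
  ∀ n, (I n : Germ (𝓝 (B.pt n)) ℝ) ∈ smoothGerms {x} (B.pt n)

/-- The variables `t, t_x, t_xx, …`. -/
def jetVar : ℕ → Var
  | 0 => t 0
  | i + 1 => d i

/-- The `r × r` minor of the coefficients of the vector fields `Z` at `∂/∂t, ∂/∂t_x, …`, with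
columns `v`. -/
noncomputable def minor {p : Phase} {r : ℕ} (Z : Fin r → Derivation ℝ (O p) (O p))
    (v : Fin r → ℕ) : O p :=
  Matrix.det (Matrix.of fun a b => Z a (coord p (jetVar (v b))))

/-- A family `A n` of sets of vector fields (one for each site) has constant rank: the rank of
their `∂/∂t, ∂/∂t_x, …`-parts is constant near the background and the same at all sites. That is,
if it is less than `r` at the background at some site (all `r × r` minors vanish there), then it is
less than `r` near the background at all sites (all `r × r` minors vanish identically). -/
def ConstantRank (A : ∀ n, Set (Derivation ℝ (O (B.pt n)) (O (B.pt n)))) : Prop :=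
  ∀ r : ℕ,
    (∃ n, ∀ Z : Fin r → Derivation ℝ (O (B.pt n)) (O (B.pt n)), (∀ a, Z a ∈ A n) →
      ∀ v, (minor Z v).value = 0) →
    ∀ n, ∀ Z : Fin r → Derivation ℝ (O (B.pt n)) (O (B.pt n)), (∀ a, Z a ∈ A n) →
      ∀ v, minor Z v = 0

/-- The background is generic: the systems of vector fields `Y_1, …, Y_k` (for each `k`), and the
Lie algebra generated by all `Y_j` and `X_j`, have constant rank. -/
def IsGeneric : Prop :=
  (∀ k : ℕ, B.ConstantRank fun n => B.Y n '' Set.Icc 1 k) ∧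
  B.ConstantRank fun n =>
    (LieSubalgebra.lieSpan ℝ (Derivation ℝ (O (B.pt n)) (O (B.pt n)))
      (B.Y n '' Set.Ici 1 ∪ B.X n '' Set.Ici 1) :
        Set (Derivation ℝ (O (B.pt n)) (O (B.pt n))))

end Background

end Chain

end SemiDiscrete

/-! Let `Φ_j = D^{-j} ∂/∂t_1 D^j` act on all functions. Evaluated on coordinates, `Φ_1 = Y_1` and
`Φ_{j+1} = Y_{j+1} + X_j` for `j ≥ 1`. Hence the conjugation `Z ↦ D^{-1} Z D` sends `X_j` to
`X_{j+1}`, `Y_j` to `Y_{j+1}` for `j ≥ 2`, and `Y_1` to `Y_2 + X_1`. An `n`-integral is killed by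
`∂/∂t_1`, hence by every `Φ_j`, hence by the Lie algebra `L` generated by all `Y_j` and `X_j`. So
integrals are to be sought among the first integrals of `L`. "Rank" below refers to the coefficients
at `∂/∂t, ∂/∂t_x, …`; the `X_j` have none.

Germs do not form a field, but `O p` is local and reduced. Genericity gives a dichotomy: either some
`r × r` minor is a unit at every site, or all of them vanish at every site. Linear algebra then
works through invertible blocks and Schur complements.

Necessity. `D_x` maps integrals to integrals, so all `D_x^k I` are killed by `L`. If `I` has exact
order `m`, then `D_x^k I` has order `m + k` with the same leading coefficient `c ≠ 0`. Each equation
`Z (D_x^k I) = 0` expresses `c` times the coefficient of `Z` at order `m + k` through lower ones. So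
a power of `c` kills every minor of size `m + 1`; reducedness forbids a unit minor
(`not_isUnit_minor_of_annihilate`), and the rank of `L` is finite. Consequently the `Y_j` are
spanned by the first `N` of them (`exists_Yspan_basis`), and `L_n` is generated by finitely many
fields (`finite_charAlgebra`).

Sufficiency. Condition 1 puts every `Y_j` in the span of `Y_1, …, Y_N`. For `j > N` the field `X_j`
commutes with `L_n`, so `L` has the same coefficients at `∂/∂t, ∂/∂t_x, …` as `L_n`, and its rank is
finite. A normalized frame of `L` restricts to finitely many variables, where Frobenius' theorem
yields a nontrivial first integral at the site `0` (`exists_common_firstIntegral`). It is carried to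
the other sites by the powers of `D`. The point to check is that no dependence on `t_{-1}` appears
under `D^{-1}`; this follows from the equality of the ranks of `L` at neighbouring sites
(`IsInvariant.X_one_shift_symm`).

Frobenius' theorem is proved by solving the integral equation of paths in the leaves with the
inverse function theorem in a space of continuous functions. -/

/-! ### Smoothness of the superposition operator `u ↦ f ∘ u` on `C(K, E)`. -/

section Superposition

variable {K E F : Type} [TopologicalSpace K] [CompactSpace K]
  [NormedAddCommGroup E] [NormedSpace ℝ E] [NormedAddCommGroup F] [NormedSpace ℝ F]

/-- Pointwise application of a family of continuous linear maps. -/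
noncomputable def ContinuousMap.evalCLM₂ : C(K, E →L[ℝ] F) →L[ℝ] C(K, E) →L[ℝ] C(K, F) :=
  LinearMap.mkContinuous₂
    (LinearMap.mk₂ ℝ (fun (A : C(K, E →L[ℝ] F)) (h : C(K, E)) =>
        (⟨fun s => A s (h s), by fun_prop⟩ : C(K, F)))
      (fun _ _ _ => by ext; simp) (fun _ _ _ => by ext; simp)
      (fun _ _ _ => by ext; simp) (fun _ _ _ => by ext; simp))
    1 (fun A h => by
      rw [ContinuousMap.norm_le _ (by positivity), one_mul]
      intro s
      exact (A s).le_of_opNorm_le_of_le (A.norm_coe_le_norm s) (h.norm_coe_le_norm s))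

@[simp]
theorem ContinuousMap.evalCLM₂_apply (A : C(K, E →L[ℝ] F)) (h : C(K, E)) (s : K) :
    ContinuousMap.evalCLM₂ A h s = A s (h s) := rfl

/-- The mean value inequality is applied at each `s` on a ball around `u s`. The bound is uniform in
`s` because `v ↦ f' ∘ v` is continuous for the sup norm, `K` being compact; `E` need not be locally
compact. -/
theorem ContinuousMap.hasFDerivAt_comp {f : C(E, F)} {f' : C(E, E →L[ℝ] F)}
    (hf : ∀ z, HasFDerivAt f (f' z) z) (u : C(K, E)) :
    HasFDerivAt (fun u : C(K, E) => f.comp u) (ContinuousMap.evalCLM₂ (f'.comp u)) u := by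
  rw [hasFDerivAt_iff_isLittleO_nhds_zero, Asymptotics.isLittleO_iff]
  intro ε hε
  have hcont : ContinuousAt (fun v : C(K, E) => f'.comp v) u :=
    (ContinuousMap.continuous_postcomp f').continuousAt
  obtain ⟨δ, hδ, hball⟩ := (Metric.continuousAt_iff (f := fun v : C(K, E) => f'.comp v)
    (a := u)).1 hcont ε hε
  filter_upwards [Metric.ball_mem_nhds (0 : C(K, E)) hδ] with h hh
  rw [ContinuousMap.norm_le _ (by positivity)]
  intro s
  have hs : ‖h s‖ < δ := (h.norm_coe_le_norm s).trans_lt (by simpa using hh)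
  have key := (convex_ball (u s) δ).norm_image_sub_le_of_norm_hasFDerivWithin_le' (f := f)
    (f' := f') (φ := f' (u s)) (C := ε) (x := u s) (y := u s + h s)
    (fun z _ => (hf z).hasFDerivWithinAt) (fun z hz => by
      -- The translate of `u` by the constant `z - u s` stays in the `δ`-ball and takes the value
      -- `z` at `s`, so the uniform estimate bounds `f' z - f' (u s)`.
      have h1 : dist (u + ContinuousMap.const K (z - u s)) u < δ := by
        rw [dist_eq_norm, add_sub_cancel_left]
        refine (ContinuousMap.norm_lt_iff _ hδ).2 fun _ => ?_
        simpa [dist_eq_norm] using hz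
      have h2 := (ContinuousMap.dist_lt_iff hε).1 (hball h1) s
      simp only [ContinuousMap.comp_apply, ContinuousMap.add_apply, ContinuousMap.const_apply,
        add_sub_cancel, dist_eq_norm] at h2
      exact h2.le) (Metric.mem_ball_self hδ) (by simpa [dist_eq_norm] using hs)
  simp only [add_sub_cancel_left] at key
  refine (key : ‖f (u s + h s) - f (u s) - f' (u s) (h s)‖ ≤ _).trans ?_
  exact mul_le_mul_of_nonneg_left (h.norm_coe_le_norm s) hε.le

/-- The derivative at `u` is `evalCLM₂` applied to the superposition `f' ∘ u`, one order of
smoothness lower. The induction therefore passes from `F` to `E →L[ℝ] F`, and the target space is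
quantified inside it. -/
theorem ContinuousMap.contDiff_comp_nat (n : ℕ) : ∀ {F : Type} [NormedAddCommGroup F]
    [NormedSpace ℝ F] {f : C(E, F)} (_ : ContDiff ℝ n f),
    ContDiff ℝ n (fun u : C(K, E) => f.comp u) := by
  induction n with
  | zero =>
    intro F _ _ f hf
    exact contDiff_zero.2 (ContinuousMap.continuous_postcomp f)
  | succ n ih =>
    intro F _ _ f hf
    obtain ⟨f', hf', hd⟩ := contDiff_succ_iff_hasFDerivAt.1 hf
    refine contDiff_succ_iff_hasFDerivAt.2
      ⟨fun u => ContinuousMap.evalCLM₂ ((⟨f', hf'.continuous⟩ : C(E, E →L[ℝ] F)).comp u), ?_,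
        fun u => ContinuousMap.hasFDerivAt_comp hd u⟩
    exact ContinuousMap.evalCLM₂.contDiff.comp
      (ih (f := (⟨f', hf'.continuous⟩ : C(E, E →L[ℝ] F))) hf')

theorem ContinuousMap.contDiff_comp {f : C(E, F)} (hf : ContDiff ℝ ∞ f) :
    ContDiff ℝ ∞ (fun u : C(K, E) => f.comp u) :=
  contDiff_infty.2 fun n => ContinuousMap.contDiff_comp_nat n (contDiff_infty.1 hf n)

end Superposition

/-! ### Frobenius' theorem by the inverse function theorem on a path space. -/

section Frobenius

open intervalIntegral

variable {E : Type} [NormedAddCommGroup E] [NormedSpace ℝ E]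

/-- The integral `s ↦ ∫_0^s u` as an operator on continuous functions on the unit interval. -/
noncomputable def unitInterval.primitiveCLM [CompleteSpace E] :
    C(unitInterval, E) →L[ℝ] C(unitInterval, E) :=
  LinearMap.mkContinuous
    { toFun := fun u => ⟨fun s => ∫ σ in (0 : ℝ)..s, u (Set.projIcc 0 1 zero_le_one σ), by
        have hc : Continuous fun σ : ℝ => u (Set.projIcc 0 1 zero_le_one σ) :=
          u.continuous.comp continuous_projIcc
        exact (continuous_primitive (fun a b => hc.intervalIntegrable a b) 0).comp
          continuous_subtype_val⟩
      map_add' := fun u v => by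
        ext s
        have hc : ∀ u : C(unitInterval, E),
            Continuous fun σ : ℝ => u (Set.projIcc 0 1 zero_le_one σ) :=
          fun u => u.continuous.comp continuous_projIcc
        exact integral_add ((hc u).intervalIntegrable _ _) ((hc v).intervalIntegrable _ _)
      map_smul' := fun r u => by
        ext s
        exact integral_smul r _ }
    1 (fun u => by
      rw [ContinuousMap.norm_le _ (by positivity), one_mul]
      intro s
      refine (norm_integral_le_of_norm_le_const (C := ‖u‖) fun σ _ =>
        u.norm_coe_le_norm _).trans ?_
      rw [sub_zero, abs_of_nonneg s.2.1]
      exact mul_le_of_le_one_right (norm_nonneg _) s.2.2)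

theorem unitInterval.primitiveCLM_apply [CompleteSpace E] (u : C(unitInterval, E))
    (s : unitInterval) : unitInterval.primitiveCLM u s =
      ∫ σ in (0 : ℝ)..s, u (Set.projIcc 0 1 zero_le_one σ) := rfl

/-- Constant functions, as a continuous linear map. -/
noncomputable def unitInterval.constCLM : E →L[ℝ] C(unitInterval, E) :=
  LinearMap.mkContinuous
    { toFun := fun z => ContinuousMap.const _ z
      map_add' := fun _ _ => rfl
      map_smul' := fun _ _ => rfl } 1 (fun z => by
      rw [ContinuousMap.norm_le _ (by positivity), one_mul]
      intro s
      exact le_rfl)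

@[simp]
theorem unitInterval.constCLM_apply (z : E) (s : unitInterval) :
    unitInterval.constCLM z s = z := rfl

/-- A function that is smooth near a point agrees near this point with a globally smooth one. -/
theorem exists_contDiff_eventuallyEq {F : Type} [NormedAddCommGroup F] [NormedSpace ℝ F]
    [FiniteDimensional ℝ E] {z₀ : E} {c : E → F} (hc : ∀ᶠ z in 𝓝 z₀, ContDiffAt ℝ ∞ c z) :
    ∃ c' : E → F, ContDiff ℝ ∞ c' ∧ c' =ᶠ[𝓝 z₀] c := by
  obtain ⟨ρ, hρ, hb⟩ := Metric.eventually_nhds_iff_ball.1 hc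
  let χ : ContDiffBump z₀ := ⟨ρ / 4, ρ / 2, by positivity, by linarith⟩
  refine ⟨fun z => χ z • c z, contDiff_iff_contDiffAt.2 fun z => ?_, ?_⟩
  · by_cases hz : z ∈ Metric.ball z₀ ρ
    · exact χ.contDiff.contDiffAt.smul (hb z hz)
    · have hz' : z ∈ (Metric.closedBall z₀ (ρ / 2))ᶜ := fun h =>
        hz (Metric.closedBall_subset_ball (by linarith) h)
      refine (contDiffAt_const (c := (0 : F))).congr_of_eventuallyEq ?_
      filter_upwards [Metric.isClosed_closedBall.isOpen_compl.mem_nhds hz'] with y hy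
      have : χ y = 0 := χ.zero_of_le_dist (by
        simp only [mem_compl_iff, Metric.mem_closedBall, not_le] at hy
        exact hy.le)
      rw [this, zero_smul]
  · filter_upwards [χ.eventuallyEq_one] with z hz
    simp only [Pi.one_apply] at hz
    rw [hz, one_smul]


/-- First integrals of a Frobenius system are obtained by following the leaves up to a transversal:
`Φ (z, u) = 0` says that `u` is the path in the leaf of `z` above the segment from `z` to `z₀`. -/
noncomputable def leafEquation [CompleteSpace E] (z₀ : E) (c : C(E, E →L[ℝ] E))
    (q : E × C(unitInterval, E)) : C(unitInterval, E) :=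
  q.2 - unitInterval.constCLM q.1 -
    unitInterval.primitiveCLM (ContinuousMap.evalCLM₂ (c.comp q.2)
      (unitInterval.constCLM (z₀ - q.1)))

theorem contDiff_leafEquation [CompleteSpace E] (z₀ : E) {c : C(E, E →L[ℝ] E)}
    (hc : ContDiff ℝ ∞ c) : ContDiff ℝ ∞ (leafEquation z₀ c) := by
  have h1 : ContDiff ℝ ∞ (fun q : E × C(unitInterval, E) => c.comp q.2) :=
    (ContinuousMap.contDiff_comp hc).comp contDiff_snd
  have h2 : ContDiff ℝ ∞ (fun q : E × C(unitInterval, E) =>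
      unitInterval.constCLM (z₀ - q.1)) :=
    (unitInterval.constCLM (E := E)).contDiff.comp (contDiff_const.sub contDiff_fst)
  exact (contDiff_snd.sub (unitInterval.constCLM.contDiff.comp contDiff_fst)).sub
    (unitInterval.primitiveCLM.contDiff.comp
      ((ContinuousMap.evalCLM₂.contDiff.comp h1).clm_apply h2))

theorem ContinuousLinearMap.hasFDerivAt_comp_left {X G H : Type} [NormedAddCommGroup X]
    [NormedSpace ℝ X] [NormedAddCommGroup G] [NormedSpace ℝ G] [NormedAddCommGroup H]
    [NormedSpace ℝ H] (Λ : G →L[ℝ] H) {f : X → G} {f' : X →L[ℝ] G} {q : X}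
    (h : HasFDerivAt f f' q) : HasFDerivAt (fun q => Λ (f q)) (Λ.comp f') q :=
  Λ.hasFDerivAt.comp q h

/-- The derivative is described through its values only: this is the linearized integral equation,
which `leaf_variation` solves explicitly. -/
theorem hasFDerivAt_leafEquation [CompleteSpace E] (z₀ : E) {c : C(E, E →L[ℝ] E)}
    {c' : C(E, E →L[ℝ] E →L[ℝ] E)} (hc : ∀ z, HasFDerivAt c (c' z) z)
    (q : E × C(unitInterval, E)) :
    ∃ L : E × C(unitInterval, E) →L[ℝ] C(unitInterval, E),
      HasFDerivAt (leafEquation z₀ c) L q ∧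
      ∀ h k, L (h, k) = k - unitInterval.constCLM h -
        unitInterval.primitiveCLM
          (ContinuousMap.evalCLM₂ (ContinuousMap.evalCLM₂ (c'.comp q.2) k)
            (unitInterval.constCLM (z₀ - q.1)) -
          ContinuousMap.evalCLM₂ (c.comp q.2) (unitInterval.constCLM h)) := by
  let A : E × C(unitInterval, E) →L[ℝ] C(unitInterval, E →L[ℝ] E) :=
    (ContinuousMap.evalCLM₂ (c'.comp q.2)).comp (ContinuousLinearMap.snd ℝ _ _)
  let B : E × C(unitInterval, E) →L[ℝ] C(unitInterval, E) :=
    unitInterval.constCLM.comp (-ContinuousLinearMap.fst ℝ _ _)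
  have h1 : HasFDerivAt (fun q : E × C(unitInterval, E) => c.comp q.2) A q :=
    (ContinuousMap.hasFDerivAt_comp hc q.2).comp q hasFDerivAt_snd
  have h2 : HasFDerivAt (fun q : E × C(unitInterval, E) =>
      unitInterval.constCLM (z₀ - q.1)) B q :=
    (unitInterval.constCLM (E := E)).hasFDerivAt.comp q
      ((hasFDerivAt_fst (E := E) (F := C(unitInterval, E)) (p := q)).const_sub z₀)
  let Λ : C(unitInterval, E →L[ℝ] E) →L[ℝ] C(unitInterval, E) →L[ℝ] C(unitInterval, E) :=
    ContinuousMap.evalCLM₂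
  have h3 : HasFDerivAt (fun q : E × C(unitInterval, E) => Λ (c.comp q.2)) (Λ.comp A) q :=
    ContinuousLinearMap.hasFDerivAt_comp_left (X := E × C(unitInterval, E))
      (G := C(unitInterval, E →L[ℝ] E)) (H := C(unitInterval, E) →L[ℝ] C(unitInterval, E)) Λ h1
  have h4 := h3.clm_apply h2
  have h5 := (unitInterval.primitiveCLM (E := E)).hasFDerivAt.comp q h4
  have h6 : HasFDerivAt (fun q : E × C(unitInterval, E) => unitInterval.constCLM q.1)
      ((unitInterval.constCLM (E := E)).comp (ContinuousLinearMap.fst ℝ E C(unitInterval, E))) q :=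
    (unitInterval.constCLM (E := E)).hasFDerivAt.comp q hasFDerivAt_fst
  refine ⟨_, (hasFDerivAt_snd.sub h6).sub h5, fun h k => ?_⟩
  change k - unitInterval.constCLM h - unitInterval.primitiveCLM
    (Λ (c.comp q.2) (unitInterval.constCLM (-h)) +
      Λ (ContinuousMap.evalCLM₂ (c'.comp q.2) k) (unitInterval.constCLM (z₀ - q.1))) = _
  rw [map_neg, map_neg, neg_add_eq_sub]

/-- Along the path in the leaf, the derivative of `leafEquation` in the direction of the leaf. -/
theorem leaf_variation [CompleteSpace E] {z₀ z : E} {c : C(E, E →L[ℝ] E)}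
    {c' : C(E, E →L[ℝ] E →L[ℝ] E)} (hc : ∀ z, HasFDerivAt c (c' z) z) {u : C(unitInterval, E)}
    (hu : leafEquation z₀ c (z, u) = 0) (a : E)
    (hcc : ∀ s, c (u s) (c z a) = c (u s) a)
    (hint : ∀ s b, c' (u s) (c (u s) a) b = c' (u s) (c (u s) b) a) :
    ∃ k : C(unitInterval, E), k 1 = 0 ∧
      k - unitInterval.constCLM (c z a) - unitInterval.primitiveCLM
          (ContinuousMap.evalCLM₂ (ContinuousMap.evalCLM₂ (c'.comp u) k)
            (unitInterval.constCLM (z₀ - z)) -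
          ContinuousMap.evalCLM₂ (c.comp u) (unitInterval.constCLM (c z a))) = 0 := by
  -- The integrand is extended to the whole line, constant beyond the ends, so that `w` extends `u`
  -- and has two-sided derivatives also at `0` and `1`.
  let pr : ℝ → unitInterval := Set.projIcc 0 1 zero_le_one
  have hpr : Continuous pr := continuous_projIcc
  have hprs : ∀ s : unitInterval, pr s = s := fun s => Set.projIcc_val zero_le_one s
  let g : ℝ → E := fun σ => c (u (pr σ)) (z₀ - z)
  have hg : Continuous g := by
    have : Continuous fun σ => c (u (pr σ)) := c.continuous.comp (u.continuous.comp hpr)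
    exact this.clm_apply continuous_const
  let w : ℝ → E := fun s => z + ∫ σ in (0 : ℝ)..s, g σ
  have hw : ∀ s, HasDerivAt w (g s) s := fun s =>
    (integral_hasDerivAt_right (hg.intervalIntegrable _ _) (hg.stronglyMeasurableAtFilter _ _)
      hg.continuousAt).const_add z
  have hwu : ∀ s : unitInterval, w s = u s := fun s => by
    have := congrArg (fun v : C(unitInterval, E) => v s) hu
    simp only [leafEquation, ContinuousMap.sub_apply, ContinuousMap.zero_apply,
      unitInterval.primitiveCLM_apply, unitInterval.constCLM_apply] at this
    have h2 : u s = z + ∫ σ in (0 : ℝ)..s, g σ := by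
      rw [sub_sub, sub_eq_zero] at this
      exact this
    exact h2.symm
  -- When the starting point moves by `a` modulo the constant kernel and the end of the segment
  -- stays fixed, the point at time `s` moves by `(1 - s) a` modulo the kernel. Along the leaf this
  -- is `(1 - s) c(u s) a`, which vanishes at `s = 1`.
  let ζ : ℝ → E := fun s => (1 - s) • c (w s) a
  have hζ : ∀ s, HasDerivAt ζ ((1 - s) • c' (w s) (g s) a - c (w s) a) s := fun s => by
    have h1 : HasDerivAt (fun s => c (w s)) (c' (w s) (g s)) s :=
      (hc (w s)).comp_hasDerivAt s (hw s)
    have h2 := h1.clm_apply (hasDerivAt_const s a)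
    have h3 := ((hasDerivAt_id s).const_sub 1).smul h2
    refine h3.congr_deriv ?_
    simp [sub_eq_add_neg]
  have hζc : Continuous ζ := continuous_iff_continuousAt.2 fun s => (hζ s).continuousAt
  let k : C(unitInterval, E) := ⟨fun s => ζ s, hζc.comp continuous_subtype_val⟩
  refine ⟨k, by simp [k, ζ], ?_⟩
  ext s
  have hint' : ∀ σ ∈ Set.uIcc (0 : ℝ) s, HasDerivAt ζ
      ((ContinuousMap.evalCLM₂ (ContinuousMap.evalCLM₂ (c'.comp u) k)
            (unitInterval.constCLM (z₀ - z)) -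
          ContinuousMap.evalCLM₂ (c.comp u) (unitInterval.constCLM (c z a))) (pr σ)) σ := by
    intro σ hσ
    rw [Set.uIcc_of_le s.2.1] at hσ
    obtain ⟨τ, rfl⟩ : ∃ τ : unitInterval, (τ : ℝ) = σ := ⟨⟨σ, hσ.1, hσ.2.trans s.2.2⟩, rfl⟩
    refine (hζ τ).congr_deriv ?_
    simp only [ContinuousMap.sub_apply, ContinuousMap.evalCLM₂_apply, ContinuousMap.comp_apply,
      unitInterval.constCLM_apply, hprs, hcc]
    have hk : k τ = (1 - (τ : ℝ)) • c (u τ) a := by simp [k, ζ, hwu]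
    -- Integrability exchanges `a` and `z₀ - z` here; this turns the derivative of `ζ` into the
    -- integrand of the linearized equation.
    rw [hk, hwu, map_smul, _root_.smul_apply, hint]
    simp [g, hprs]
  have hci : Continuous fun σ : ℝ => (ContinuousMap.evalCLM₂ (ContinuousMap.evalCLM₂ (c'.comp u) k)
            (unitInterval.constCLM (z₀ - z)) -
          ContinuousMap.evalCLM₂ (c.comp u) (unitInterval.constCLM (c z a))) (pr σ) :=
    (ContinuousMap.continuous _).comp hpr
  have hI := integral_eq_sub_of_hasDerivAt hint' (hci.intervalIntegrable _ _)
  rw [ContinuousMap.sub_apply, ContinuousMap.sub_apply, unitInterval.primitiveCLM_apply]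
  have h0 : ζ 0 = c z a := by
    have : w 0 = u 0 := by simpa using hwu 0
    have hz : w 0 = z := by simp [w]
    have := hcc 0
    rw [← ‹w 0 = u 0›, hz] at this
    simp [ζ, hz]
  refine (congrArg (fun q => k s - unitInterval.constCLM (c z a) s - q) hI).trans ?_
  simp [k, h0]

/-- Frobenius' theorem: `c z` is a projection onto the integrable plane at `z`, with constant
kernel. There are first integrals `I` whose differential at `z₀` is the complementary projection. -/
theorem exists_firstIntegral [FiniteDimensional ℝ E] {z₀ : E} {c : E → E →L[ℝ] E}
    (hc : ∀ᶠ z in 𝓝 z₀, ContDiffAt ℝ ∞ c z)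
    (hcc : ∀ᶠ q : E × E in 𝓝 (z₀, z₀), ∀ a, c q.1 (c q.2 a) = c q.1 a)
    (hint : ∀ᶠ z in 𝓝 z₀, ∀ a b, fderiv ℝ c z (c z a) b = fderiv ℝ c z (c z b) a) :
    ∃ J : E → E, (∀ᶠ z in 𝓝 z₀, ContDiffAt ℝ ∞ J z) ∧
      (∀ᶠ z in 𝓝 z₀, ∀ a, fderiv ℝ J z (c z a) = 0) ∧
      ∀ h, fderiv ℝ J z₀ h = h - c z₀ h := by
  -- The superposition operator requires a globally smooth coefficient, so `c` is replaced by one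
  -- with the same germ at `z₀`.
  obtain ⟨c₁, hc₁, hcc₁⟩ := exists_contDiff_eventuallyEq hc
  let C : C(E, E →L[ℝ] E) := ⟨c₁, hc₁.continuous⟩
  have hC : ContDiff ℝ ∞ C := hc₁
  let C' : C(E, E →L[ℝ] E →L[ℝ] E) := ⟨fderiv ℝ c₁, hc₁.continuous_fderiv (by simp)⟩
  have hCC' : ∀ z, HasFDerivAt C (C' z) z := fun z =>
    (hc₁.differentiable (by simp) z).hasFDerivAt
  let u₀ : C(unitInterval, E) := unitInterval.constCLM z₀
  let Ψ : E × C(unitInterval, E) → E × C(unitInterval, E) := fun q => (q.1, leafEquation z₀ C q)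
  have hΨ : ContDiff ℝ ∞ Ψ := contDiff_fst.prodMk (contDiff_leafEquation z₀ hC)
  have hdΨ : ∀ q, ∀ h k, fderiv ℝ Ψ q (h, k) = (h, k - unitInterval.constCLM h -
        unitInterval.primitiveCLM
          (ContinuousMap.evalCLM₂ (ContinuousMap.evalCLM₂ (C'.comp q.2) k)
            (unitInterval.constCLM (z₀ - q.1)) -
          ContinuousMap.evalCLM₂ (C.comp q.2) (unitInterval.constCLM h))) := by
    intro q h k
    obtain ⟨L, hL, hL'⟩ := hasFDerivAt_leafEquation z₀ hCC' q
    rw [(hasFDerivAt_fst.prodMk hL).fderiv, ← hL']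
    rfl
  -- At `(z₀, u₀)` the term with the derivative of `c` carries the factor `z₀ - z₀ = 0`. The
  -- linearization is then `(h, k) ↦ (h, k + S h)`, which is invertible whatever `c` is.
  let S : E →L[ℝ] C(unitInterval, E) := unitInterval.primitiveCLM.comp
    ((ContinuousMap.evalCLM₂ (C.comp u₀)).comp unitInterval.constCLM) - unitInterval.constCLM
  let e₀ : (E × C(unitInterval, E)) ≃L[ℝ] (E × C(unitInterval, E)) :=
    ContinuousLinearEquiv.skewProd (ContinuousLinearEquiv.refl ℝ _)
      (ContinuousLinearEquiv.refl ℝ _) S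
  have he₀ : fderiv ℝ Ψ (z₀, u₀) = (e₀ : _ →L[ℝ] _) := by
    refine ContinuousLinearMap.ext fun ⟨h, k⟩ => ?_
    rw [hdΨ]
    simp [e₀, S, sub_eq_add_neg, add_comm, add_assoc]
  have hΨ₀ : HasFDerivAt Ψ (e₀ : _ →L[ℝ] _) (z₀, u₀) := by
    rw [← he₀]
    exact (hΨ.differentiable (by simp) _).hasFDerivAt
  let e := hΨ.contDiffAt.toOpenPartialHomeomorph Ψ hΨ₀ (by simp)
  have hes : (z₀, u₀) ∈ e.source :=
    hΨ.contDiffAt.mem_toOpenPartialHomeomorph_source hΨ₀ (by simp)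
  have hΨ0 : Ψ (z₀, u₀) = (z₀, 0) := by
    simp [Ψ, leafEquation, u₀]
  have htgt : ((z₀, 0) : E × C(unitInterval, E)) ∈ e.target := by
    rw [← hΨ0]; exact e.map_source hes
  have hsymm : e.symm (z₀, 0) = (z₀, u₀) := by
    rw [← hΨ0]; exact e.left_inv hes
  have hι : Continuous fun z : E => ((z, 0) : E × C(unitInterval, E)) := by fun_prop
  have hcont : ContinuousAt (fun z : E => e.symm (z, 0)) z₀ :=
    ContinuousAt.comp (g := e.symm) (f := fun z : E => ((z, 0) : E × C(unitInterval, E)))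
      (e.symm.continuousAt htgt) hι.continuousAt
  have hT : Tendsto (fun z : E => e.symm (z, 0)) (𝓝 z₀) (𝓝 (z₀, u₀)) := by
    have := hcont.tendsto
    rwa [hsymm] at this
  have htgt' : ∀ᶠ z : E in 𝓝 z₀, ((z, 0) : E × C(unitInterval, E)) ∈ e.target :=
    hι.continuousAt.eventually (e.open_target.mem_nhds htgt)
  -- Invertibility of the derivative is an open condition. It is needed at all nearby points, since
  -- both the smoothness and the derivative of the first integral are asserted on a neighbourhood.
  have hinv : ∀ᶠ z : E in 𝓝 z₀, ∃ E' : (E × C(unitInterval, E)) ≃L[ℝ] (E × C(unitInterval, E)),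
      fderiv ℝ Ψ (e.symm (z, 0)) = (E' : _ →L[ℝ] _) := by
    have h1 : ContinuousAt (fderiv ℝ Ψ) (z₀, u₀) :=
      (hΨ.continuous_fderiv (by simp)).continuousAt
    have h2 := ContinuousLinearEquiv.nhds e₀
    rw [← he₀] at h2
    filter_upwards [hT.eventually (h1.eventually h2)] with z ⟨E', hE'⟩
    exact ⟨E', hE'.symm⟩
  have hsm : ∀ᶠ z : E in 𝓝 z₀, ContDiffAt ℝ ∞ (fun z : E => e.symm (z, 0)) z := by
    filter_upwards [htgt', hinv] with z hz ⟨E', hE'⟩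
    have h1 : HasFDerivAt e (E' : _ →L[ℝ] _) (e.symm (z, 0)) := by
      rw [← hE']
      exact (hΨ.differentiable (by simp) _).hasFDerivAt
    exact ContDiffAt.comp (g := e.symm) (f := fun z : E => ((z, 0) : E × C(unitInterval, E))) z
      (e.contDiffAt_symm hz h1 hΨ.contDiffAt) (contDiffAt_id.prodMk contDiffAt_const)
  -- The first integral is the endpoint of the path: the point in which the leaf of `z` meets the
  -- transversal through `z₀`.
  let ev : (E × C(unitInterval, E)) →L[ℝ] E :=
    (ContinuousMap.evalCLM ℝ (1 : unitInterval)).comp (ContinuousLinearMap.snd ℝ _ _)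
  have hJd : ∀ᶠ z : E in 𝓝 z₀, ∀ E' : (E × C(unitInterval, E)) ≃L[ℝ] (E × C(unitInterval, E)),
      fderiv ℝ Ψ (e.symm (z, 0)) = (E' : _ →L[ℝ] _) →
      ∀ h, fderiv ℝ (fun z : E => ev (e.symm (z, 0))) z h = ev (E'.symm (h, 0)) := by
    filter_upwards [htgt'] with z hz E' hE' h
    have h1 : HasFDerivAt e (E' : _ →L[ℝ] _) (e.symm (z, 0)) := by
      rw [← hE']
      exact (hΨ.differentiable (by simp) _).hasFDerivAt
    have h2 := e.hasFDerivAt_symm hz h1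
    have h3 : HasFDerivAt (fun z : E => ((z, 0) : E × C(unitInterval, E)))
      (ContinuousLinearMap.inl ℝ _ _) z := (hasFDerivAt_id z).prodMk (hasFDerivAt_const _ _)
    have h4 : HasFDerivAt (fun z : E => e.symm (z, 0)) _ z :=
      HasFDerivAt.comp (g := e.symm) (f := fun z : E => ((z, 0) : E × C(unitInterval, E))) z h2 h3
    have h5 : HasFDerivAt (fun z : E => ev (e.symm (z, 0))) _ z := ev.hasFDerivAt.comp z h4
    rw [h5.fderiv]
    rfl
  refine ⟨fun z => ev (e.symm (z, 0)), ?_, ?_, ?_⟩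
  · filter_upwards [hsm] with z hz
    exact ev.contDiff.contDiffAt.comp z hz
  · obtain ⟨ρ, hρ, hb⟩ := Metric.eventually_nhds_iff_ball.1 (hcc₁.eventuallyEq_nhds.and hint)
    have hnear : ∀ᶠ z : E in 𝓝 z₀, ∀ s, (e.symm (z, 0)).2 s ∈ Metric.ball z₀ ρ := by
      have h1 : Tendsto (fun z : E => (e.symm (z, 0)).2) (𝓝 z₀) (𝓝 u₀) :=
        (continuous_snd.tendsto _).comp hT
      filter_upwards [(Metric.tendsto_nhds (u := fun z : E => (e.symm (z, 0)).2)).1 h1 ρ hρ]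
        with z hz s
      exact (ContinuousMap.dist_lt_iff hρ).1 hz s
    have hcc' : ∀ᶠ z in 𝓝 z₀, ∀ s a, c ((e.symm (z, 0)).2 s) (c z a) =
        c ((e.symm (z, 0)).2 s) a := by
      obtain ⟨P, hP, Q, hQ, hPQ⟩ := eventually_prod_iff.1 (by rwa [nhds_prod_eq] at hcc)
      obtain ⟨δ, hδ, hδb⟩ := Metric.eventually_nhds_iff_ball.1 hP
      have h1 : Tendsto (fun z : E => (e.symm (z, 0)).2) (𝓝 z₀) (𝓝 u₀) :=
        (continuous_snd.tendsto _).comp hT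
      filter_upwards [(Metric.tendsto_nhds (u := fun z : E => (e.symm (z, 0)).2)).1 h1 δ hδ, hQ]
        with z hz hz' s a
      exact hPQ (hδb _ ((ContinuousMap.dist_lt_iff hδ).1 hz s)) hz' a
    filter_upwards [hnear, hcc', htgt', hinv, hJd, hcc₁] with z h1 h2 h3 ⟨E', hE'⟩ h5 h6 a
    have hΨz : Ψ (e.symm (z, 0)) = (z, 0) := e.right_inv h3
    have hfst : (e.symm (z, 0)).1 = z := congrArg Prod.fst hΨz
    have hCu : ∀ s, C ((e.symm (z, 0)).2 s) = c ((e.symm (z, 0)).2 s) := fun s =>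
      (hb _ (h1 s)).1.self_of_nhds
    have hC'u : ∀ s, C' ((e.symm (z, 0)).2 s) = fderiv ℝ c ((e.symm (z, 0)).2 s) := fun s =>
      (hb _ (h1 s)).1.fderiv_eq
    have hCz : C z = c z := h6
    -- The derivative of `Ψ` maps `(c z a, k)` to `(c z a, 0)`. So `k` is the variation of the path
    -- in the direction `c z a`, and its endpoint is zero.
    obtain ⟨k, hk1, hk⟩ := leaf_variation (z₀ := z₀) (z := z) hCC' (u := (e.symm (z, 0)).2)
      (by
        have h8 : (z, (e.symm (z, 0)).2) = e.symm (z, 0) := Prod.ext hfst.symm rfl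
        rw [h8]
        exact congrArg Prod.snd hΨz) a
      (fun s => by rw [hCu, hCz, h2]) (fun s b => by rw [hCu, hC'u]; exact (hb _ (h1 s)).2 a b)
    rw [h5 E' hE']
    have h7 : E' (c z a, k) = (c z a, 0) := by
      have := hdΨ (e.symm (z, 0)) (c z a) k
      rw [hE', hfst, ← hCz, hk] at this
      rw [← hCz]
      exact this
    rw [← h7, E'.symm_apply_apply]
    exact hk1
  · intro h
    have h1 : fderiv ℝ Ψ (e.symm (z₀, 0)) = (e₀ : _ →L[ℝ] _) := by rw [hsymm, he₀]
    rw [hJd.self_of_nhds e₀ h1]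
    -- The endpoint of `-S h` is `h - c z₀ h`, the complementary projection.
    have h2 : e₀ (h, -S h) = (h, 0) := by simp [e₀]
    rw [← h2, e₀.symm_apply_apply]
    have h3 : C z₀ = c z₀ := hcc₁.self_of_nhds
    simp [ev, S, u₀, unitInterval.primitiveCLM_apply, h3]

end Frobenius

namespace SemiDiscrete

/-! ### The local reduced ring of germs and its partial derivatives. -/

section Germs

variable {p : Phase}

theorem O.value_mkO (h : Phase → ℝ) (hh : SmoothIn Set.univ p h) : (mkO h hh).value = h p := rfl

/-- The value at the base point as a homomorphism of rings. -/
noncomputable def O.valueHom (p : Phase) : O p →+* ℝ where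
  toFun := O.value
  map_one' := rfl
  map_mul' a b := by
    induction a using O.ind with | H h hh => ?_
    induction b using O.ind with | H k hk => ?_
    rfl
  map_zero' := rfl
  map_add' a b := by
    induction a using O.ind with | H h hh => ?_
    induction b using O.ind with | H k hk => ?_
    rfl

/-- A nonzero value persists nearby, so the reciprocal is again smooth. Minors that do not vanish at
the background can thus be inverted. -/
theorem O.isUnit_iff {a : O p} : IsUnit a ↔ a.value ≠ 0 := by
  refine ⟨fun h => (h.map (O.valueHom p)).ne_zero, fun h => ?_⟩
  induction a using O.ind with | H k hk => ?_
  have hk0 : k p ≠ 0 := h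
  refine IsUnit.of_mul_eq_one (mkO (fun y => 1 / k y) ((smoothIn_const p 1).div hk hk0)) ?_
  refine Subtype.ext (Germ.coe_eq.2 ?_)
  filter_upwards [hk.continuousAt.eventually_ne hk0] with y hy
  exact mul_one_div_cancel hy

theorem O.eq_zero_of_pow_eq_zero {a : O p} {n : ℕ} (h : a ^ n = 0) : a = 0 := by
  induction a using O.ind with | H k hk => ?_
  have h1 : ((k ^ n : Phase → ℝ) : Germ (𝓝 p) ℝ) = ((0 : Phase → ℝ) : Germ (𝓝 p) ℝ) := by
    have := congrArg Subtype.val h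
    rw [Germ.coe_pow]
    exact this
  refine Subtype.ext (Germ.coe_eq.2 ?_)
  filter_upwards [Germ.coe_eq.1 h1] with y hy
  exact IsReduced.eq_zero _ ⟨n, hy⟩

theorem contDiffAt_of_contDiff {s : Finset Var} {H : (s → ℝ) → ℝ} (hH : ContDiff ℝ ∞ H) :
    SmoothIn Set.univ p fun y => H (s.restrict y) :=
  ⟨s, Set.subset_univ _, H, Eventually.of_forall fun _ => hH.contDiffAt, EventuallyEq.rfl⟩

/-- The germ of a globally smooth function of finitely many variables. -/
noncomputable def ofFin (p : Phase) {s : Finset Var} {H : (s → ℝ) → ℝ} (hH : ContDiff ℝ ∞ H) :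
    O p :=
  mkO (fun y => H (s.restrict y)) (contDiffAt_of_contDiff hH)

/-- A bump function extends a local representative. Global representatives free the later
computations from neighbourhoods. -/
theorem exists_ofFin (a : O p) :
    ∃ (s : Finset Var) (H : (s → ℝ) → ℝ) (hH : ContDiff ℝ ∞ H), a = ofFin p hH := by
  induction a using O.ind with | H h hh => ?_
  obtain ⟨s, -, H, h1, h2⟩ := hh
  obtain ⟨H', h3, h4⟩ := exists_contDiff_eventuallyEq h1
  refine ⟨s, H', h3, mkO_eq (h2.trans ?_)⟩
  filter_upwards [(continuous_restr s).continuousAt.eventually h4] with y hy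
  exact hy.symm

theorem contDiff_fderiv_single {s : Finset Var} {H : (s → ℝ) → ℝ} (hH : ContDiff ℝ ∞ H)
    (e : s → ℝ) : ContDiff ℝ ∞ fun z => fderiv ℝ H z e :=
  (hH.fderiv_right (m := ∞) (by simp)).clm_apply contDiff_const

theorem clm_apply_eq_sum {s : Finset Var} (L : (s → ℝ) →L[ℝ] ℝ) (e : s → ℝ) :
    L e = ∑ v, e v • L (Pi.single v 1) := by
  conv_lhs => rw [pi_eq_sum_univ' e, map_sum]
  exact Finset.sum_congr rfl fun v _ => by
    rw [map_smul]

theorem partialD_mkO (v : Var) (h : Phase → ℝ) (hh : SmoothIn Set.univ p h) :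
    partialD v (mkO h hh) = mkO (pd v h) (hh.pd v) := rfl

theorem partialD_ofFin {s : Finset Var} {H : (s → ℝ) → ℝ} (hH : ContDiff ℝ ∞ H) (v : s) :
    partialD (v : Var) (ofFin p hH) = ofFin p (contDiff_fderiv_single hH (Pi.single v 1)) := by
  refine Subtype.ext (Germ.coe_eq.2 ?_)
  filter_upwards [hasDerivAt_of_rep (p := p) (Eventually.of_forall fun _ => hH.contDiffAt)
    (EventuallyEq.refl (𝓝 p) fun y : Phase => H (s.restrict y)) v] with y hy
  simp only [v.2, dite_true] at hy
  exact hy.deriv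

theorem partialD_ofFin_of_notMem {s : Finset Var} {H : (s → ℝ) → ℝ} (hH : ContDiff ℝ ∞ H)
    {v : Var} (hv : v ∉ s) : partialD v (ofFin p hH) = 0 := by
  refine Subtype.ext (Germ.coe_eq.2 ?_)
  filter_upwards [hasDerivAt_of_rep (p := p) (Eventually.of_forall fun _ => hH.contDiffAt)
    (EventuallyEq.refl (𝓝 p) fun y : Phase => H (s.restrict y)) v] with y hy
  simp only [hv, dite_false] at hy
  exact hy.deriv

theorem partialD_comm (v w : Var) (a : O p) :
    partialD v (partialD w a) = partialD w (partialD v a) := by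
  obtain ⟨s, H, hH, rfl⟩ := exists_ofFin a
  by_cases hv : v ∈ s <;> by_cases hw : w ∈ s
  · lift v to s using hv
    lift w to s using hw
    rw [partialD_ofFin hH, partialD_ofFin hH, partialD_ofFin, partialD_ofFin]
    refine mkO_eq (Eventually.of_forall fun y => ?_)
    have h1 : ∀ (z e e' : s → ℝ),
        fderiv ℝ (fun z => fderiv ℝ H z e) z e' = fderiv ℝ (fderiv ℝ H) z e' e := by
      intro z e e'
      have hd : DifferentiableAt ℝ (fderiv ℝ H) z :=
        (hH.fderiv_right (m := ∞) (by simp)).differentiable (by simp) z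
      rw [(hd.hasFDerivAt.clm_apply (hasFDerivAt_const e z)).fderiv]
      simp
    simp only [h1]
    exact (hH.contDiffAt (x := s.restrict y)).isSymmSndFDerivAt
      (by simpa using WithTop.coe_le_coe.2 (le_top : (2 : ℕ∞) ≤ ⊤)) _ _
  · lift v to s using hv
    rw [partialD_ofFin hH, partialD_ofFin_of_notMem hH hw, partialD_ofFin_of_notMem _ hw, map_zero]
  · lift w to s using hw
    rw [partialD_ofFin hH, partialD_ofFin_of_notMem hH hv, partialD_ofFin_of_notMem _ hv, map_zero]
  · rw [partialD_ofFin_of_notMem hH hv, partialD_ofFin_of_notMem hH hw, map_zero, map_zero]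

theorem partialD_coord (v w : Var) : partialD v (coord p w) = if v = w then 1 else 0 := by
  split_ifs with h
  · subst h
    refine Subtype.ext (Germ.coe_eq.2 (Eventually.of_forall fun y => ?_))
    simp [pd]
  · refine Subtype.ext (Germ.coe_eq.2 (Eventually.of_forall fun y => ?_))
    have h' : w ≠ v := fun e => h e.symm
    simp [pd, h']

theorem mkO_sum {ι : Type} (s : Finset ι) (h : ι → Phase → ℝ)
    (hh : ∀ i, SmoothIn Set.univ p (h i)) :
    ∑ i ∈ s, mkO (h i) (hh i) = mkO (fun y => ∑ i ∈ s, h i y) (SmoothIn.sum s fun i _ => hh i) := by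
  classical
  induction s using Finset.induction_on with
  | empty => rfl
  | insert i s his ih =>
    rw [Finset.sum_insert his, ih]
    refine Subtype.ext (Germ.coe_eq.2 (Eventually.of_forall fun y => ?_))
    simp [Finset.sum_insert his]

/-- The chain rule. -/
theorem partialD_pullback {p q : Phase} {φ : Phase → Phase}
    (hφ : ∀ v, SmoothIn Set.univ p (fun y => φ y v)) (hpq : φ p = q) (v : Var) (a : O q) :
    partialD v (pullback φ hφ hpq a) =
      ∑ᶠ w, pullback φ hφ hpq (partialD w a) * partialD v (pullback φ hφ hpq (coord q w)) := by
  obtain ⟨s, H, hH, rfl⟩ := exists_ofFin a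
  rw [finsum_eq_sum_of_support_subset (s := s) _ (fun w hw => by
    by_contra hws
    refine hw ?_
    dsimp only
    rw [partialD_ofFin_of_notMem hH hws, map_zero, zero_mul])]
  rw [← Finset.sum_coe_sort s]
  have h1 : ∀ w : s, pullback φ hφ hpq (partialD (w : Var) (ofFin q hH)) *
      partialD v (pullback φ hφ hpq (coord q w)) =
      mkO (fun y => fderiv ℝ H (s.restrict (φ y)) (Pi.single w 1) * pd v (fun y => φ y w) y)
        (((contDiffAt_of_contDiff (contDiff_fderiv_single hH (Pi.single w 1))).comp_map
          hφ hpq).mul ((hφ w).pd v)) := fun w => by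
    rw [partialD_ofFin hH]
    rfl
  rw [Finset.sum_congr rfl fun w _ => h1 w, mkO_sum]
  refine Subtype.ext (Germ.coe_eq.2 ?_)
  have h2 : ∀ᶠ y in 𝓝 p, ∀ w : s,
      DifferentiableAt ℝ (fun r => φ (Function.update y v r) w) (y v) := by
    rw [eventually_all]
    exact fun w => (hφ w).differentiable v
  filter_upwards [h2] with y hy
  have h3 : HasDerivAt (fun r => s.restrict (φ (Function.update y v r)))
      (fun w => pd v (fun y => φ y w) y) (y v) :=
    hasDerivAt_pi.2 fun w => (hy w).hasDerivAt
  have h4 : HasFDerivAt H (fderiv ℝ H (s.restrict (φ y)))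
      (s.restrict (φ (Function.update y v (y v)))) := by
    rw [Function.update_eq_self]
    exact (hH.differentiable (by simp) _).hasFDerivAt
  refine (h4.comp_hasDerivAt (y v) h3).deriv.trans ?_
  rw [clm_apply_eq_sum]
  exact Finset.sum_congr rfl fun w _ => mul_comm _ _

-- For the converse, the variables outside `V` are frozen at their values at `p`. The frozen and the
-- original function agree because the derivative along the segment joining the two arguments
-- vanishes. Independence of a variable thereby becomes the vanishing of a derivation.
open Classical in
theorem mem_smoothGerms_iff {V : Set Var} {a : O p} :
    (a : Germ (𝓝 p) ℝ) ∈ smoothGerms V p ↔ ∀ v ∉ V, partialD v a = 0 := by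
  constructor
  · intro ha v hv
    obtain ⟨h, ⟨s, hs, H, h1, h2⟩, h3⟩ := ha
    have h4 : a = mkO h ⟨s, Set.subset_univ _, H, h1, h2⟩ := Subtype.ext h3
    rw [h4]
    refine Subtype.ext (Germ.coe_eq.2 ?_)
    filter_upwards [hasDerivAt_of_rep h1 h2 v] with y hy
    simp only [show v ∉ s from fun h => hv (hs h), dite_false] at hy
    exact hy.deriv
  · intro ha
    obtain ⟨s, H, hH, rfl⟩ := exists_ofFin a
    let s' := s.filter (· ∈ V)
    let ext' : (s' → ℝ) → (s → ℝ) := fun z v =>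
      if hv : (v : Var) ∈ V then z ⟨v, Finset.mem_filter.2 ⟨v.2, hv⟩⟩ else p v
    have hext : ContDiff ℝ ∞ ext' := contDiff_pi.2 fun v => by
      by_cases hv : (v : Var) ∈ V
      · simp only [ext', hv, dite_true]
        fun_prop
      · simp only [ext', hv, dite_false]
        fun_prop
    have hzero : ∀ᶠ z in 𝓝 (s.restrict p), ∀ v : s, (v : Var) ∉ V →
        fderiv ℝ H z (Pi.single v 1) = 0 := by
      -- A section of the restriction map, with the remaining coordinates taken from `p`; it
      -- transfers vanishing near `p` to vanishing near `s.restrict p`.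
      let up : (s → ℝ) → Phase := fun z v => if hv : v ∈ s then z ⟨v, hv⟩ else p v
      have hup : Continuous up := continuous_pi fun v => by
        by_cases hv : v ∈ s
        · simp only [up, hv, dite_true]; fun_prop
        · simp only [up, hv, dite_false]; fun_prop
      have hup0 : up (s.restrict p) = p := by
        funext v
        simp [up, Finset.restrict]
      have hres : ∀ z, s.restrict (up z) = z := fun z => by
        funext v
        simp [up, Finset.restrict]
      rw [eventually_all]
      intro v
      by_cases hv : (v : Var) ∈ V
      · exact Eventually.of_forall fun z h => absurd hv h
      · have h0 := ha v hv
        rw [partialD_ofFin hH] at h0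
        have h1 : (fun y : Phase => fderiv ℝ H (s.restrict y) (Pi.single v 1)) =ᶠ[𝓝 p]
          fun _ => 0 := Germ.coe_eq.1 (congrArg Subtype.val h0)
        have h2 : Tendsto up (𝓝 (s.restrict p)) (𝓝 p) := by
          have := hup.tendsto (s.restrict p)
          rwa [hup0] at this
        filter_upwards [h2.eventually h1] with z hz _
        rwa [hres] at hz
    obtain ⟨ρ, hρ, hb⟩ := Metric.eventually_nhds_iff_ball.1 hzero
    refine ⟨fun y => H (ext' (s'.restrict y)), ⟨s', fun v hv => (Finset.mem_filter.1 hv).2,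
      fun z => H (ext' z), Eventually.of_forall fun z => (hH.comp hext).contDiffAt,
      EventuallyEq.rfl⟩, Germ.coe_eq.2 ?_⟩
    have hext0 : ext' (s'.restrict p) = s.restrict p := by
      funext v
      simp [ext', Finset.restrict]
    have hcont : Continuous fun y : Phase => ext' (s'.restrict y) :=
      hext.continuous.comp (continuous_restr s')
    have hnear : ∀ᶠ y in 𝓝 p, ext' (s'.restrict y) ∈ Metric.ball (s.restrict p) ρ :=
      hcont.continuousAt.eventually (by
        change Metric.ball (s.restrict p) ρ ∈ 𝓝 (ext' (s'.restrict p))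
        rw [hext0]; exact Metric.ball_mem_nhds _ hρ)
    have hnear' : ∀ᶠ y : Phase in 𝓝 p, (s.restrict y : s → ℝ) ∈ Metric.ball (s.restrict p) ρ :=
      (continuous_restr s).continuousAt.eventually (Metric.ball_mem_nhds _ hρ)
    filter_upwards [hnear, hnear'] with y hy hy'
    set A := ext' (s'.restrict y)
    set B : s → ℝ := s.restrict y
    have hdiff : ∀ z ∈ Metric.ball (s.restrict p) ρ, fderiv ℝ H z (B - A) = 0 := by
      intro z hz
      rw [clm_apply_eq_sum]
      refine Finset.sum_eq_zero fun v _ => ?_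
      by_cases hv : (v : Var) ∈ V
      · have : (B - A) v = 0 := by simp [A, B, ext', hv, Finset.restrict]
        rw [this, zero_smul]
      · rw [hb z hz v hv, smul_zero]
    have hline : ∀ r ∈ Set.Icc (0 : ℝ) 1, A + r • (B - A) ∈ Metric.ball (s.restrict p) ρ := by
      intro r hr
      exact (convex_ball _ _).add_smul_sub_mem hy hy' hr
    have hder : ∀ r : ℝ, HasDerivAt (fun r : ℝ => H (A + r • (B - A)))
        (fderiv ℝ H (A + r • (B - A)) (B - A)) r := by
      intro r
      have h1 : HasDerivAt (fun r : ℝ => A + r • (B - A)) (B - A) r := by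
        simpa using ((hasDerivAt_id r).smul_const (B - A)).const_add A
      exact ((hH.differentiable (by simp) _).hasFDerivAt).comp_hasDerivAt r h1
    have := constant_of_has_deriv_right_zero (f := fun r : ℝ => H (A + r • (B - A))) (a := 0)
      (b := 1) (fun r _ => (hder r).continuousAt.continuousWithinAt) (fun r hr => by
        have h1 := hder r
        rw [hdiff _ (hline r ⟨hr.1, hr.2.le⟩)] at h1
        exact h1.hasDerivWithinAt) 1 (by simp)
    simpa using this

end Germs


/-! ### Derivations given by their coefficients. -/

section Fields

variable {p : Phase}

theorem vectorField_apply (c : Var → O p) (a : O p) :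
    vectorField c a = ∑ᶠ v, c v * partialD v a := rfl

theorem vectorField_coord (c : Var → O p) (v : Var) : vectorField c (coord p v) = c v := by
  rw [vectorField_apply, finsum_eq_single _ v fun w hw => by rw [partialD_coord, if_neg hw, mul_zero],
    partialD_coord, if_pos rfl, mul_one]

theorem vectorField_add (c c' : Var → O p) :
    vectorField (fun v => c v + c' v) = vectorField c + vectorField c' := by
  ext1 a
  rw [Derivation.add_apply, vectorField_apply, vectorField_apply, vectorField_apply,
    ← finsum_add_distrib (finite_support_mul_pd c a) (finite_support_mul_pd c' a)]
  exact finsum_congr fun v => add_mul _ _ _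

theorem vectorField_smul (r : O p) (c : Var → O p) :
    vectorField (fun v => r * c v) = r • vectorField c := by
  ext1 a
  rw [Derivation.smul_apply, vectorField_apply, vectorField_apply, smul_eq_mul,
    mul_finsum' _ _ (finite_support_mul_pd c a)]
  exact finsum_congr fun v => mul_assoc _ _ _

/-- The derivations that are determined by their coefficients, `Z = ∑ v, Z v ∂/∂v`. -/
noncomputable def fields (p : Phase) : Submodule (O p) (Derivation ℝ (O p) (O p)) where
  carrier := {Z | Z = vectorField fun v => Z (coord p v)}
  add_mem' {Z Z'} h h' := by
    simp only [Set.mem_ofPred_eq, Derivation.add_apply] at *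
    rw [vectorField_add, ← h, ← h']
  zero_mem' := by
    have := vectorField_smul (p := p) 0 fun _ => 0
    simp only [zero_mul, zero_smul] at this
    exact this.symm
  smul_mem' r Z h := by
    simp only [Set.mem_ofPred_eq, Derivation.smul_apply, smul_eq_mul] at *
    rw [vectorField_smul, ← h]

theorem vectorField_mem_fields (c : Var → O p) : vectorField c ∈ fields p := by
  change vectorField c = vectorField fun v => vectorField c (coord p v)
  simp only [vectorField_coord]

theorem fields_apply {Z : Derivation ℝ (O p) (O p)} (hZ : Z ∈ fields p) (a : O p) :
    Z a = ∑ᶠ v, Z (coord p v) * partialD v a := by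
  conv_lhs => rw [show Z = vectorField fun v => Z (coord p v) from hZ]
  rfl

theorem fields_ext {Z Z' : Derivation ℝ (O p) (O p)} (hZ : Z ∈ fields p) (hZ' : Z' ∈ fields p)
    (h : ∀ v, Z (coord p v) = Z' (coord p v)) : Z = Z' := by
  rw [show Z = vectorField fun v => Z (coord p v) from hZ,
    show Z' = vectorField fun v => Z' (coord p v) from hZ']
  simp only [h]

theorem fields_apply_eq_sum {Z : Derivation ℝ (O p) (O p)} (hZ : Z ∈ fields p) {a : O p}
    (s : Finset Var) (h : ∀ v ∉ s, Z (coord p v) * partialD v a = 0) :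
    Z a = ∑ v ∈ s, Z (coord p v) * partialD v a := by
  rw [fields_apply hZ]
  exact finsum_eq_sum_of_support_subset _ fun v hv => by
    by_contra hvs
    exact hv (h v hvs)

theorem fields_apply_eq_zero {Z : Derivation ℝ (O p) (O p)} (hZ : Z ∈ fields p) {a : O p}
    (h : ∀ v, Z (coord p v) * partialD v a = 0) : Z a = 0 := by
  rw [fields_apply_eq_sum hZ ∅ fun v _ => h v, Finset.sum_empty]

theorem partialD_mem_fields (v : Var) : (partialD v : Derivation ℝ (O p) (O p)) ∈ fields p := by
  change _ = _
  ext1 a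
  rw [vectorField_apply, finsum_eq_single _ v fun w hw => by
    rw [partialD_coord, if_neg hw.symm, zero_mul], partialD_coord, if_pos rfl, one_mul]

theorem lie_partialD (v w : Var) :
    ⁅(partialD v : Derivation ℝ (O p) (O p)), (partialD w : Derivation ℝ (O p) (O p))⁆ = 0 := by
  ext1 a
  rw [Derivation.commutator_apply, partialD_comm, sub_self, Derivation.zero_apply]

/-- In `Z Z' - Z' Z` the second-order terms cancel by symmetry of the second derivatives, and the
remaining first-order part is determined by the values on coordinates. -/
theorem fields_lie_mem {Z Z' : Derivation ℝ (O p) (O p)} (hZ : Z ∈ fields p)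
    (hZ' : Z' ∈ fields p) : ⁅Z, Z'⁆ ∈ fields p := by
  classical
  have key : ∀ {Z Z' : Derivation ℝ (O p) (O p)} (_ : Z ∈ fields p) (_ : Z' ∈ fields p) (a : O p)
      (s : Finset Var) (_ : ∀ v ∉ s, partialD v a = 0), Z (Z' a) =
        (∑ v ∈ s, Z (Z' (coord p v)) * partialD v a) +
        ∑ v ∈ s, ∑ w ∈ s, Z' (coord p v) * Z (coord p w) * partialD w (partialD v a) := by
    intro Z Z' hZ hZ' a s hs
    rw [fields_apply_eq_sum hZ' s fun v hv => by rw [hs v hv, mul_zero], map_sum,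
      ← Finset.sum_add_distrib]
    refine Finset.sum_congr rfl fun v _ => ?_
    rw [Derivation.leibniz, fields_apply_eq_sum hZ (a := partialD v a) s fun w hw => by
      rw [partialD_comm, hs w hw, map_zero, mul_zero], smul_eq_mul, smul_eq_mul, Finset.mul_sum,
      add_comm, mul_comm (partialD v a)]
    congr 1
    exact Finset.sum_congr rfl fun w _ => by ring
  change _ = _
  ext1 a
  have hfin := finite_support_pd a
  have hs : ∀ v ∉ hfin.toFinset, partialD v a = 0 := fun v hv => by
    by_contra h
    exact hv (hfin.mem_toFinset.2 h)
  rw [vectorField_apply, finsum_eq_sum_of_support_subset (s := hfin.toFinset) _ fun v hv => by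
    by_contra hvs
    exact hv (by dsimp only; rw [hs v hvs, mul_zero]), Derivation.commutator_apply,
    key hZ hZ' a _ hs, key hZ' hZ a _ hs]
  simp only [Derivation.commutator_apply, sub_mul, Finset.sum_sub_distrib]
  have h2 : ∑ v ∈ hfin.toFinset, ∑ w ∈ hfin.toFinset,
      Z' (coord p v) * Z (coord p w) * partialD w (partialD v a) =
      ∑ v ∈ hfin.toFinset, ∑ w ∈ hfin.toFinset,
      Z (coord p v) * Z' (coord p w) * partialD w (partialD v a) := by
    rw [Finset.sum_comm]
    refine Finset.sum_congr rfl fun v _ => Finset.sum_congr rfl fun w _ => ?_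
    rw [partialD_comm]
    ring
  rw [h2]
  ring

/-- The chain rule for a vector field. -/
theorem fields_apply_pullback {q : Phase} {φ : Phase → Phase}
    (hφ : ∀ v, SmoothIn Set.univ p (fun y => φ y v)) (hpq : φ p = q)
    {Z : Derivation ℝ (O p) (O p)} (hZ : Z ∈ fields p) (a : O q) :
    Z (pullback φ hφ hpq a) =
      ∑ᶠ w, pullback φ hφ hpq (partialD w a) * Z (pullback φ hφ hpq (coord q w)) := by
  classical
  set e := pullback φ hφ hpq
  have hfin := finite_support_pd a
  set s := hfin.toFinset
  have hs : ∀ v ∉ s, partialD v a = 0 := fun v hv => by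
    by_contra h
    exact hv (hfin.mem_toFinset.2 h)
  have hred : ∀ g : Var → O p, ∑ᶠ w, e (partialD w a) * g w = ∑ w ∈ s, e (partialD w a) * g w :=
    fun g => finsum_eq_sum_of_support_subset _ fun v hv => by
      by_contra hvs
      exact hv (by dsimp only; rw [hs v hvs, map_zero, zero_mul])
  let S : Finset Var := (finite_support_pd (e a)).toFinset ∪
    s.biUnion fun w => (finite_support_pd (e (coord q w))).toFinset
  have hS1 : ∀ v ∉ S, partialD v (e a) = 0 := fun v hv => by
    by_contra h
    exact hv (Finset.mem_union_left _ ((finite_support_pd (e a)).mem_toFinset.2 h))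
  have hS2 : ∀ w ∈ s, ∀ v ∉ S, partialD v (e (coord q w)) = 0 := fun w hw v hv => by
    by_contra h
    exact hv (Finset.mem_union_right _ (Finset.mem_biUnion.2
      ⟨w, hw, (finite_support_pd (e (coord q w))).mem_toFinset.2 h⟩))
  rw [hred, fields_apply_eq_sum hZ S fun v hv => by rw [hS1 v hv, mul_zero]]
  have h1 : ∀ w ∈ s, e (partialD w a) * Z (e (coord q w)) =
      ∑ v ∈ S, e (partialD w a) * (Z (coord p v) * partialD v (e (coord q w))) := fun w hw => by
    rw [fields_apply_eq_sum hZ (a := e (coord q w)) S fun v hv => by rw [hS2 w hw v hv, mul_zero],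
      Finset.mul_sum]
  rw [Finset.sum_congr rfl h1, Finset.sum_comm]
  refine Finset.sum_congr rfl fun v _ => ?_
  rw [partialD_pullback, hred, Finset.mul_sum]
  exact Finset.sum_congr rfl fun w _ => by ring

end Fields

theorem derivation_lie_sub {A : Type} [CommRing A] [Algebra ℝ A] (Z Z₁ Z₂ : Derivation ℝ A A) :
    ⁅Z, Z₁ - Z₂⁆ = ⁅Z, Z₁⁆ - ⁅Z, Z₂⁆ := by
  ext1 a
  simp only [Derivation.commutator_apply, Derivation.sub_apply, map_sub]
  abel

/-! ### Conjugation of derivations by isomorphisms of algebras. -/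

section Conjugation

variable {A A' : Type} [CommRing A] [Algebra ℝ A] [CommRing A'] [Algebra ℝ A']

/-- The derivation `e⁻¹ Z e` of `A`. -/
noncomputable def conjD (e : A ≃ₐ[ℝ] A') (Z : Derivation ℝ A' A') : Derivation ℝ A A :=
  Derivation.mk' (e.symm.toLinearMap ∘ₗ (Z : A' →ₗ[ℝ] A') ∘ₗ e.toLinearMap) fun a b => by
    simp

@[simp]
theorem conjD_apply (e : A ≃ₐ[ℝ] A') (Z : Derivation ℝ A' A') (a : A) :
    conjD e Z a = e.symm (Z (e a)) := rfl

theorem conjD_lie (e : A ≃ₐ[ℝ] A') (Z Z' : Derivation ℝ A' A') :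
    conjD e ⁅Z, Z'⁆ = ⁅conjD e Z, conjD e Z'⁆ := by
  ext1 a
  simp [Derivation.commutator_apply]

theorem conjD_add (e : A ≃ₐ[ℝ] A') (Z Z' : Derivation ℝ A' A') :
    conjD e (Z + Z') = conjD e Z + conjD e Z' := by
  ext1 a
  simp

theorem conjD_sub (e : A ≃ₐ[ℝ] A') (Z Z' : Derivation ℝ A' A') :
    conjD e (Z - Z') = conjD e Z - conjD e Z' := by
  ext1 a
  simp

theorem conjD_zero (e : A ≃ₐ[ℝ] A') : conjD e 0 = 0 := by
  ext1 a
  simp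

theorem conjD_smul_real (e : A ≃ₐ[ℝ] A') (r : ℝ) (Z : Derivation ℝ A' A') :
    conjD e (r • Z) = r • conjD e Z := by
  ext1 a
  simp

theorem conjD_smul (e : A ≃ₐ[ℝ] A') (c : A') (Z : Derivation ℝ A' A') :
    conjD e (c • Z) = e.symm c • conjD e Z := by
  ext1 a
  simp

end Conjugation

theorem partialD_eq_zero_of_dependsOn {p : Phase} {h : Phase → ℝ} (hh : SmoothIn Set.univ p h)
    {V : Set Var} (hV : DependsOn h V) {v : Var} (hv : v ∉ V) : partialD v (mkO h hh) = 0 := by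
  refine Subtype.ext (Germ.coe_eq.2 (Eventually.of_forall fun y => ?_))
  have : (fun s => h (Function.update y v s)) = fun _ => h y := by
    funext s
    refine hV fun w hw => ?_
    exact Function.update_of_ne (fun e : w = v => hv (e ▸ hw)) _ _
  change deriv (fun s => h (Function.update y v s)) (y v) = 0
  rw [this, deriv_const]

/-! ### The fields `Y_j` and `X_j` and their behaviour under the shift. -/

namespace Chain.Background

open Var

variable {C : Chain} (B : C.Background)

/-- The shift from the site `n + 1` to the site `n`. -/
noncomputable def shift (n : ℤ) : O (B.pt (n + 1)) ≃ₐ[ℝ] O (B.pt n) :=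
  C.shiftEquiv (B.pt_mem n) (B.fwd_pt rfl)

theorem D_apply (h : B.Fun) (n : ℤ) : B.D h n = B.shift n (h (n + 1)) := rfl

theorem D_symm_apply (h : B.Fun) (n : ℤ) : B.D.symm h (n + 1) = (B.shift n).symm (h n) := by
  rw [AlgEquiv.eq_symm_apply, ← D_apply, AlgEquiv.apply_symm_apply]

theorem shift_coord_x (n : ℤ) : B.shift n (coord _ x) = coord _ x := rfl

theorem shift_coord_t (n : ℤ) (k : ℤ) : B.shift n (coord _ (t k)) = coord _ (t (k + 1)) := rfl

theorem shift_coord_d (n : ℤ) (i : ℕ) :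
    B.shift n (coord _ (d i)) = mkO (C.fJet i) (C.smooth_fJet i _ (B.pt_mem n)) := rfl

/-- The chain rule along the shift expands `Z (D a)` through the derivatives of `a`; applying
`D^{-1}` returns these derivatives unchanged. -/
theorem conjD_shift_mem_fields {n : ℤ} {Z : Derivation ℝ (O (B.pt n)) (O (B.pt n))}
    (hZ : Z ∈ fields (B.pt n)) : conjD (B.shift n) Z ∈ fields (B.pt (n + 1)) := by
  change _ = _
  ext1 a
  have hfin : ∀ g : Var → O (B.pt n), (Function.support fun w =>
      B.shift n (partialD w a) * g w).Finite := fun g =>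
    (finite_support_pd a).subset fun w hw h => hw (by
      dsimp only
      rw [h, map_zero, zero_mul])
  rw [conjD_apply]
  have h1 : Z (B.shift n a) = ∑ᶠ w, B.shift n (partialD w a) * Z (B.shift n (coord _ w)) :=
    fields_apply_pullback (C.smooth_fwd (B.pt_mem n)) (B.fwd_pt rfl) hZ a
  rw [h1, vectorField_apply]
  refine ((B.shift n).symm.toAddEquiv.toAddMonoidHom.map_finsum (hfin _)).trans ?_
  refine finsum_congr fun w => ?_
  change (B.shift n).symm (B.shift n (partialD w a) * _) = _
  rw [map_mul, AlgEquiv.symm_apply_apply, mul_comm]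
  rfl

theorem partialD_fJet_eq_zero (n : ℤ) {v : Var} {i : ℕ} (hv : v ∉ Chain.low i) :
    partialD v (B.shift n (coord _ (d i))) = 0 := by
  rw [shift_coord_d]
  exact partialD_eq_zero_of_dependsOn _ (C.fJet_dep i) hv

/-- `D t_{k-1} = t_k`, while the jets of `f` involve no `t_k` other than `t` and `t_1`. This is why
`k = 0` and `k = 1` are excluded. -/
theorem conjD_partialD_t (n : ℤ) {k : ℤ} (h0 : k ≠ 0) (h1 : k ≠ 1) :
    conjD (B.shift n) (partialD (t k)) = partialD (t (k - 1)) := by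
  refine fields_ext (B.conjD_shift_mem_fields (partialD_mem_fields _)) (partialD_mem_fields _)
    fun v => ?_
  rw [conjD_apply, AlgEquiv.symm_apply_eq]
  match v with
  | x => rw [shift_coord_x, partialD_coord, partialD_coord, if_neg (by simp), if_neg (by simp),
      map_zero]
  | t l =>
    rw [shift_coord_t, partialD_coord, partialD_coord, apply_ite (B.shift n), map_one, map_zero]
    exact if_congr (by simp; omega) rfl rfl
  | d i =>
    rw [partialD_coord, if_neg (by simp), map_zero, partialD_fJet_eq_zero]
    simp [Chain.low, h0, h1]

/-- The operator `D^{-j} ∂/∂t_1 D^j` at the site `n`, as a vector field. -/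
noncomputable def conjField (n : ℤ) (j : ℕ) : Derivation ℝ (O (B.pt n)) (O (B.pt n)) :=
  vectorField fun v => B.conj j (B.coordFun v) n

theorem conjField_mem (n : ℤ) (j : ℕ) : B.conjField n j ∈ fields (B.pt n) :=
  vectorField_mem_fields _

theorem conj_succ (j : ℕ) (h : B.Fun) : B.conj (j + 1) h = B.D.symm (B.conj j (B.D h)) := by
  rw [conj, Function.iterate_succ_apply', Function.iterate_succ_apply]
  rfl

/-- Each conjugation by the shift stays within `fields`. Hence `conj j`, defined on functions over
all sites, acts at the site `n` through a single vector field. -/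
theorem exists_conj (j : ℕ) : ∀ n : ℤ, ∃ Z ∈ fields (B.pt n), ∀ h : B.Fun,
    B.conj j h n = Z (h n) := by
  induction j with
  | zero => exact fun n => ⟨partialD (t 1), partialD_mem_fields _, fun h => rfl⟩
  | succ j ih =>
    intro n
    obtain ⟨m, rfl⟩ : ∃ m, n = m + 1 := ⟨n - 1, by ring⟩
    obtain ⟨Z, hZ, hj⟩ := ih m
    refine ⟨conjD (B.shift m) Z, B.conjD_shift_mem_fields hZ, fun h => ?_⟩
    rw [conj_succ, D_symm_apply, hj]
    rfl

theorem conj_apply (j : ℕ) (h : B.Fun) (n : ℤ) : B.conj j h n = B.conjField n j (h n) := by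
  obtain ⟨Z, hZ, hj⟩ := B.exists_conj j n
  rw [hj, fields_ext (B.conjField_mem n j) hZ fun v => by
    rw [conjField, vectorField_coord, hj]; rfl]

theorem conjField_zero (n : ℤ) : B.conjField n 0 = partialD (t 1) :=
  fields_ext (B.conjField_mem n 0) (partialD_mem_fields _) fun v => by
    rw [conjField, vectorField_coord]; rfl

theorem conjField_succ (n : ℤ) (j : ℕ) :
    B.conjField (n + 1) (j + 1) = conjD (B.shift n) (B.conjField n j) :=
  fields_ext (B.conjField_mem _ _) (B.conjD_shift_mem_fields (B.conjField_mem _ _)) fun v => by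
    rw [conjField, vectorField_coord, conj_succ, D_symm_apply, conj_apply]
    rfl

theorem conjField_x (j : ℕ) : ∀ n : ℤ, B.conjField n j (coord _ x) = 0 := by
  induction j with
  | zero => exact fun n => by rw [conjField_zero, partialD_coord, if_neg (by simp)]
  | succ j ih =>
    intro n
    obtain ⟨m, rfl⟩ : ∃ m, n = m + 1 := ⟨n - 1, by ring⟩
    rw [conjField_succ, conjD_apply, shift_coord_x, ih, map_zero]

/-- `D^j t_k = t_{k+j}`, and `∂/∂t_1` sees it only for `k + j = 1`. -/
theorem conjField_t (j : ℕ) : ∀ (n k : ℤ),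
    B.conjField n j (coord _ (t k)) = if k + j = 1 then 1 else 0 := by
  induction j with
  | zero =>
    intro n k
    rw [conjField_zero, partialD_coord]
    exact if_congr (by simp [eq_comm]) rfl rfl
  | succ j ih =>
    intro n k
    obtain ⟨m, rfl⟩ : ∃ m, n = m + 1 := ⟨n - 1, by ring⟩
    rw [conjField_succ, conjD_apply, shift_coord_t, ih, apply_ite (B.shift m).symm, map_one,
      map_zero]
    exact if_congr (by push_cast; constructor <;> intro h <;> linarith) rfl rfl

theorem Y_mem (n : ℤ) (j : ℕ) : B.Y n j ∈ fields (B.pt n) := vectorField_mem_fields _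

theorem X_mem (n : ℤ) (j : ℕ) : B.X n j ∈ fields (B.pt n) := partialD_mem_fields _

theorem Y_x (n : ℤ) (j : ℕ) : B.Y n j (coord _ x) = 0 := by
  rw [Y, vectorField_coord]

theorem Y_t (n : ℤ) (j : ℕ) (k : ℤ) :
    B.Y n j (coord _ (t k)) = if k = 0 ∧ j = 1 then 1 else 0 := by
  rw [Y, vectorField_coord]
  dsimp only
  split_ifs with h1 h2 h2
  · rw [conj_apply, coordFun, conjField_t, if_pos (by simp [h2.2])]
  · rw [conj_apply, coordFun, conjField_t, if_neg (by intro h; apply h2; constructor <;> omega)]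
  · exact absurd h2.1 h1
  · rfl

theorem Y_d (n : ℤ) (j i : ℕ) : B.Y n j (coord _ (d i)) = B.conjField n j (coord _ (d i)) := by
  rw [Y, vectorField_coord]
  exact B.conj_apply j _ n

theorem X_x (n : ℤ) (j : ℕ) : B.X n j (coord _ x) = 0 := by
  rw [X, partialD_coord, if_neg (by simp)]

theorem X_t (n : ℤ) (j : ℕ) (k : ℤ) :
    B.X n j (coord _ (t k)) = if k = -j then 1 else 0 := by
  rw [X, partialD_coord]
  exact if_congr (by simp [eq_comm]) rfl rfl

theorem X_d (n : ℤ) (j i : ℕ) : B.X n j (coord _ (d i)) = 0 := by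
  rw [X, partialD_coord, if_neg (by simp)]

theorem Y_one (n : ℤ) : B.Y n 1 = B.conjField n 1 :=
  fields_ext (B.Y_mem n 1) (B.conjField_mem n 1) fun v => match v with
    | x => by rw [Y_x, conjField_x]
    | t k => by
      rw [Y_t, conjField_t]
      exact if_congr (by simp) rfl rfl
    | d i => B.Y_d n 1 i

/-- `Y_{j+2}` records only the coefficients at `t, t_x, …`. The one coefficient of `D^{-(j+2)}
∂/∂t_1 D^{j+2}` left out is that at `t_{-(j+1)}`, which equals `1`. -/
theorem Y_add_X (n : ℤ) (j : ℕ) : B.Y n (j + 2) + B.X n (j + 1) = B.conjField n (j + 2) :=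
  fields_ext (add_mem (B.Y_mem _ _) (B.X_mem _ _)) (B.conjField_mem _ _) fun v => match v with
    | x => by rw [Derivation.add_apply, Y_x, X_x, conjField_x, add_zero]
    | t k => by
      rw [Derivation.add_apply, Y_t, X_t, conjField_t, if_neg (by omega), zero_add]
      exact if_congr (by push_cast; constructor <;> intro h <;> linarith) rfl rfl
    | d i => by rw [Derivation.add_apply, X_d, Y_d, add_zero]

theorem conjD_partialD_t_one (n : ℤ) : conjD (B.shift n) (partialD (t 1)) = B.Y (n + 1) 1 := by
  rw [Y_one, conjField_succ, conjField_zero]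

theorem conjD_X (n : ℤ) {j : ℕ} (hj : 1 ≤ j) :
    conjD (B.shift n) (B.X n j) = B.X (n + 1) (j + 1) := by
  rw [X, conjD_partialD_t _ _ (by omega) (by omega), X]
  congr 2
  push_cast
  ring

theorem conjD_Y_one (n : ℤ) : conjD (B.shift n) (B.Y n 1) = B.Y (n + 1) 2 + B.X (n + 1) 1 := by
  rw [Y_one, ← conjField_succ, Y_add_X]

/-- `Y_j` is the difference of `D^{-j} ∂/∂t_1 D^j` and `X_{j-1}`, and conjugation raises both
indices by one. For `j = 1` there is nothing to subtract, hence the extra `X_1` in `conjD_Y_one`. -/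
theorem conjD_Y (n : ℤ) {j : ℕ} (hj : 2 ≤ j) :
    conjD (B.shift n) (B.Y n j) = B.Y (n + 1) (j + 1) := by
  obtain ⟨j, rfl⟩ : ∃ i, j = i + 2 := ⟨j - 2, by omega⟩
  rw [← add_sub_cancel_right (B.Y n (j + 2)) (B.X n (j + 1)), Y_add_X, conjD_sub,
    conjD_X _ _ (by omega), ← conjField_succ, ← Y_add_X,
    show j + 1 + 2 = j + 2 + 1 from rfl, show j + 1 + 1 = j + 2 from rfl]
  exact add_sub_cancel_right (B.Y (n + 1) (j + 2 + 1)) (B.X (n + 1) (j + 2))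

/-- In this range of `k`, undoing `j` conjugations turns the pair into `∂/∂t_{k+j}` and `∂/∂t_1`,
which commute. The excluded indices `0` and `1` are never met on the way. -/
theorem lie_conjField (j : ℕ) : ∀ (n k : ℤ) (_ : k < -j ∨ 0 < k),
    ⁅(partialD (t k) : Derivation ℝ (O (B.pt n)) (O (B.pt n))), B.conjField n j⁆ = 0 := by
  induction j with
  | zero => exact fun n k _ => by rw [conjField_zero, lie_partialD]
  | succ j ih =>
    intro n k hk
    obtain ⟨m, rfl⟩ : ∃ m, n = m + 1 := ⟨n - 1, by ring⟩
    have h1 : conjD (B.shift m) (partialD (t (k + 1))) = partialD (t k) := by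
      rw [conjD_partialD_t _ _ (by push_cast at hk; omega) (by push_cast at hk; omega),
        add_sub_cancel_right]
    rw [conjField_succ, ← h1, ← conjD_lie, ih _ _ (by push_cast at hk; omega), conjD_zero]

theorem lie_partialD_Y (n k : ℤ) {j : ℕ} (hj : 1 ≤ j) (hk : k < -j ∨ 0 < k) :
    ⁅(partialD (t k) : Derivation ℝ (O (B.pt n)) (O (B.pt n))), B.Y n j⁆ = 0 := by
  obtain rfl | ⟨i, rfl⟩ : j = 1 ∨ ∃ i, j = i + 2 := by
    rcases j with _ | _ | i
    · omega
    · exact Or.inl rfl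
    · exact Or.inr ⟨i, rfl⟩
  · rw [Y_one, lie_conjField _ _ _ _ hk]
  · rw [← add_sub_cancel_right (B.Y n (i + 2)) (B.X n (i + 1)), Y_add_X, derivation_lie_sub,
      lie_conjField _ _ _ _ hk, X, lie_partialD]
    exact sub_zero (0 : Derivation ℝ (O (B.pt n)) (O (B.pt n)))

/-- The functions that do not depend on the derivatives `d i, d (i + 1), …`. -/
noncomputable def orderLT (p : Phase) (i : ℕ) : Set (O p) := {a | ∀ l ≥ i, partialD (d l) a = 0}

theorem partialD_shift (n : ℤ) (v : Var) (a : O (B.pt (n + 1))) :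
    partialD v (B.shift n a) =
      ∑ᶠ w, B.shift n (partialD w a) * partialD v (B.shift n (coord _ w)) :=
  partialD_pullback (C.smooth_fwd (B.pt_mem n)) (B.fwd_pt rfl) v a

theorem partialD_d_shift_coord (n : ℤ) (l : ℕ) (w : Var) (hw : ∀ m, w = d m → m < l) :
    partialD (d l) (B.shift n (coord _ w)) = 0 := by
  match w with
  | x => rw [shift_coord_x, partialD_coord, if_neg (by simp)]
  | t k => rw [shift_coord_t, partialD_coord, if_neg (by simp)]
  | d m =>
    have := hw m rfl
    refine B.partialD_fJet_eq_zero n ?_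
    simp [Chain.low]
    omega

theorem isUnit_partialD_d_shift_coord (n : ℤ) (l : ℕ) :
    IsUnit (partialD (d l) (B.shift n (coord _ (d l)))) := by
  rw [O.isUnit_iff, shift_coord_d, partialD_mkO, O.value_mkO, C.pd_top]
  exact C.lead_ne_zero (B.pt_mem n)

/-- The shift is triangular: `D t_{[i]}` contains no derivative of order above `i`. -/
theorem shift_mem_orderLT {n : ℤ} {i : ℕ} {a : O (B.pt (n + 1))}
    (ha : a ∈ orderLT (B.pt (n + 1)) i) : B.shift n a ∈ orderLT (B.pt n) i := by
  intro l hl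
  rw [partialD_shift]
  refine finsum_eq_zero_of_forall_eq_zero fun w => ?_
  by_cases hw : ∀ m, w = d m → m < l
  · rw [partialD_d_shift_coord _ _ _ _ hw, mul_zero]
  · push Not at hw
    obtain ⟨m, rfl, hm⟩ := hw
    rw [ha m (hl.trans hm), map_zero, zero_mul]

/-- At the highest derivative on which `a` depends, a single term of the chain rule survives: it is
multiplied by `∂f/∂t_x`, a unit. So the inverse shift does not raise the order either. -/
theorem mem_orderLT_of_shift {n : ℤ} {i : ℕ} {a : O (B.pt (n + 1))}
    (ha : B.shift n a ∈ orderLT (B.pt n) i) : a ∈ orderLT (B.pt (n + 1)) i := by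
  by_contra hcon
  have hne : ∃ l, i ≤ l ∧ partialD (d l) a ≠ 0 := by
    simpa [orderLT] using hcon
  have hfin : {l | i ≤ l ∧ partialD (d l) a ≠ 0}.Finite := by
    refine ((finite_support_pd a).preimage (f := d) (fun _ _ _ _ h => by simpa using h)).subset ?_
    exact fun l hl => hl.2
  obtain ⟨l, ⟨hil, hl⟩, hmax⟩ := hfin.exists_maximal hne
  have h1 := ha l hil
  rw [partialD_shift, finsum_eq_single _ (d l)] at h1
  · rw [(B.isUnit_partialD_d_shift_coord n l).mul_left_eq_zero,
      map_eq_zero_iff _ (B.shift n).injective] at h1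
    exact hl h1
  · intro w hw
    by_cases hw' : ∀ m, w = d m → m < l
    · rw [partialD_d_shift_coord _ _ _ _ hw', mul_zero]
    · push Not at hw'
      obtain ⟨m, rfl, hm⟩ := hw'
      have hm0 : partialD (d m) a = 0 := by
        by_contra h
        have := hmax ⟨hil.trans hm, h⟩ hm
        exact hw (by rw [le_antisymm hm this])
      rw [hm0, map_zero, zero_mul]

theorem partialD_mem_orderLT {p : Phase} {i : ℕ} {a : O p} (v : Var) (ha : a ∈ orderLT p i) :
    partialD v a ∈ orderLT p i := fun l hl => by
  rw [partialD_comm, ha l hl, map_zero]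

theorem conjField_mem_orderLT (j : ℕ) : ∀ (n : ℤ) {i : ℕ} {a : O (B.pt n)}
    (_ : a ∈ orderLT (B.pt n) i), B.conjField n j a ∈ orderLT (B.pt n) i := by
  induction j with
  | zero => exact fun n i a ha => by rw [conjField_zero]; exact partialD_mem_orderLT _ ha
  | succ j ih =>
    intro n i a ha
    obtain ⟨m, rfl⟩ : ∃ m, n = m + 1 := ⟨n - 1, by ring⟩
    rw [conjField_succ, conjD_apply]
    refine B.mem_orderLT_of_shift ?_
    rw [AlgEquiv.apply_symm_apply]
    exact ih m (B.shift_mem_orderLT ha)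

theorem Y_mem_orderLT (n : ℤ) {i j : ℕ} (hj : 1 ≤ j) {a : O (B.pt n)}
    (ha : a ∈ orderLT (B.pt n) i) : B.Y n j a ∈ orderLT (B.pt n) i := by
  obtain rfl | ⟨j, rfl⟩ : j = 1 ∨ ∃ i, j = i + 2 := by
    rcases j with _ | _ | i
    · omega
    · exact Or.inl rfl
    · exact Or.inr ⟨i, rfl⟩
  · rw [Y_one]
    exact B.conjField_mem_orderLT _ _ ha
  · rw [← add_sub_cancel_right (B.Y n (j + 2)) (B.X n (j + 1)), Y_add_X, Derivation.sub_apply]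
    intro l hl
    rw [map_sub, B.conjField_mem_orderLT _ _ ha l hl, X, partialD_mem_orderLT _ ha l hl, sub_zero]

end Chain.Background

end SemiDiscrete

/-! ### Rank over the ring of germs: minors, spans and bases. -/

theorem Matrix.le_of_isUnit_det_of_rows_mem_span {R : Type} [CommRing R] [Nontrivial R] {r s : ℕ}
    {A : Matrix (Fin r) (Fin r) R} (hA : IsUnit A.det) {g : Fin s → Fin r → R}
    (h : ∀ a, A a ∈ Submodule.span R (Set.range g)) : r ≤ s := by
  classical
  have hli : LinearIndependent R A.row :=
    Matrix.linearIndependent_rows_of_isUnit ((Matrix.isUnit_iff_isUnit_det A).2 hA)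
  have h1 := linearIndependent_le_span' A.row hli (Set.range g) (by
    rintro _ ⟨a, rfl⟩
    exact h a)
  have h2 := h1.trans (Nat.cast_le.2 (Fintype.card_range_le g))
  simpa using h2

/-- A row of a bordered matrix of determinant zero is a combination of the rows of an invertible
block; the coefficients only depend on the columns of the block. -/
theorem Matrix.eq_sum_of_det_bordered_eq_zero {R : Type} [CommRing R] {r : ℕ}
    {M : Matrix (Fin r) (Fin r) R} (hM : IsUnit M.det) (w u : Fin r → R) (y : R)
    (h : (Matrix.fromBlocks M (Matrix.of fun a (_ : Fin 1) => u a)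
      (Matrix.of fun (_ : Fin 1) b => w b) (Matrix.of fun _ _ => y)).det = 0) :
    y = ∑ a, (∑ b, w b * M⁻¹ b a) * u a := by
  let _ : Invertible M := Matrix.invertibleOfIsUnitDet M hM
  rw [Matrix.det_fromBlocks₁₁, hM.mul_right_eq_zero, Matrix.det_fin_one, Matrix.sub_apply,
    sub_eq_zero, Matrix.invOf_eq_nonsing_inv] at h
  simpa [Matrix.mul_apply] using h

namespace SemiDiscrete

open Chain.Background Chain Var

section Jets

variable {p : Phase}

/-- The coefficients of a vector field at `∂/∂t, ∂/∂t_x, …`. -/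
noncomputable def jets (p : Phase) : Derivation ℝ (O p) (O p) →ₗ[O p] ℕ → O p where
  toFun Z i := Z (coord p (jetVar i))
  map_add' _ _ := rfl
  map_smul' _ _ := rfl

@[simp]
theorem jets_apply (Z : Derivation ℝ (O p) (O p)) (i : ℕ) :
    jets p Z i = Z (coord p (jetVar i)) := rfl

/-- The invertible block is bordered by the row of `W` and an arbitrary column `i`. The vanishing
Schur complement expresses the coefficient of `W` at `i` with multipliers computed from the columns
`v` alone, so the same combination works for all of the infinitely many columns. -/
theorem jets_mem_span_of_minors_eq_zero {A : Set (Derivation ℝ (O p) (O p))} {r : ℕ}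
    {Z : Fin r → Derivation ℝ (O p) (O p)} {v : Fin r → ℕ} (hZ : ∀ a, Z a ∈ A)
    (hu : IsUnit (minor Z v))
    (hA : ∀ Z' : Fin (r + 1) → Derivation ℝ (O p) (O p), (∀ a, Z' a ∈ A) → ∀ v', minor Z' v' = 0)
    {W : Derivation ℝ (O p) (O p)} (hW : W ∈ A) :
    jets p W ∈ Submodule.span (O p) (Set.range fun a => jets p (Z a)) := by
  rw [Submodule.mem_span_range_iff_exists_fun]
  let M : Matrix (Fin r) (Fin r) (O p) := Matrix.of fun a b => Z a (coord p (jetVar (v b)))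
  refine ⟨fun a => ∑ b, W (coord p (jetVar (v b))) * M⁻¹ b a, ?_⟩
  funext i
  rw [Finset.sum_apply]
  refine (Matrix.eq_sum_of_det_bordered_eq_zero (M := M) hu _ (fun a => Z a (coord p (jetVar i)))
    (W (coord p (jetVar i))) ?_).symm
  have h1 := hA (Fin.append Z fun _ : Fin 1 => W) (fun a => by
    refine Fin.addCases (fun a => ?_) (fun a => ?_) a
    · rw [Fin.append_left]; exact hZ a
    · rw [Fin.append_right]; exact hW) (Fin.append v fun _ : Fin 1 => i)
  rw [minor, ← Matrix.det_submatrix_equiv_self finSumFinEquiv] at h1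
  rw [← h1]
  congr 1
  ext a b
  rcases a with a | a <;> rcases b with b | b <;> simp [M]

theorem linearIndependent_of_isUnit_minor {r : ℕ} {Z : Fin r → Derivation ℝ (O p) (O p)}
    {v : Fin r → ℕ} (hu : IsUnit (minor Z v)) : LinearIndependent (O p) Z := by
  have hli := Matrix.linearIndependent_rows_of_isUnit ((Matrix.isUnit_iff_isUnit_det _).2 hu)
  let f : Derivation ℝ (O p) (O p) →ₗ[O p] Fin r → O p :=
    { toFun := fun Z b => Z (coord p (jetVar (v b)))
      map_add' := fun _ _ => rfl
      map_smul' := fun _ _ => rfl }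
  exact LinearIndependent.of_comp f hli

theorem le_of_jets_mem_span {r s : ℕ} {Z : Fin r → Derivation ℝ (O p) (O p)}
    {v : Fin r → ℕ} (hu : IsUnit (minor Z v)) {g : Fin s → ℕ → O p}
    (h : ∀ a, jets p (Z a) ∈ Submodule.span (O p) (Set.range g)) : r ≤ s := by
  let f : (ℕ → O p) →ₗ[O p] Fin r → O p := LinearMap.funLeft (O p) (O p) v
  refine Matrix.le_of_isUnit_det_of_rows_mem_span hu (g := fun b => f (g b)) fun a => ?_
  have h1 := Submodule.mem_map_of_mem (f := f) (h a)
  rw [Submodule.map_span, ← Set.range_comp] at h1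
  exact h1

end Jets

namespace Chain.Background

variable {C : Chain} {B : C.Background}

/-- The form in which genericity is used. A value is nonzero exactly when the minor is a unit, so no
intermediate case remains. -/
theorem ConstantRank.minor_dichotomy
    {A : ∀ n, Set (Derivation ℝ (O (B.pt n)) (O (B.pt n)))} (hA : B.ConstantRank A) (r : ℕ) :
    (∀ n, ∃ (Z : Fin r → Derivation ℝ (O (B.pt n)) (O (B.pt n))) (v : Fin r → ℕ),
      (∀ a, Z a ∈ A n) ∧ IsUnit (minor Z v)) ∨
    ∀ n, ∀ Z : Fin r → Derivation ℝ (O (B.pt n)) (O (B.pt n)), (∀ a, Z a ∈ A n) →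
      ∀ v, minor Z v = 0 := by
  by_cases h : ∃ n, ∀ Z : Fin r → Derivation ℝ (O (B.pt n)) (O (B.pt n)), (∀ a, Z a ∈ A n) →
      ∀ v, (minor Z v).value = 0
  · exact Or.inr (hA r h)
  · left
    intro n
    push Not at h
    obtain ⟨Z, hZ, v, hv⟩ := h n
    exact ⟨Z, v, hZ, O.isUnit_iff.2 hv⟩

theorem ConstantRank.exists_rank
    {A : ∀ n, Set (Derivation ℝ (O (B.pt n)) (O (B.pt n)))} (hA : B.ConstantRank A) {n₀ : ℤ}
    {R : ℕ} (h : ∀ Z : Fin R → Derivation ℝ (O (B.pt n₀)) (O (B.pt n₀)), (∀ a, Z a ∈ A n₀) →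
      ∀ v, ¬ IsUnit (minor Z v)) :
    ∃ r < R, (∀ n, ∃ (Z : Fin r → Derivation ℝ (O (B.pt n)) (O (B.pt n))) (v : Fin r → ℕ),
      (∀ a, Z a ∈ A n) ∧ IsUnit (minor Z v)) ∧
    ∀ n, ∀ Z : Fin (r + 1) → Derivation ℝ (O (B.pt n)) (O (B.pt n)), (∀ a, Z a ∈ A n) →
      ∀ v, minor Z v = 0 := by
  classical
  let P : ℕ → Prop := fun r => ¬ ∀ n,
    ∃ (Z : Fin r → Derivation ℝ (O (B.pt n)) (O (B.pt n))) (v : Fin r → ℕ),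
      (∀ a, Z a ∈ A n) ∧ IsUnit (minor Z v)
  have hR : P R := fun hcon => by
    obtain ⟨Z, v, hZ, hv⟩ := hcon n₀
    exact h Z hZ v hv
  have hex : ∃ r, P r := ⟨R, hR⟩
  -- The empty minor equals `1`, so the least failing size is positive; the rank is its predecessor.
  obtain ⟨r, hr⟩ : ∃ r, Nat.find hex = r + 1 := by
    refine Nat.exists_eq_succ_of_ne_zero fun h0 => ?_
    have := Nat.find_spec hex
    rw [h0] at this
    exact this fun n => ⟨Fin.elim0, Fin.elim0, fun a => a.elim0, by
      rw [minor, Matrix.det_fin_zero]; exact isUnit_one⟩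
  refine ⟨r, ?_, ?_, ?_⟩
  · have := Nat.find_min' hex hR
    omega
  · exact not_not.1 (Nat.find_min hex (m := r) (by omega))
  · have := Nat.find_spec hex
    rw [hr] at this
    exact (hA.minor_dichotomy (r + 1)).resolve_left this

variable (B)

theorem ext_of_jets_eq {n : ℤ} {Z Z' : Derivation ℝ (O (B.pt n)) (O (B.pt n))}
    (hZ : Z ∈ fields (B.pt n)) (hZ' : Z' ∈ fields (B.pt n)) (hx : Z (coord _ x) = Z' (coord _ x))
    (ht : ∀ k ≠ 0, Z (coord _ (t k)) = Z' (coord _ (t k))) (h : jets _ Z = jets _ Z') : Z = Z' := by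
  refine fields_ext hZ hZ' fun v => match v with
    | x => hx
    | t k => ?_
    | d i => congrFun h (i + 1)
  by_cases hk : k = 0
  · subst hk
    exact congrFun h 0
  · exact ht k hk

/-- The vector fields without component at `∂/∂x` and at `∂/∂t_k`, `k ∈ K`. -/
noncomputable def vanishingFields (p : Phase) (K : Set ℤ) :
    Submodule (O p) (Derivation ℝ (O p) (O p)) where
  carrier := {Z | Z ∈ fields p ∧ Z (coord _ x) = 0 ∧ ∀ k ∈ K, Z (coord _ (t k)) = 0}
  add_mem' {Z Z'} h h' := ⟨add_mem h.1 h'.1, by rw [Derivation.add_apply, h.2.1, h'.2.1, add_zero],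
    fun k hk => by rw [Derivation.add_apply, h.2.2 k hk, h'.2.2 k hk, add_zero]⟩
  zero_mem' := ⟨zero_mem _, rfl, fun _ _ => rfl⟩
  smul_mem' c Z h := ⟨(fields _).smul_mem c h.1, by
      rw [Derivation.smul_apply, h.2.1, smul_zero],
    fun k hk => by rw [Derivation.smul_apply, h.2.2 k hk, smul_zero]⟩

/-- The vector fields with coefficients only at `∂/∂t, ∂/∂t_x, …`. -/
noncomputable abbrev jetFields (n : ℤ) :
    Submodule (O (B.pt n)) (Derivation ℝ (O (B.pt n)) (O (B.pt n))) :=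
  vanishingFields (B.pt n) {0}ᶜ

theorem Y_mem_jetFields (n : ℤ) (j : ℕ) : B.Y n j ∈ B.jetFields n :=
  ⟨B.Y_mem n j, B.Y_x n j, fun k hk => by rw [Y_t, if_neg fun h => hk h.1]⟩

/-- A field without components at `x` and at `t_k`, `k ≠ 0`, is determined by its jets, so relations
among jets lift to relations among fields. -/
theorem mem_span_of_jets_mem_span {n : ℤ} {ι : Type} [Fintype ι]
    {Z : ι → Derivation ℝ (O (B.pt n)) (O (B.pt n))} (hZ : ∀ a, Z a ∈ B.jetFields n)
    {W : Derivation ℝ (O (B.pt n)) (O (B.pt n))} (hW : W ∈ B.jetFields n)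
    (h : jets _ W ∈ Submodule.span (O (B.pt n)) (Set.range fun a => jets _ (Z a))) :
    W ∈ Submodule.span (O (B.pt n)) (Set.range Z) := by
  rw [Submodule.mem_span_range_iff_exists_fun] at h ⊢
  obtain ⟨c, hc⟩ := h
  have hs : ∑ a, c a • Z a ∈ B.jetFields n :=
    sum_mem fun a _ => (B.jetFields n).smul_mem _ (hZ a)
  refine ⟨c, B.ext_of_jets_eq hs.1 hW.1 (by rw [hs.2.1, hW.2.1])
    (fun k hk => by rw [hs.2.2 k hk, hW.2.2 k hk]) ?_⟩
  rw [map_sum, ← hc]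
  simp only [map_smul]

theorem conjD_mem_span {n : ℤ} {S : Set (Derivation ℝ (O (B.pt n)) (O (B.pt n)))}
    {T : Submodule (O (B.pt (n + 1))) (Derivation ℝ (O (B.pt (n + 1))) (O (B.pt (n + 1))))}
    (h : ∀ Z ∈ S, conjD (B.shift n) Z ∈ T) {Z : Derivation ℝ (O (B.pt n)) (O (B.pt n))}
    (hZ : Z ∈ Submodule.span (O (B.pt n)) S) : conjD (B.shift n) Z ∈ T := by
  induction hZ using Submodule.span_induction with
  | mem Z hZ => exact h Z hZ
  | zero => rw [conjD_zero]; exact zero_mem _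
  | add Z Z' _ _ h1 h2 => rw [conjD_add]; exact add_mem h1 h2
  | smul c Z _ h1 => rw [conjD_smul]; exact T.smul_mem _ h1

/-- `N + 1` is the least number `k` for which `Y_1, …, Y_k` fail to be independent in the sense of
unit minors. Conjugation by the shift spreads the one relation for `Y_{N+1}` to all later `Y_j`; the
relation must not contain `Y_1`, whose conjugate has an `X_1` term. -/
theorem exists_Yspan_basis (hB : ∀ k : ℕ, B.ConstantRank fun n => B.Y n '' Set.Icc 1 k) {n₀ : ℤ}
    {K : ℕ} (hK : ∀ Z : Fin K → Derivation ℝ (O (B.pt n₀)) (O (B.pt n₀)),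
      (∀ a, Z a ∈ B.Y n₀ '' Set.Icc 1 K) → ∀ v, ¬ IsUnit (minor Z v)) :
    ∃ N : ℕ, (∀ n, Module.Finite (O (B.pt n)) (B.Yspan n) ∧
        Module.finrank (O (B.pt n)) (B.Yspan n) = N) ∧
      ∀ n, ∀ j ≥ 1, B.Y n j ∈ Submodule.span (O (B.pt n)) (B.Y n '' Set.Icc 1 N) := by
  classical
  let P : ℕ → Prop := fun r => ¬ ∀ n,
    ∃ (Z : Fin r → Derivation ℝ (O (B.pt n)) (O (B.pt n))) (v : Fin r → ℕ),
      (∀ a, Z a ∈ B.Y n '' Set.Icc 1 r) ∧ IsUnit (minor Z v)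
  have hPK : P K := fun hcon => by
    obtain ⟨Z, v, hZ, hv⟩ := hcon n₀
    exact hK Z hZ v hv
  have hex : ∃ r, P r := ⟨K, hPK⟩
  obtain ⟨N, hN⟩ : ∃ r, Nat.find hex = r + 1 := by
    refine Nat.exists_eq_succ_of_ne_zero fun h0 => ?_
    have := Nat.find_spec hex
    rw [h0] at this
    exact this fun n => ⟨Fin.elim0, Fin.elim0, fun a => a.elim0, by
      rw [minor, Matrix.det_fin_zero]; exact isUnit_one⟩
  have hPN := not_not.1 (Nat.find_min hex (m := N) (by omega))
  have hzero : ∀ n, ∀ Z : Fin (N + 1) → Derivation ℝ (O (B.pt n)) (O (B.pt n)),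
      (∀ a, Z a ∈ B.Y n '' Set.Icc 1 (N + 1)) → ∀ v, minor Z v = 0 := by
    have := Nat.find_spec hex
    rw [hN] at this
    exact ((hB (N + 1)).minor_dichotomy (N + 1)).resolve_left this
  choose Z v hZ hu using hPN
  have hZj : ∀ n a, Z n a ∈ B.jetFields n := fun n a => by
    obtain ⟨j, -, hj⟩ := hZ n a
    rw [← hj]
    exact B.Y_mem_jetFields n j
  have hYZ : ∀ n, ∀ j ∈ Set.Icc 1 (N + 1),
      B.Y n j ∈ Submodule.span (O (B.pt n)) (Set.range (Z n)) := fun n j hj =>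
    B.mem_span_of_jets_mem_span (hZj n) (B.Y_mem_jetFields n j)
      (jets_mem_span_of_minors_eq_zero
        (fun a => Set.image_mono (Set.Icc_subset_Icc_right (Nat.le_succ N)) (hZ n a)) (hu n)
        (hzero n)
        (Set.mem_image_of_mem _ hj))
  have hZY : ∀ n, Submodule.span (O (B.pt n)) (Set.range (Z n)) ≤
      Submodule.span (O (B.pt n)) (B.Y n '' Set.Icc 1 N) := fun n => by
    refine Submodule.span_mono ?_
    rintro _ ⟨a, rfl⟩
    exact hZ n a
  have hN1 : 1 ≤ N := by
    by_contra hcon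
    obtain rfl : N = 0 := by omega
    have h1 := hZY 0 (hYZ 0 1 (by simp))
    simp only [Set.Icc_eq_empty (show ¬ 1 ≤ 0 by simp), Set.image_empty, Submodule.span_empty,
      Submodule.mem_bot] at h1
    have h2 := B.Y_t 0 1 0
    rw [h1, if_pos ⟨rfl, rfl⟩] at h2
    exact zero_ne_one h2
  -- Only `Y_1` has a component at `∂/∂t`, and this component is `1`. Comparing these components
  -- removes `Y_1` from the relation.
  have htail : ∀ n, B.Y n (N + 1) ∈ Submodule.span (O (B.pt n)) (B.Y n '' Set.Icc 2 N) := by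
    intro n
    have h1 := hZY n (hYZ n (N + 1) (by simp))
    have h2 : Set.Icc 1 N = insert 1 (Set.Icc 2 N) := by
      ext i
      simp only [Set.mem_Icc, Set.mem_insert_iff]
      omega
    rw [h2, Set.image_insert_eq, Submodule.mem_span_insert] at h1
    obtain ⟨c, W, hW, hc⟩ := h1
    have hWt : W (coord _ (t 0)) = 0 := by
      clear hc
      induction hW using Submodule.span_induction with
      | mem W hW =>
        obtain ⟨j, hj, rfl⟩ := hW
        rw [Y_t, if_neg]
        have := hj.1
        omega
      | zero => rfl
      | add W W' _ _ h h' => rw [Derivation.add_apply, h, h', add_zero]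
      | smul c W _ h => rw [Derivation.smul_apply, h, smul_zero]
    have h3 := B.Y_t n (N + 1) 0
    rw [hc, Derivation.add_apply, hWt, add_zero, Derivation.smul_apply, Y_t, if_pos ⟨rfl, rfl⟩,
      if_neg (by omega), smul_eq_mul, mul_one] at h3
    rw [hc, h3, zero_smul, zero_add]
    exact hW
  have hall : ∀ i n, B.Y n (N + 1 + i) ∈
      Submodule.span (O (B.pt n)) (B.Y n '' Set.Icc 2 N) := by
    intro i
    induction i with
    | zero => exact htail
    | succ i ih =>
      intro n
      obtain ⟨m, rfl⟩ : ∃ m, n = m + 1 := ⟨n - 1, by ring⟩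
      rw [← add_assoc, ← conjD_Y _ _ (by omega)]
      refine B.conjD_mem_span ?_ (ih m)
      rintro _ ⟨j, hj, rfl⟩
      -- The conjugate of `Y_N` is `Y_{N+1}`, which the relation at the new site puts back into the
      -- span of `Y_2, …, Y_N`.
      rw [conjD_Y _ _ hj.1]
      rcases eq_or_lt_of_le hj.2 with rfl | h
      · exact htail _
      · exact Submodule.subset_span ⟨j + 1, ⟨by linarith [hj.1], h⟩, rfl⟩
  have hY : ∀ n, ∀ j ≥ 1, B.Y n j ∈ Submodule.span (O (B.pt n)) (B.Y n '' Set.Icc 1 N) := by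
    intro n j hj
    rcases Nat.lt_or_ge N j with h | h
    · obtain ⟨i, rfl⟩ := Nat.exists_eq_add_of_lt h
      have := hall i n
      rw [show N + 1 + i = N + i + 1 by ring] at this
      exact Submodule.span_mono (Set.image_mono (Set.Icc_subset_Icc_left (by simp))) this
    · exact Submodule.subset_span ⟨j, ⟨hj, h⟩, rfl⟩
  refine ⟨N, fun n => ?_, hY⟩
  have heq : B.Yspan n = Submodule.span (O (B.pt n)) (Set.range (Z n)) := by
    refine le_antisymm (Submodule.span_le.2 ?_) (Submodule.span_mono ?_)
    · rintro _ ⟨j, hj, rfl⟩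
      refine (Submodule.span_le.2 ?_ : Submodule.span (O (B.pt n)) (B.Y n '' Set.Icc 1 N) ≤ _)
        (hY n j hj)
      rintro _ ⟨i, hi, rfl⟩
      exact hYZ n i ⟨hi.1, hi.2.trans (Nat.le_succ N)⟩
    · rintro _ ⟨a, rfl⟩
      obtain ⟨j, hj, hj'⟩ := hZ n a
      exact ⟨j, hj.1, hj'⟩
  rw [heq]
  refine ⟨Module.Finite.span_of_finite _ (Set.finite_range _), ?_⟩
  rw [finrank_span_eq_card (linearIndependent_of_isUnit_minor (hu n)), Fintype.card_fin]

/-- A unit minor of size `finrank + 1` would give more independent fields in the envelope than its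
rank allows. -/
theorem not_isUnit_minor_of_finite_Yspan {n : ℤ} (h : Module.Finite (O (B.pt n)) (B.Yspan n)) :
    ∃ K : ℕ, ∀ Z : Fin K → Derivation ℝ (O (B.pt n)) (O (B.pt n)),
      (∀ a, Z a ∈ B.Y n '' Set.Icc 1 K) → ∀ v, ¬ IsUnit (minor Z v) := by
  refine ⟨Module.finrank (O (B.pt n)) (B.Yspan n) + 1, fun Z hZ v hv => ?_⟩
  have hli := linearIndependent_of_isUnit_minor hv
  have hZ' : ∀ a, Z a ∈ B.Yspan n := fun a => by
    obtain ⟨j, hj, hj'⟩ := hZ a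
    exact Submodule.subset_span ⟨j, hj.1, hj'⟩
  have hli' : LinearIndependent (O (B.pt n)) fun a => (⟨Z a, hZ' a⟩ : B.Yspan n) :=
    LinearIndependent.of_comp (B.Yspan n).subtype hli
  have := hli'.fintype_card_le_finrank
  simp at this

end Chain.Background


/-! ### Frobenius' theorem for germs in finitely many variables. -/

section GermFrobenius

variable {p : Phase}

theorem eventually_of_restrict {s : Finset Var} {P : (s → ℝ) → Prop}
    (h : ∀ᶠ y : Phase in 𝓝 p, P (s.restrict y)) : ∀ᶠ z in 𝓝 (s.restrict p), P z := by
  let up : (s → ℝ) → Phase := fun z v => if hv : v ∈ s then z ⟨v, hv⟩ else p v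
  have hup : Continuous up := continuous_pi fun v => by
    by_cases hv : v ∈ s
    · simp only [up, hv, dite_true]; fun_prop
    · simp only [up, hv, dite_false]; fun_prop
  have hup0 : up (s.restrict p) = p := by
    funext v
    simp [up, Finset.restrict]
  have hres : ∀ z, s.restrict (up z) = z := fun z => by
    funext v
    simp [up, Finset.restrict]
  have h2 : Tendsto up (𝓝 (s.restrict p)) (𝓝 p) := by
    have := hup.tendsto (s.restrict p)
    rwa [hup0] at this
  filter_upwards [h2.eventually h] with z hz
  rwa [hres] at hz

theorem ofFin_eq_iff {s : Finset Var} {H H' : (s → ℝ) → ℝ} (hH : ContDiff ℝ ∞ H)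
    (hH' : ContDiff ℝ ∞ H') : ofFin p hH = ofFin p hH' ↔ H =ᶠ[𝓝 (s.restrict p)] H' := by
  refine ⟨fun h => ?_, fun h => mkO_eq ?_⟩
  · exact eventually_of_restrict (Germ.coe_eq.1 (congrArg Subtype.val h))
  · exact (continuous_restr s).continuousAt.eventually h

/-- The set `s` is prescribed here, so that all coefficients of a system are functions on one and
the same finite-dimensional space. -/
theorem exists_ofFin_of_partialD_eq_zero {s : Finset Var} {a : O p}
    (ha : ∀ v ∉ s, partialD v a = 0) :
    ∃ (H : (s → ℝ) → ℝ) (hH : ContDiff ℝ ∞ H), a = ofFin p hH := by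
  obtain ⟨h, ⟨s', hs', H, h1, h2⟩, h3⟩ := mem_smoothGerms_iff (V := (s : Set Var)).2
    fun v hv => ha v (by simpa using hv)
  obtain ⟨H', h4, h5⟩ := exists_contDiff_eventuallyEq h1
  have hsub : s' ⊆ s := fun v hv => by simpa using hs' hv
  let r : (s → ℝ) → (s' → ℝ) := fun z v => z ⟨v, hsub v.2⟩
  have hr : ContDiff ℝ ∞ r := contDiff_pi.2 fun v => by fun_prop
  refine ⟨fun z => H' (r z), h4.comp hr, Subtype.ext (h3.trans (Germ.coe_eq.2 ?_))⟩
  filter_upwards [h2, (continuous_restr s').continuousAt.eventually h5] with y hy hy'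
  exact hy.trans hy'.symm

theorem ofFin_mul {s : Finset Var} {H H' : (s → ℝ) → ℝ} (hH : ContDiff ℝ ∞ H)
    (hH' : ContDiff ℝ ∞ H') : ofFin p hH * ofFin p hH' = ofFin p (hH.mul hH') := rfl

theorem ofFin_sum {ι : Type} (S : Finset ι) {s : Finset Var} {H : ι → (s → ℝ) → ℝ}
    (hH : ∀ i, ContDiff ℝ ∞ (H i)) :
    ∑ i ∈ S, ofFin p (hH i) = ofFin p (H := fun z => ∑ i ∈ S, H i z)
      (ContDiff.sum fun i _ => hH i) :=
  mkO_sum S _ _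

theorem ofFin_const (c : ℝ) (s : Finset Var) :
    ofFin p (s := s) (H := fun _ => c) contDiff_const = algebraMap ℝ (O p) c := by
  rw [Algebra.algebraMap_eq_smul_one]
  refine Subtype.ext (Germ.coe_eq.2 (Eventually.of_forall fun y => ?_))
  simp

/-- Frobenius' theorem for the system of vector fields `∑ l, c a l ∂/∂l` in normal form: there is a
common first integral that depends on any given one of the variables not among the `v a`. -/
theorem exists_germ_firstIntegral {s : Finset Var} {r : ℕ} (v : Fin r → s)
    (c : Fin r → s → O p) (hc : ∀ a w, ∀ u ∉ s, partialD u (c a w) = 0)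
    (hδ : ∀ a b, c a (v b) = if a = b then 1 else 0)
    (hint : ∀ a b w, ∑ l : s, c a l * partialD (l : Var) (c b w) =
      ∑ l : s, c b l * partialD (l : Var) (c a w))
    (w₀ : s) (hw₀ : ∀ a, v a ≠ w₀) :
    ∃ I : O p, (∀ u ∉ s, partialD u I = 0) ∧ (∀ a, ∑ l : s, c a l * partialD (l : Var) I = 0) ∧
      partialD (w₀ : Var) I ≠ 0 := by
  classical
  choose H hH hcH using fun a w => exists_ofFin_of_partialD_eq_zero (hc a w)
  let z₀ : s → ℝ := s.restrict p
  -- The projection onto the plane spanned by the fields along `{e | e (v a) = 0}`. This kernel is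
  -- independent of the point because of the normalization `hδ`.
  let c' : (s → ℝ) → (s → ℝ) →L[ℝ] (s → ℝ) := fun z =>
    ∑ a, ContinuousLinearMap.smulRightL ℝ (s → ℝ) (s → ℝ)
    (ContinuousLinearMap.proj (v a)) (fun w => H a w z)
  have hc'_apply : ∀ z e, c' z e = ∑ a, e (v a) • fun w => H a w z := fun z e => by
    simp [c']
  have hHpi : ∀ a, ContDiff ℝ ∞ fun z (w : s) => H a w z := fun a => contDiff_pi.2 (hH a)
  have hc's : ContDiff ℝ ∞ c' := ContDiff.sum fun a _ =>
    (ContinuousLinearMap.smulRightL ℝ (s → ℝ) (s → ℝ) (ContinuousLinearMap.proj (v a))).contDiff.comp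
      (hHpi a)
  have hc'd : ∀ z h e, fderiv ℝ c' z h e = ∑ a, e (v a) • fun w => fderiv ℝ (H a w) z h := by
    intro z h e
    have h1 : ∀ a, HasFDerivAt (fun z (w : s) => H a w z)
        (ContinuousLinearMap.pi fun w => fderiv ℝ (H a w) z) z := fun a =>
      hasFDerivAt_pi.2 fun w => ((hH a w).differentiable (by simp) z).hasFDerivAt
    have h2 : HasFDerivAt c' _ z := HasFDerivAt.fun_sum fun a (_ : a ∈ Finset.univ) =>
      (ContinuousLinearMap.smulRightL ℝ (s → ℝ) (s → ℝ)
        (ContinuousLinearMap.proj (v a))).hasFDerivAt.comp z (h1 a)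
    rw [h2.fderiv]
    funext w
    simp
  have hδ' : ∀ᶠ z in 𝓝 z₀, ∀ a b, H a (v b) z = if a = b then 1 else 0 := by
    rw [eventually_all]; intro a
    rw [eventually_all]; intro b
    have h1 := hδ a b
    rw [hcH a (v b)] at h1
    refine (ofFin_eq_iff (hH a (v b)) (contDiff_const (c := if a = b then (1 : ℝ) else 0))).1 ?_
    rw [h1, ofFin_const, apply_ite (algebraMap ℝ (O p)), map_one, map_zero]
  have hint' : ∀ᶠ z in 𝓝 z₀, ∀ a b w,
      ∑ l : s, H a l z * fderiv ℝ (H b w) z (Pi.single l 1) =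
        ∑ l : s, H b l z * fderiv ℝ (H a w) z (Pi.single l 1) := by
    rw [eventually_all]; intro a
    rw [eventually_all]; intro b
    rw [eventually_all]; intro w
    have h1 : ∀ a b w, ∑ l : s, c a l * partialD (l : Var) (c b w) =
        ofFin p (H := fun z => ∑ l : s, H a l z * fderiv ℝ (H b w) z (Pi.single l 1))
          (ContDiff.sum fun l _ => (hH a l).mul (contDiff_fderiv_single (hH b w) _)) := by
      intro a b w
      rw [← ofFin_sum Finset.univ fun l =>
        (hH a l).mul (contDiff_fderiv_single (hH b w) (Pi.single l 1))]
      refine Finset.sum_congr rfl fun l _ => ?_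
      rw [hcH a l, hcH b w, partialD_ofFin, ofFin_mul]
    have h2 := hint a b w
    rw [h1, h1] at h2
    exact (ofFin_eq_iff _ _).1 h2
  have hproj : ∀ z, (∀ a b, H a (v b) z = if a = b then 1 else 0) → ∀ e b,
      c' z e (v b) = e (v b) := by
    intro z hz e b
    rw [hc'_apply, Finset.sum_apply]
    simp [hz]
  obtain ⟨J, hJ1, hJ2, hJ3⟩ := exists_firstIntegral (z₀ := z₀) (c := c')
    (Eventually.of_forall fun z => hc's.contDiffAt)
    (by
      rw [nhds_prod_eq]
      filter_upwards [(tendsto_snd (f := 𝓝 z₀) (g := 𝓝 z₀)).eventually hδ'] with q hq e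
      rw [hc'_apply q.1, hc'_apply q.1]
      exact Finset.sum_congr rfl fun a _ => by rw [hproj q.2 hq])
    (by
      filter_upwards [hδ', hint'] with z hz hz' e e'
      have key : ∀ e e' w, fderiv ℝ c' z (c' z e) e' w = ∑ b, ∑ a, e' (v b) * (e (v a) *
          ∑ l : s, H a l z * fderiv ℝ (H b w) z (Pi.single l 1)) := by
        intro e e' w
        rw [hc'd, Finset.sum_apply]
        refine Finset.sum_congr rfl fun b _ => ?_
        rw [Pi.smul_apply, smul_eq_mul, ← Finset.mul_sum]
        congr 1
        rw [clm_apply_eq_sum]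
        simp only [hc'_apply, Finset.sum_apply, Pi.smul_apply, smul_eq_mul, Finset.sum_mul]
        rw [Finset.sum_comm]
        refine Finset.sum_congr rfl fun a _ => ?_
        rw [Finset.mul_sum]
        exact Finset.sum_congr rfl fun l _ => mul_assoc _ _ _
      funext w
      rw [key, key, Finset.sum_comm]
      refine Finset.sum_congr rfl fun a _ => Finset.sum_congr rfl fun b _ => ?_
      rw [hz' a b w]
      ring)
  -- The component with index `w₀` is the one needed. The unit vector at `w₀` lies in the kernel of
  -- the projection, so the derivative of this component along it is `1` at `z₀`.
  have hj : ∀ᶠ z in 𝓝 z₀, ContDiffAt ℝ ∞ (fun z => J z w₀) z := by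
    filter_upwards [hJ1] with z hz
    exact contDiffAt_pi.1 hz w₀
  obtain ⟨j, hj1, hj2⟩ := exists_contDiff_eventuallyEq hj
  have hjd : ∀ᶠ z in 𝓝 z₀, ∀ e, fderiv ℝ j z e = fderiv ℝ J z e w₀ := by
    filter_upwards [hj2.eventuallyEq_nhds, hJ1] with z hz hz' e
    rw [hz.fderiv_eq]
    have h1 := (hz'.differentiableAt (by simp)).hasFDerivAt
    rw [(hasFDerivAt_pi'.1 h1 w₀).fderiv]
    rfl
  refine ⟨ofFin p hj1, fun u hu => partialD_ofFin_of_notMem hj1 hu, fun a => ?_, ?_⟩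
  · have h1 : ∑ l : s, c a l * partialD (l : Var) (ofFin p hj1) =
        ofFin p (H := fun z => ∑ l : s, H a l z * fderiv ℝ j z (Pi.single l 1))
          (ContDiff.sum fun l _ => (hH a l).mul (contDiff_fderiv_single hj1 _)) := by
      rw [← ofFin_sum Finset.univ fun l =>
        (hH a l).mul (contDiff_fderiv_single hj1 (Pi.single l 1))]
      refine Finset.sum_congr rfl fun l _ => ?_
      rw [hcH a l, partialD_ofFin, ofFin_mul]
    rw [h1, ← map_zero (algebraMap ℝ (O p)), ← ofFin_const 0 s, ofFin_eq_iff]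
    filter_upwards [hJ2, hjd, hδ'] with z hz hz' hz''
    have h2 : c' z (Pi.single (v a) 1) = fun w => H a w z := by
      rw [hc'_apply]
      -- Injectivity of `v` is not a hypothesis; it follows from the normalization.
      have hva : ∀ b, (Pi.single (v a) 1 : s → ℝ) (v b) = if a = b then 1 else 0 := by
        intro b
        by_cases hab : a = b
        · subst hab; simp
        · have : v b ≠ v a := fun h => by
            have h3 := hz'' a b
            rw [h, hz'', if_pos rfl, if_neg hab] at h3
            exact one_ne_zero h3
          rw [Pi.single_eq_of_ne this, if_neg hab]
      simp [hva]
    have h3 : fderiv ℝ j z (fun w => H a w z) = 0 := by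
      rw [hz', ← h2, hz]
      rfl
    rw [clm_apply_eq_sum] at h3
    exact h3
  · intro h0
    rw [partialD_ofFin hj1] at h0
    have h1 : fderiv ℝ j z₀ (Pi.single w₀ 1) = 0 := congrArg O.value h0
    rw [hjd.self_of_nhds, hJ3, hc'_apply] at h1
    simp [Pi.single_eq_of_ne (hw₀ _)] at h1

end GermFrobenius


/-! ### Lie algebras of vector fields with functional coefficients. -/

section LieAlgebras

variable {p : Phase}

theorem lie_smul_right (c : O p) (Z Z' : Derivation ℝ (O p) (O p)) :
    ⁅Z, c • Z'⁆ = c • ⁅Z, Z'⁆ + Z c • Z' := by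
  ext1 a
  simp only [Derivation.commutator_apply, Derivation.smul_apply, Derivation.add_apply,
    Derivation.leibniz, smul_eq_mul]
  ring

theorem lie_smul_left (c : O p) (Z Z' : Derivation ℝ (O p) (O p)) :
    ⁅c • Z, Z'⁆ = c • ⁅Z, Z'⁆ + (-Z' c) • Z := by
  ext1 a
  simp only [Derivation.commutator_apply, Derivation.smul_apply, Derivation.add_apply,
    Derivation.leibniz, smul_eq_mul]
  ring

theorem derivation_lie_add (Z Z₁ Z₂ : Derivation ℝ (O p) (O p)) :
    ⁅Z, Z₁ + Z₂⁆ = ⁅Z, Z₁⁆ + ⁅Z, Z₂⁆ := by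
  ext1 a
  simp only [Derivation.commutator_apply, Derivation.add_apply, map_add]
  ring

theorem derivation_add_lie (Z Z₁ Z₂ : Derivation ℝ (O p) (O p)) :
    ⁅Z₁ + Z₂, Z⁆ = ⁅Z₁, Z⁆ + ⁅Z₂, Z⁆ := by
  ext1 a
  simp only [Derivation.commutator_apply, Derivation.add_apply, map_add]
  ring

theorem derivation_lie_zero (Z : Derivation ℝ (O p) (O p)) :
    ⁅Z, (0 : Derivation ℝ (O p) (O p))⁆ = 0 := by
  ext1 a
  simp [Derivation.commutator_apply]

theorem derivation_zero_lie (Z : Derivation ℝ (O p) (O p)) :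
    ⁅(0 : Derivation ℝ (O p) (O p)), Z⁆ = 0 := by
  ext1 a
  simp [Derivation.commutator_apply]

/-- The linear combinations with functional coefficients of the elements of a Lie algebra of vector
fields form a Lie algebra. -/
noncomputable def spanLie (L : LieSubalgebra ℝ (Derivation ℝ (O p) (O p))) :
    LieSubalgebra ℝ (Derivation ℝ (O p) (O p)) where
  carrier := Submodule.span (O p) (L : Set (Derivation ℝ (O p) (O p)))
  add_mem' h h' := Submodule.add_mem _ h h'
  zero_mem' := Submodule.zero_mem _
  smul_mem' r Z hZ := Submodule.smul_of_tower_mem _ r hZ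
  lie_mem' {Z Z'} hZ hZ' := by
    have key : ∀ W ∈ L, ∀ Z' ∈ Submodule.span (O p) (L : Set (Derivation ℝ (O p) (O p))),
        ⁅W, Z'⁆ ∈ Submodule.span (O p) (L : Set (Derivation ℝ (O p) (O p))) := by
      intro W hW Z' hZ'
      induction hZ' using Submodule.span_induction with
      | mem Z' h => exact Submodule.subset_span (L.lie_mem hW h)
      | zero => rw [derivation_lie_zero]; exact Submodule.zero_mem _
      | add Z₁ Z₂ _ _ h1 h2 => rw [derivation_lie_add]; exact Submodule.add_mem _ h1 h2
      | smul c Z₁ h0 h1 =>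
        rw [lie_smul_right]
        exact Submodule.add_mem _ (Submodule.smul_mem _ _ h1) (Submodule.smul_mem _ _ h0)
    change ⁅Z, Z'⁆ ∈ Submodule.span (O p) (L : Set (Derivation ℝ (O p) (O p)))
    have hZ'' : Z' ∈ Submodule.span (O p) (L : Set (Derivation ℝ (O p) (O p))) := hZ'
    have hZ₀ : Z ∈ Submodule.span (O p) (L : Set (Derivation ℝ (O p) (O p))) := hZ
    clear hZ hZ'
    induction hZ₀ using Submodule.span_induction with
    | mem Z h => exact key Z h Z' hZ''
    | zero => rw [derivation_zero_lie]; exact Submodule.zero_mem _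
    | add Z₁ Z₂ _ _ h1 h2 => rw [derivation_add_lie]; exact Submodule.add_mem _ h1 h2
    | smul c Z₁ h0 h1 =>
      rw [lie_smul_left]
      exact Submodule.add_mem _ (Submodule.smul_mem _ _ h1) (Submodule.smul_mem _ _ h0)

/-- The vector fields that annihilate a function. -/
noncomputable def annihilator (a : O p) : LieSubalgebra ℝ (Derivation ℝ (O p) (O p)) where
  carrier := {Z | Z a = 0}
  add_mem' {Z Z'} h h' := by
    change Z a + Z' a = 0
    rw [show Z a = 0 from h, show Z' a = 0 from h', add_zero]
  zero_mem' := rfl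
  smul_mem' r Z h := by
    change r • Z a = 0
    rw [show Z a = 0 from h, smul_zero]
  lie_mem' {Z Z'} h h' := by
    change ⁅Z, Z'⁆ a = 0
    rw [Derivation.commutator_apply, show Z a = 0 from h, show Z' a = 0 from h', map_zero, map_zero,
      sub_zero]

/-- The vector fields without component at `∂/∂x` and at `∂/∂t_k`, `k ∈ K`, that commute with
`∂/∂t_k`, `k ∈ K`, and do not raise the order of functions. -/
noncomputable def adapted (p : Phase) (K : Set ℤ) :
    LieSubalgebra ℝ (Derivation ℝ (O p) (O p)) where
  carrier := {Z | Z ∈ vanishingFields p K ∧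
    (∀ k ∈ K, ∀ a, partialD (t k) (Z a) = Z (partialD (t k) a)) ∧
    ∀ i, ∀ a ∈ orderLT p i, Z a ∈ orderLT p i}
  add_mem' {Z Z'} h h' := ⟨add_mem h.1 h'.1,
    fun k hk a => by simp only [Derivation.add_apply, map_add, h.2.1 k hk, h'.2.1 k hk],
    fun i a ha l hl => by
      rw [Derivation.add_apply, map_add, h.2.2 i a ha l hl, h'.2.2 i a ha l hl, add_zero]⟩
  zero_mem' := ⟨zero_mem _, fun k hk a => by simp, fun i a ha l hl => by simp⟩
  smul_mem' r Z h := ⟨Submodule.smul_of_tower_mem _ r h.1,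
    fun k hk a => by simp only [Derivation.smul_apply, Derivation.map_smul, h.2.1 k hk],
    fun i a ha l hl => by
      rw [Derivation.smul_apply, Derivation.map_smul, h.2.2 i a ha l hl, smul_zero]⟩
  lie_mem' {Z Z'} h h' := ⟨⟨fields_lie_mem h.1.1 h'.1.1,
    by rw [Derivation.commutator_apply, h.1.2.1, h'.1.2.1, map_zero, map_zero, sub_zero],
    fun k hk => by
      rw [Derivation.commutator_apply, h.1.2.2 k hk, h'.1.2.2 k hk, map_zero, map_zero, sub_zero]⟩,
    fun k hk a => by
      simp only [Derivation.commutator_apply, map_sub, h.2.1 k hk, h'.2.1 k hk],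
    fun i a ha l hl => by
      rw [Derivation.commutator_apply, map_sub, h.2.2 i _ (h'.2.2 i a ha) l hl,
        h'.2.2 i _ (h.2.2 i a ha) l hl, sub_zero]⟩

end LieAlgebras

/-! ### The Lie algebra of all `Y_j` and `X_j`, and its invariants. -/

namespace Chain.Background

variable {C : Chain} (B : C.Background)

/-- The Lie algebra generated by all `Y_j` and `X_j`. -/
noncomputable def fullLie (n : ℤ) : LieSubalgebra ℝ (Derivation ℝ (O (B.pt n)) (O (B.pt n))) :=
  LieSubalgebra.lieSpan ℝ _ (B.Y n '' Set.Ici 1 ∪ B.X n '' Set.Ici 1)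

/-- The Lie algebra generated by `Y_1, …, Y_N, X_1, …, X_N`. -/
noncomputable def charLie (N : ℕ) (n : ℤ) :
    LieSubalgebra ℝ (Derivation ℝ (O (B.pt n)) (O (B.pt n))) :=
  LieSubalgebra.lieSpan ℝ _ (B.Y n '' Set.Icc 1 N ∪ B.X n '' Set.Icc 1 N)

theorem Y_mem_fullLie (n : ℤ) {j : ℕ} (hj : 1 ≤ j) : B.Y n j ∈ B.fullLie n :=
  LieSubalgebra.subset_lieSpan (Or.inl ⟨j, hj, rfl⟩)

theorem X_mem_fullLie (n : ℤ) {j : ℕ} (hj : 1 ≤ j) : B.X n j ∈ B.fullLie n :=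
  LieSubalgebra.subset_lieSpan (Or.inr ⟨j, hj, rfl⟩)

theorem charLie_le_fullLie (N : ℕ) (n : ℤ) : B.charLie N n ≤ B.fullLie n :=
  LieSubalgebra.lieSpan_mono (Set.union_subset_union (Set.image_mono fun _ h => h.1)
    (Set.image_mono fun _ h => h.1))

theorem Y_mem_adapted (n : ℤ) {j : ℕ} (hj : 1 ≤ j) {K : Set ℤ} (hK : ∀ k ∈ K, k < -j ∨ 0 < k) :
    B.Y n j ∈ adapted (B.pt n) K := by
  refine ⟨⟨B.Y_mem n j, B.Y_x n j, fun k hk => ?_⟩, fun k hk a => ?_,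
    fun i a ha => B.Y_mem_orderLT n hj ha⟩
  · rw [Y_t, if_neg]
    have := hK k hk
    omega
  · have := congrArg (fun Z => Z a) (B.lie_partialD_Y n k hj (hK k hk))
    exact sub_eq_zero.1 this

theorem X_mem_adapted (n : ℤ) {j : ℕ} {K : Set ℤ} (hK : -(j : ℤ) ∉ K) :
    B.X n j ∈ adapted (B.pt n) K := by
  refine ⟨⟨B.X_mem n j, B.X_x n j, fun k hk => ?_⟩, fun k hk a => partialD_comm _ _ _,
    fun i a ha => partialD_mem_orderLT _ ha⟩
  rw [X_t, if_neg]
  rintro rfl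
  exact hK hk

theorem fullLie_le_adapted (n : ℤ) : B.fullLie n ≤ adapted (B.pt n) (Set.Ioi 0) := by
  refine LieSubalgebra.lieSpan_le.2 ?_
  rintro _ (⟨j, hj, rfl⟩ | ⟨j, hj, rfl⟩)
  · exact B.Y_mem_adapted n hj fun k hk => Or.inr hk
  · exact B.X_mem_adapted n (by simp)

/-- With only `N` generators of each kind the excluded indices also include those below `-N`. Hence
`X_j`, `j > N`, commutes with the whole algebra, which has no component there. -/
theorem charLie_le_adapted (N : ℕ) (n : ℤ) :
    B.charLie N n ≤ adapted (B.pt n) {k | k < -N ∨ 0 < k} := by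
  refine LieSubalgebra.lieSpan_le.2 ?_
  rintro _ (⟨j, hj, rfl⟩ | ⟨j, hj, rfl⟩)
  · refine B.Y_mem_adapted n hj.1 fun k hk => ?_
    have := hj.2
    simp only [Set.mem_ofPred_eq] at hk
    omega
  · refine B.X_mem_adapted n ?_
    have := hj.2
    simp only [Set.mem_ofPred_eq]
    omega

theorem jets_X (n : ℤ) {j : ℕ} (hj : 1 ≤ j) : jets _ (B.X n j) = 0 := by
  funext i
  match i with
  | 0 =>
    change B.X n j (coord _ (t 0)) = 0
    rw [X_t, if_neg (by omega)]
  | i + 1 => exact B.X_d n j i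

/-- The sums of an element of `charLie N n` and a
combination of the `X_j`, `j > N`, with constant coefficients. -/
noncomputable def charLieAddX (N : ℕ) (n : ℤ) :
    LieSubalgebra ℝ (Derivation ℝ (O (B.pt n)) (O (B.pt n))) where
  carrier := {Z | ∃ Z₁ ∈ B.charLie N n, ∃ Z₂ ∈ Submodule.span ℝ (B.X n '' Set.Ioi N), Z = Z₁ + Z₂}
  add_mem' := by
    rintro _ _ ⟨Z₁, h₁, Z₂, h₂, rfl⟩ ⟨W₁, k₁, W₂, k₂, rfl⟩
    exact ⟨Z₁ + W₁, (B.charLie N n).add_mem h₁ k₁, Z₂ + W₂, Submodule.add_mem _ h₂ k₂,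
      add_add_add_comm _ _ _ _⟩
  zero_mem' := ⟨0, (B.charLie N n).zero_mem, 0, Submodule.zero_mem _, (add_zero _).symm⟩
  smul_mem' := by
    rintro r _ ⟨Z₁, h₁, Z₂, h₂, rfl⟩
    exact ⟨r • Z₁, (B.charLie N n).smul_mem r h₁, r • Z₂, Submodule.smul_mem _ r h₂, smul_add _ _ _⟩
  lie_mem' := by
    have hc : ∀ Z₁ ∈ B.charLie N n, ∀ Z₂ ∈ Submodule.span ℝ (B.X n '' Set.Ioi N), ∀ a,
        Z₂ (Z₁ a) = Z₁ (Z₂ a) := by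
      intro Z₁ h₁ Z₂ h₂ a
      induction h₂ using Submodule.span_induction with
      | mem Z h =>
        obtain ⟨j, hj, rfl⟩ := h
        exact (B.charLie_le_adapted N n h₁).2.1 _ (Or.inl (by
          have : N < j := hj
          omega)) a
      | zero => simp
      | add Z Z' _ _ h h' => rw [Derivation.add_apply, Derivation.add_apply, h, h', map_add]
      | smul r Z _ h => rw [Derivation.smul_apply, Derivation.smul_apply, h, Derivation.map_smul]
    have hX : ∀ Z₁ ∈ Submodule.span ℝ (B.X n '' Set.Ioi N),
        ∀ Z₂ ∈ Submodule.span ℝ (B.X n '' Set.Ioi N), ∀ a, Z₂ (Z₁ a) = Z₁ (Z₂ a) := by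
      intro Z₁ h₁ Z₂ h₂ a
      induction h₂ using Submodule.span_induction with
      | mem Z h =>
        obtain ⟨j, hj, rfl⟩ := h
        induction h₁ using Submodule.span_induction with
        | mem Z h =>
          obtain ⟨i, hi, rfl⟩ := h
          exact partialD_comm _ _ _
        | zero => simp
        | add Z Z' _ _ h h' => rw [Derivation.add_apply, Derivation.add_apply, map_add, h, h']
        | smul r Z _ h => rw [Derivation.smul_apply, Derivation.smul_apply, Derivation.map_smul, h]
      | zero => simp
      | add Z Z' _ _ h h' => rw [Derivation.add_apply, Derivation.add_apply, h, h', map_add]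
      | smul r Z _ h => rw [Derivation.smul_apply, Derivation.smul_apply, h, Derivation.map_smul]
    rintro _ _ ⟨Z₁, h₁, Z₂, h₂, rfl⟩ ⟨W₁, k₁, W₂, k₂, rfl⟩
    refine ⟨⁅Z₁, W₁⁆, (B.charLie N n).lie_mem h₁ k₁, 0, Submodule.zero_mem _, ?_⟩
    ext1 a
    simp only [Derivation.commutator_apply, Derivation.add_apply, map_add, hc Z₁ h₁ W₂ k₂,
      hc W₁ k₁ Z₂ h₂, hX Z₂ h₂ W₂ k₂, Derivation.zero_apply]
    abel

/-- The `Y_j` with `j > N` are combinations of the first `N`. The `X_j` with `j > N` commute with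
`L_n` and with each other, so they enter only additively, and their jets vanish. Finite generation
of `L_n` therefore bounds the rank of the full algebra. -/
theorem exists_charAlgebra_jets_eq {N : ℕ} {n : ℤ}
    (hY : ∀ j ≥ 1, B.Y n j ∈ Submodule.span (O (B.pt n)) (B.Y n '' Set.Icc 1 N))
    {Z : Derivation ℝ (O (B.pt n)) (O (B.pt n))} (hZ : Z ∈ B.fullLie n) :
    ∃ Z' ∈ B.charAlgebra N n, jets _ Z = jets _ Z' := by
  have h1 : B.fullLie n ≤ spanLie (B.charLieAddX N n) := by
    refine LieSubalgebra.lieSpan_le.2 ?_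
    rintro _ (⟨j, hj, rfl⟩ | ⟨j, hj, rfl⟩)
    · refine Submodule.span_mono ?_ (hY j hj)
      rintro _ ⟨i, hi, rfl⟩
      exact ⟨B.Y n i, LieSubalgebra.subset_lieSpan (Or.inl ⟨i, hi, rfl⟩), 0, Submodule.zero_mem _,
        (add_zero _).symm⟩
    · refine Submodule.subset_span ?_
      rcases Nat.lt_or_ge N j with h | h
      · exact ⟨0, (B.charLie N n).zero_mem, B.X n j, Submodule.subset_span ⟨j, h, rfl⟩,
          (zero_add _).symm⟩
      · exact ⟨B.X n j, LieSubalgebra.subset_lieSpan (Or.inr ⟨j, ⟨hj, h⟩, rfl⟩), 0, Submodule.zero_mem _,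
          (add_zero _).symm⟩
  have h2 : Submodule.span (O (B.pt n)) (B.charLieAddX N n : Set _) ≤
      (Submodule.map (jets _) (B.charAlgebra N n)).comap (jets _) := by
    refine Submodule.span_le.2 ?_
    rintro _ ⟨Z₁, h₁, Z₂, h₂, rfl⟩
    refine ⟨Z₁, Submodule.subset_span h₁, ?_⟩
    have h3 : jets _ Z₂ = 0 := by
      induction h₂ using Submodule.span_induction with
      | mem Z h =>
        obtain ⟨j, hj, rfl⟩ := h
        exact B.jets_X n (Nat.one_le_of_lt hj)
      | zero => exact map_zero _
      | add Z Z' _ _ h h' => rw [map_add, h, h', add_zero]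
      | smul r Z _ h =>
        funext i
        have := congrFun h i
        simp only [jets_apply, Pi.zero_apply] at this
        simp [this]
    rw [map_add, h3, add_zero]
  obtain ⟨Z', hZ', h⟩ := h2 (h1 hZ)
  exact ⟨Z', hZ', h.symm⟩

/-- The preimage of a Lie algebra of vector fields under conjugation. -/
noncomputable def comapConj {p q : Phase} (e : O q ≃ₐ[ℝ] O p)
    (L : LieSubalgebra ℝ (Derivation ℝ (O q) (O q))) :
    LieSubalgebra ℝ (Derivation ℝ (O p) (O p)) where
  carrier := {Z | conjD e Z ∈ L}
  add_mem' {Z Z'} h h' := by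
    change conjD e (Z + Z') ∈ L
    rw [conjD_add]
    exact L.add_mem h h'
  zero_mem' := by
    change conjD e 0 ∈ L
    rw [conjD_zero]
    exact L.zero_mem
  smul_mem' r Z h := by
    change conjD e (r • Z) ∈ L
    rw [conjD_smul_real]
    exact L.smul_mem r h
  lie_mem' {Z Z'} h h' := by
    change conjD e ⁅Z, Z'⁆ ∈ L
    rw [conjD_lie]
    exact L.lie_mem h h'

/-- Conjugation respects brackets, so the generators suffice; the sum `Y_2 + X_1` arising from `Y_1`
again lies in the algebra. -/
theorem fullLie_le_comapConj (n : ℤ) :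
    B.fullLie n ≤ comapConj (B.shift n) (B.fullLie (n + 1)) := by
  refine LieSubalgebra.lieSpan_le.2 ?_
  have hX := fun j hj => B.X_mem_fullLie (n + 1) (j := j) hj
  have hY := fun j hj => B.Y_mem_fullLie (n + 1) (j := j) hj
  generalize B.fullLie (n + 1) = L at *
  rintro _ (⟨j, hj, rfl⟩ | ⟨j, hj, rfl⟩)
  · change conjD (B.shift n) (B.Y n j) ∈ L
    rcases Nat.eq_or_lt_of_le (show 1 ≤ j from hj) with rfl | h
    · rw [conjD_Y_one]
      exact L.add_mem (hY 2 (by simp)) (hX 1 le_rfl)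
    · rw [conjD_Y _ _ h]
      exact hY (j + 1) (by simp)
  · change conjD (B.shift n) (B.X n j) ∈ L
    rw [conjD_X _ _ hj]
    exact hX (j + 1) (by simp)

/-- The vector fields in the Lie algebra generated by all `Y_j` and `X_j`, as a set. -/
noncomputable def fullSet (n : ℤ) : Set (Derivation ℝ (O (B.pt n)) (O (B.pt n))) := B.fullLie n

theorem Y_mem_fullSet (n : ℤ) {j : ℕ} (hj : 1 ≤ j) : B.Y n j ∈ B.fullSet n := B.Y_mem_fullLie n hj

theorem X_mem_fullSet (n : ℤ) {j : ℕ} (hj : 1 ≤ j) : B.X n j ∈ B.fullSet n := B.X_mem_fullLie n hj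

theorem conjD_mem_fullSet {n : ℤ} {Z : Derivation ℝ (O (B.pt n)) (O (B.pt n))}
    (hZ : Z ∈ B.fullSet n) : conjD (B.shift n) Z ∈ B.fullSet (n + 1) :=
  B.fullLie_le_comapConj n hZ

theorem mem_vanishingFields_of_mem_fullSet {n : ℤ} {Z : Derivation ℝ (O (B.pt n)) (O (B.pt n))}
    (hZ : Z ∈ B.fullSet n) : Z ∈ vanishingFields (B.pt n) (Set.Ioi 0) :=
  (B.fullLie_le_adapted n hZ).1

/-- The functions of `x, t, t_x, …` and of `t_k`, `k < 0`, that are annihilated by all `Y_j` and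
`X_j`. -/
structure IsInvariant (n : ℤ) (a : O (B.pt n)) : Prop where
  Y_eq_zero : ∀ j ≥ 1, B.Y n j a = 0
  X_eq_zero : ∀ j ≥ 1, B.X n j a = 0
  partialD_eq_zero : ∀ k : ℤ, 0 < k → partialD (t k) a = 0

variable {B}

theorem IsInvariant.fullSet_eq_zero {n : ℤ} {a : O (B.pt n)} (ha : B.IsInvariant n a)
    {Z : Derivation ℝ (O (B.pt n)) (O (B.pt n))} (hZ : Z ∈ B.fullSet n) : Z a = 0 := by
  have : B.fullLie n ≤ annihilator a := by
    refine LieSubalgebra.lieSpan_le.2 ?_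
    rintro _ (⟨j, hj, rfl⟩ | ⟨j, hj, rfl⟩)
    · exact ha.Y_eq_zero j hj
    · exact ha.X_eq_zero j hj
  exact this hZ

theorem apply_shift (n : ℤ) (Z : Derivation ℝ (O (B.pt n)) (O (B.pt n))) (a : O (B.pt (n + 1))) :
    Z (B.shift n a) = B.shift n (conjD (B.shift n) Z a) := by
  rw [conjD_apply, AlgEquiv.apply_symm_apply]

/-- Every field to be tested on `D a` is conjugate to a combination of generators or to some
`∂/∂t_{k-1}` with `k ≥ 2`. In particular `∂/∂t_1` becomes `Y_1`. No rank assumption enters in this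
direction. -/
theorem IsInvariant.shift {n : ℤ} {a : O (B.pt (n + 1))} (ha : B.IsInvariant (n + 1) a) :
    B.IsInvariant n (B.shift n a) where
  Y_eq_zero j hj := by
    rw [apply_shift]
    rcases Nat.eq_or_lt_of_le hj with rfl | h
    · rw [conjD_Y_one, Derivation.add_apply, ha.Y_eq_zero 2 (by simp), ha.X_eq_zero 1 le_rfl,
        add_zero, map_zero]
    · rw [conjD_Y _ _ h, ha.Y_eq_zero _ (by simp), map_zero]
  X_eq_zero j hj := by
    rw [apply_shift, conjD_X _ _ hj, ha.X_eq_zero _ (by simp), map_zero]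
  partialD_eq_zero k hk := by
    rw [apply_shift]
    rcases eq_or_ne k 1 with rfl | h
    · rw [conjD_partialD_t_one, ha.Y_eq_zero 1 le_rfl, map_zero]
    · rw [conjD_partialD_t _ _ (by omega) h, ha.partialD_eq_zero _ (by omega), map_zero]

end Chain.Background

end SemiDiscrete

/-! ### Stability of the invariants under the inverse shift. -/

theorem Matrix.eq_zero_of_mulVec_eq_zero_of_isUnit_det_mul {R ι : Type} [CommRing R] [Fintype ι]
    [DecidableEq ι] {M P : Matrix ι ι R} (h : IsUnit (M * P).det) {g : ι → R}
    (hg : M.mulVec g = 0) : g = 0 := by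
  rw [Matrix.det_mul] at h
  have hM := isUnit_of_mul_isUnit_left h
  rw [← Matrix.one_mulVec g, ← Matrix.nonsing_inv_mul M hM, ← Matrix.mulVec_mulVec, hg,
    Matrix.mulVec_zero]

namespace SemiDiscrete

open Chain.Background Chain Var

namespace Chain.Background

variable {C : Chain} {B : C.Background}

/-- Once the jets are matched by the frame and the component at `t_{-1}` by a multiple of `X_1`, the
difference has components only at `t_{-j}`, `j ≥ 2`, to which `h` is blind. -/
theorem exists_fullSet_expansion {n : ℤ} {r : ℕ}
    {W : Fin r → Derivation ℝ (O (B.pt n)) (O (B.pt n))} {w : Fin r → ℕ}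
    (hW : ∀ a, W a ∈ B.fullSet n) (hWu : IsUnit (minor W w))
    (hr : ∀ Z : Fin (r + 1) → Derivation ℝ (O (B.pt n)) (O (B.pt n)),
      (∀ a, Z a ∈ B.fullSet n) → ∀ v, minor Z v = 0)
    {F : Derivation ℝ (O (B.pt n)) (O (B.pt n))} (hF : F ∈ B.fullSet n) :
    ∃ (c : Fin r → O (B.pt n)) (β : O (B.pt n)), ∀ h : O (B.pt n),
      (∀ j ≥ 2, B.X n j h = 0) → F h = ∑ j, c j * W j h + β * B.X n 1 h := by
  have h1 := jets_mem_span_of_minors_eq_zero hW hWu hr hF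
  rw [Submodule.mem_span_range_iff_exists_fun] at h1
  obtain ⟨c, hc⟩ := h1
  set V := vanishingFields (B.pt n) (Set.Ioi 0)
  obtain ⟨S, hS, hS'⟩ : ∃ S ∈ V, ∀ h, S h = ∑ j, c j * W j h := by
    refine ⟨∑ j, c j • W j, sum_mem fun j _ => Submodule.smul_mem _ _
      (B.mem_vanishingFields_of_mem_fullSet (hW j)), fun h => ?_⟩
    rw [← Derivation.coeFnAddMonoidHom_apply, map_sum, Finset.sum_apply]
    rfl
  have hF' : F ∈ V := B.mem_vanishingFields_of_mem_fullSet hF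
  have hjet : ∀ i, F (coord _ (jetVar i)) = S (coord _ (jetVar i)) := fun i => by
    rw [hS', ← jets_apply, ← hc, Finset.sum_apply]
    rfl
  let β := F (coord _ (t (-1))) - S (coord _ (t (-1)))
  refine ⟨c, β, fun h hh => ?_⟩
  rw [← hS']
  have hE : F + (-1 : O (B.pt n)) • (S + β • B.X n 1) ∈ V :=
    V.add_mem hF' (V.smul_mem _ (V.add_mem hS (V.smul_mem _
      (B.mem_vanishingFields_of_mem_fullSet (B.X_mem_fullSet n le_rfl)))))
  have happ : ∀ a, (F + (-1 : O (B.pt n)) • (S + β • B.X n 1)) a = F a - (S a + β * B.X n 1 a) :=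
    fun a => by
      simp only [Derivation.add_apply, Derivation.smul_apply, smul_eq_mul]
      ring
  have hXj : ∀ i, B.X n 1 (coord _ (jetVar i)) = 0 := fun i =>
    congrFun (B.jets_X n le_rfl) i
  rw [← sub_eq_zero, ← happ]
  refine fields_apply_eq_zero hE.1 fun v => ?_
  match v with
  | x => rw [hE.2.1, zero_mul]
  | d i =>
    rw [happ]
    have h1 : F (coord _ (d i)) = S (coord _ (d i)) := hjet (i + 1)
    have h2 : B.X n 1 (coord _ (d i)) = 0 := hXj (i + 1)
    rw [h1, h2, mul_zero, add_zero, sub_self, zero_mul]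
  | t k =>
    rcases lt_trichotomy k 0 with hk | rfl | hk
    · rcases eq_or_ne k (-1) with rfl | hk'
      · rw [happ, X_t, if_pos (by simp), mul_one]
        simp [β]
      · have h1 : partialD (t k) h = 0 := by
          have h2 := hh k.natAbs (by omega)
          rwa [X, show -(k.natAbs : ℤ) = k by omega] at h2
        rw [h1, mul_zero]
    · rw [happ]
      have h1 : F (coord _ (t 0)) = S (coord _ (t 0)) := hjet 0
      have h2 : B.X n 1 (coord _ (t 0)) = 0 := hXj 0
      rw [h1, h2, mul_zero, add_zero, sub_self, zero_mul]
    · rw [hE.2.2 k hk, zero_mul]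

theorem conjD_symm (n : ℤ) (Z : Derivation ℝ (O (B.pt n)) (O (B.pt n))) (b : O (B.pt n)) :
    conjD (B.shift n) Z ((B.shift n).symm b) = (B.shift n).symm (Z b) := by
  rw [conjD_apply, AlgEquiv.apply_symm_apply]

theorem partialD_t_coord_jetVar {p : Phase} {k : ℤ} (hk : k ≠ 0) (i : ℕ) :
    partialD (t k) (coord p (jetVar i)) = 0 := by
  rw [partialD_coord, if_neg]
  match i with
  | 0 => simpa [jetVar] using hk
  | i + 1 => simp [jetVar]

/-- The conjugates of a frame at the site `n`, together with `Y_1`, are `r + 1` fields that kill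
`D^{-1} a`. On functions independent of `t_{-2}, t_{-3}, …` they are combinations of the `r + 1`
fields `W_1, …, W_r, X_1` at the site `n + 1`. The rank being the same at both sites, the
coefficient matrix is square; it turns out to be invertible, so `X_1` kills `D^{-1} a` as well. -/
theorem IsInvariant.X_one_shift_symm {n : ℤ} {r : ℕ}
    {Z : Fin r → Derivation ℝ (O (B.pt n)) (O (B.pt n))} {v : Fin r → ℕ}
    (hZ : ∀ a, Z a ∈ B.fullSet n) (hZu : IsUnit (minor Z v))
    {W : Fin r → Derivation ℝ (O (B.pt (n + 1))) (O (B.pt (n + 1)))} {w : Fin r → ℕ}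
    (hW : ∀ a, W a ∈ B.fullSet (n + 1)) (hWu : IsUnit (minor W w))
    (hr : ∀ Z : Fin (r + 1) → Derivation ℝ (O (B.pt (n + 1))) (O (B.pt (n + 1))),
      (∀ a, Z a ∈ B.fullSet (n + 1)) → ∀ v, minor Z v = 0)
    {a : O (B.pt n)} (ha : B.IsInvariant n a) :
    B.X (n + 1) 1 ((B.shift n).symm a) = 0 := by
  have hX : ∀ h : O (B.pt n), (∀ j ≥ 1, B.X n j h = 0) →
      ∀ j ≥ 2, B.X (n + 1) j ((B.shift n).symm h) = 0 := fun h hh j hj => by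
    obtain ⟨i, rfl⟩ : ∃ i, j = i + 1 := ⟨j - 1, by omega⟩
    rw [← conjD_X _ _ (by omega), conjD_symm, hh _ (by omega), map_zero]
  have hYh : ∀ h : O (B.pt n), partialD (t 1) h = 0 →
      B.Y (n + 1) 1 ((B.shift n).symm h) = 0 := fun h hh => by
    rw [← conjD_partialD_t_one, conjD_symm, hh, map_zero]
  obtain ⟨c, hc⟩ : ∃ c : Fin r → Fin r → O (B.pt (n + 1)), ∃ β : Fin r → O (B.pt (n + 1)),
      ∀ i, ∀ h : O (B.pt (n + 1)), (∀ j ≥ 2, B.X (n + 1) j h = 0) → conjD (B.shift n) (Z i) h =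
        ∑ j, c i j * W j h + β i * B.X (n + 1) 1 h := by
    choose c β h using fun i => exists_fullSet_expansion hW hWu hr (B.conjD_mem_fullSet (hZ i))
    exact ⟨c, β, h⟩
  obtain ⟨β, hc⟩ := hc
  obtain ⟨c', β', hc'⟩ := exists_fullSet_expansion hW hWu hr (B.Y_mem_fullSet (n + 1) le_rfl)
  -- Rows: the conjugated frame and `Y_1`. Columns: the frame `W` and `X_1`.
  let M : Matrix (Fin r ⊕ Unit) (Fin r ⊕ Unit) (O (B.pt (n + 1))) :=
    Matrix.fromBlocks (Matrix.of c) (Matrix.of fun i _ => β i) (Matrix.of fun _ => c')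
      (Matrix.of fun _ _ => β')
  let G : O (B.pt (n + 1)) → Fin r ⊕ Unit → O (B.pt (n + 1)) := fun h =>
    Sum.elim (fun j => W j h) fun _ => B.X (n + 1) 1 h
  have hMG : ∀ h : O (B.pt (n + 1)), (∀ j ≥ 2, B.X (n + 1) j h = 0) → M.mulVec (G h) =
      Sum.elim (fun i => conjD (B.shift n) (Z i) h) fun _ => B.Y (n + 1) 1 h := fun h hh => by
    funext i
    rcases i with i | i
    · simp only [Matrix.mulVec, dotProduct, Fintype.sum_sum_type, Sum.elim_inl, M, G,
        Matrix.fromBlocks_apply₁₁, Matrix.fromBlocks_apply₁₂, Matrix.of_apply, Sum.elim_inr]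
      rw [hc i h hh]
      simp
    · simp only [Matrix.mulVec, dotProduct, Fintype.sum_sum_type, Sum.elim_inl, M, G,
        Matrix.fromBlocks_apply₂₁, Matrix.fromBlocks_apply₂₂, Matrix.of_apply, Sum.elim_inr]
      rw [hc' h hh]
      simp
  -- Test functions: `D^{-1}` of the coordinates of the unit minor at the site `n`, and `t = D^{-1}
  -- t_1`. On them the rows of `M` take block diagonal values, the blocks being the transported
  -- minor matrix and `1`.
  let h : Fin r ⊕ Unit → O (B.pt (n + 1)) :=
    Sum.elim (fun j => (B.shift n).symm (coord _ (jetVar (v j)))) fun _ => coord _ (t 0)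
  have hh : ∀ i, ∀ j ≥ 2, B.X (n + 1) j (h i) = 0 := by
    rintro (i | i) j hj
    · exact hX _ (fun j hj => partialD_t_coord_jetVar (by omega) _) j hj
    · change B.X (n + 1) j (coord _ (t 0)) = 0
      rw [X_t, if_neg (by omega)]
  let Q : Matrix (Fin r) (Fin r) (O (B.pt n)) := Matrix.of fun a b => Z a (coord _ (jetVar (v b)))
  have hQ : M * Matrix.of (fun i j => G (h j) i) =
      Matrix.fromBlocks (Q.map (B.shift n).symm) 0 0 1 := by
    refine Matrix.ext fun i j => ?_
    refine (congrFun (hMG (h j) (hh j)) i).trans ?_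
    rcases i with i | i <;> rcases j with j | j
    · exact conjD_symm _ _ _
    · change (B.shift n).symm (Z i (coord _ (t (0 + 1)))) = 0
      rw [(B.mem_vanishingFields_of_mem_fullSet (hZ i)).2.2 _ (by simp), map_zero]
    · exact hYh _ (partialD_t_coord_jetVar one_ne_zero _)
    · change B.Y (n + 1) 1 (coord _ (t 0)) = _
      rw [Y_t, if_pos ⟨rfl, rfl⟩]
      simp
  have hQu : IsUnit (M * Matrix.of (fun i j => G (h j) i)).det := by
    rw [hQ, Matrix.det_fromBlocks_zero₁₂, Matrix.det_one, mul_one]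
    have h2 := hZu.map (B.shift n).symm
    rw [minor, AlgEquiv.map_det] at h2
    exact h2
  have hb : M.mulVec (G ((B.shift n).symm a)) = 0 := by
    rw [hMG _ (hX a ha.X_eq_zero)]
    funext i
    rcases i with i | i
    · change conjD (B.shift n) (Z i) ((B.shift n).symm a) = 0
      rw [conjD_symm, ha.fullSet_eq_zero (hZ i), map_zero]
    · exact hYh a (ha.partialD_eq_zero 1 one_pos)
  exact congrFun (Matrix.eq_zero_of_mulVec_eq_zero_of_isUnit_det_mul hQu hb) (Sum.inr ())

/-- All the conditions are conjugates of known ones except the one for `X_1`. The condition for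
`Y_2` rests on it as well, because only `Y_2 + X_1` is a conjugate. -/
theorem IsInvariant.shift_symm {n : ℤ} {r : ℕ}
    {Z : Fin r → Derivation ℝ (O (B.pt n)) (O (B.pt n))} {v : Fin r → ℕ}
    (hZ : ∀ a, Z a ∈ B.fullSet n) (hZu : IsUnit (minor Z v))
    {W : Fin r → Derivation ℝ (O (B.pt (n + 1))) (O (B.pt (n + 1)))} {w : Fin r → ℕ}
    (hW : ∀ a, W a ∈ B.fullSet (n + 1)) (hWu : IsUnit (minor W w))
    (hr : ∀ Z : Fin (r + 1) → Derivation ℝ (O (B.pt (n + 1))) (O (B.pt (n + 1))),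
      (∀ a, Z a ∈ B.fullSet (n + 1)) → ∀ v, minor Z v = 0)
    {a : O (B.pt n)} (ha : B.IsInvariant n a) :
    B.IsInvariant (n + 1) ((B.shift n).symm a) := by
  have hX1 := ha.X_one_shift_symm hZ hZu hW hWu hr
  refine ⟨fun j hj => ?_, fun j hj => ?_, fun k hk => ?_⟩
  · rcases Nat.eq_or_lt_of_le hj with rfl | hj
    · rw [← conjD_partialD_t_one, conjD_symm, ha.partialD_eq_zero 1 one_pos, map_zero]
    · rcases Nat.eq_or_lt_of_le hj with rfl | hj
      · have h1 := conjD_symm n (B.Y n 1) a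
        rw [conjD_Y_one, ha.Y_eq_zero 1 le_rfl, map_zero, Derivation.add_apply, hX1] at h1
        exact (add_zero _).symm.trans h1
      · obtain ⟨i, rfl⟩ : ∃ i, j = i + 1 := ⟨j - 1, by omega⟩
        rw [← conjD_Y _ _ (by omega), conjD_symm, ha.Y_eq_zero _ (by omega), map_zero]
  · rcases Nat.eq_or_lt_of_le hj with rfl | hj
    · exact hX1
    · obtain ⟨i, rfl⟩ : ∃ i, j = i + 1 := ⟨j - 1, by omega⟩
      rw [← conjD_X _ _ (by omega), conjD_symm, ha.X_eq_zero _ (by omega), map_zero]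
  · obtain ⟨l, rfl⟩ : ∃ l, k = l - 1 := ⟨k + 1, by omega⟩
    rw [← B.conjD_partialD_t n (k := l) (by omega) (by omega), conjD_symm,
      ha.partialD_eq_zero _ (by omega), map_zero]

end Chain.Background


/-! ### Normalized frames and common first integrals. -/

section Frames

variable {p : Phase}

theorem sum_smul_apply {ι : Type} [Fintype ι] (c : ι → O p) (W : ι → Derivation ℝ (O p) (O p))
    (h : O p) : (∑ j, c j • W j) h = ∑ j, c j * W j h := by
  rw [← Derivation.coeFnAddMonoidHom_apply, map_sum, Finset.sum_apply]
  rfl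

/-- The components at the columns `v` determine the coefficients with respect to the frame, the
block being invertible. For brackets this replaces any computation of structure functions. -/
theorem jets_eq_zero_of_mem_span {L : Set (Derivation ℝ (O p) (O p))} {r : ℕ}
    {W : Fin r → Derivation ℝ (O p) (O p)} {v : Fin r → ℕ} (hW : ∀ a, W a ∈ L)
    (hu : IsUnit (minor W v))
    (hr : ∀ Z : Fin (r + 1) → Derivation ℝ (O p) (O p), (∀ a, Z a ∈ L) → ∀ v, minor Z v = 0)
    {F : Derivation ℝ (O p) (O p)} (hF : F ∈ Submodule.span (O p) L)
    (h0 : ∀ b, F (coord p (jetVar (v b))) = 0) : jets p F = 0 := by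
  have h1 : Submodule.span (O p) L ≤
      (Submodule.span (O p) (Set.range fun a => jets p (W a))).comap (jets p) :=
    Submodule.span_le.2 fun Z hZ => jets_mem_span_of_minors_eq_zero hW hu hr hZ
  have h2 : jets p F ∈ Submodule.span (O p) (Set.range fun a => jets p (W a)) := h1 hF
  rw [Submodule.mem_span_range_iff_exists_fun] at h2
  obtain ⟨c, hc⟩ := h2
  have h3 : Matrix.vecMul c (Matrix.of fun a b => W a (coord p (jetVar (v b)))) = 0 := by
    funext b
    have := congrFun hc (v b)
    rw [jets_apply, h0, Finset.sum_apply] at this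
    exact this
  have h4 : c = 0 := by
    have h := congrArg (fun e => Matrix.vecMul e
      (Matrix.of fun a b => W a (coord p (jetVar (v b))))⁻¹) h3
    simpa [Matrix.vecMul_vecMul, Matrix.mul_nonsing_inv _ hu] using h
  rw [← hc, h4]
  simp

/-- The frame is multiplied by the inverse of its block. The last clause is what makes the new
coefficients independent of a variable whenever the old data are: differentiate `M (Z h) = W h` and
cancel `M`. -/
theorem exists_normal_frame {L : Set (Derivation ℝ (O p) (O p))} {r : ℕ}
    {W : Fin r → Derivation ℝ (O p) (O p)} {v : Fin r → ℕ} (hW : ∀ a, W a ∈ L)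
    (hu : IsUnit (minor W v)) :
    ∃ Z : Fin r → Derivation ℝ (O p) (O p), (∀ a, Z a ∈ Submodule.span (O p) L) ∧
      (∀ a b, Z a (coord p (jetVar (v b))) = if a = b then 1 else 0) ∧
      ∀ (δ : Derivation ℝ (O p) (O p)) (h : O p),
        (∀ a b, δ (W a (coord p (jetVar (v b)))) = 0) → (∀ a, δ (W a h) = 0) →
          ∀ a, δ (Z a h) = 0 := by
  set M : Matrix (Fin r) (Fin r) (O p) := Matrix.of fun a b => W a (coord p (jetVar (v b))) with hM
  have hu' : IsUnit M.det := hu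
  refine ⟨fun a => ∑ b, M⁻¹ a b • W b, fun a => Submodule.sum_mem _ fun b _ =>
    Submodule.smul_mem _ _ (Submodule.subset_span (hW b)), fun a b => ?_, fun δ h h1 h2 => ?_⟩
  · rw [sum_smul_apply]
    have := congrFun (congrFun (Matrix.nonsing_inv_mul M hu') a) b
    rw [Matrix.mul_apply, Matrix.one_apply] at this
    exact this
  · have h3 : M.mulVec (M⁻¹.mulVec fun b => W b h) = fun b => W b h := by
      rw [Matrix.mulVec_mulVec, Matrix.mul_nonsing_inv M hu', Matrix.one_mulVec]
    have h4 : M.mulVec (fun a => δ (M⁻¹.mulVec (fun b => W b h) a)) = 0 := by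
      funext a
      have h5 := congrArg δ (congrFun h3 a)
      rw [h2, Matrix.mulVec, dotProduct, map_sum] at h5
      refine Eq.trans ?_ h5
      rw [Matrix.mulVec, dotProduct]
      refine Finset.sum_congr rfl fun b _ => ?_
      rw [Derivation.leibniz, show δ (M a b) = 0 from h1 a b, smul_zero, add_zero, smul_eq_mul]
    have h6 : IsUnit (M * 1).det := by rwa [mul_one]
    intro a
    rw [sum_smul_apply]
    exact congrFun (Matrix.eq_zero_of_mulVec_eq_zero_of_isUnit_det_mul h6 h4) a

theorem coord_jetVar_mem_orderLT (w : ℕ) {m : ℕ} (h : w ≤ m) :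
    coord p (jetVar w) ∈ orderLT p m := fun l hl => by
  rw [partialD_coord, if_neg]
  match w with
  | 0 => simp [jetVar]
  | w + 1 =>
    simp only [jetVar, d.injEq]
    omega

theorem jetVar_injective : Function.Injective jetVar := by
  rintro (_ | i) (_ | j) h <;> simp_all [jetVar]

set_option maxHeartbeats 1000000 in
/-- A nontrivial common first integral of a finite-dimensional Lie algebra of vector fields. -/
theorem exists_common_firstIntegral {L : LieSubalgebra ℝ (Derivation ℝ (O p) (O p))}
    (hL : L ≤ adapted p (Set.Ioi 0)) (hX : ∀ k < (0 : ℤ), partialD (t k) ∈ L) {r : ℕ}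
    {W : Fin r → Derivation ℝ (O p) (O p)} {v : Fin r → ℕ} (hW : ∀ a, W a ∈ L)
    (hu : IsUnit (minor W v))
    (hr : ∀ Z : Fin (r + 1) → Derivation ℝ (O p) (O p), (∀ a, Z a ∈ L) → ∀ v, minor Z v = 0) :
    ∃ I : O p, (∀ F ∈ L, F I = 0) ∧ (∀ k ≠ 0, partialD (t k) I = 0) ∧
      ∃ w, partialD (jetVar w) I ≠ 0 := by
  classical
  obtain ⟨Z, hZ, hZv, hZd⟩ := exists_normal_frame (L := (L : Set (Derivation ℝ (O p) (O p)))) hW hu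
  have hLie : ∀ {F G}, F ∈ Submodule.span (O p) (L : Set (Derivation ℝ (O p) (O p))) →
      G ∈ Submodule.span (O p) (L : Set (Derivation ℝ (O p) (O p))) →
      ⁅F, G⁆ ∈ Submodule.span (O p) (L : Set (Derivation ℝ (O p) (O p))) :=
    fun hF hG => (spanLie L).lie_mem hF hG
  have hLie0 : ∀ {F G}, F ∈ Submodule.span (O p) (L : Set (Derivation ℝ (O p) (O p))) →
      G ∈ Submodule.span (O p) (L : Set (Derivation ℝ (O p) (O p))) →
      (∀ b, F (G (coord p (jetVar (v b)))) = G (F (coord p (jetVar (v b))))) →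
      ∀ w, F (G (coord p (jetVar w))) = G (F (coord p (jetVar w))) := fun hF hG h w => by
    have h1 := congrFun (jets_eq_zero_of_mem_span hW hu hr (hLie hF hG) fun b => by
      rw [Derivation.commutator_apply, h b, sub_self]) w
    rw [jets_apply, Derivation.commutator_apply] at h1
    exact sub_eq_zero.1 h1
  have hV : ∀ F ∈ Submodule.span (O p) (L : Set (Derivation ℝ (O p) (O p))),
      F ∈ vanishingFields p (Set.Ioi 0) := by
    intro F hF
    have h1 : Submodule.span (O p) (L : Set (Derivation ℝ (O p) (O p))) ≤
        vanishingFields p (Set.Ioi 0) := Submodule.span_le.2 fun F hF => (hL hF).1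
    exact h1 hF
  -- The bracket lies in the span and kills the columns `v`, on which the `Z a` have constant
  -- components; so the normalized fields commute on all jet coordinates.
  have hZZ : ∀ a b w, Z a (Z b (coord p (jetVar w))) = Z b (Z a (coord p (jetVar w))) :=
    fun a b => hLie0 (hZ a) (hZ b) fun c => by
      rw [hZv, hZv]
      split_ifs <;> simp
  -- For `k < 0` the field `∂/∂t_k` belongs to `L`, and the same bracket argument applies. For `k >
  -- 0` it commutes with all of `L`.
  have htk : ∀ k : ℤ, k ≠ 0 → ∀ a w, partialD (t k) (Z a (coord p (jetVar w))) = 0 := by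
    intro k hk a w
    rcases lt_or_gt_of_ne hk with hk' | hk'
    · rw [hLie0 (Submodule.subset_span (hX k hk')) (hZ a) (fun c => ?_),
        partialD_t_coord_jetVar hk, map_zero]
      rw [hZv, partialD_t_coord_jetVar hk, map_zero]
      split_ifs <;> simp
    · have h1 : ∀ b w, partialD (t k) (W b (coord p (jetVar w))) = 0 := fun b w => by
        rw [(hL (hW b)).2.1 k hk', partialD_t_coord_jetVar hk, map_zero]
      exact hZd _ _ (fun a b => h1 a _) (fun a => h1 a _) a
  -- Large enough for all columns `v`; moreover the `m + 1` jet variables of index at most `m`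
  -- outnumber the `r` columns, which leaves a free variable `w₀`.
  let m : ℕ := (Finset.univ.sup v) + r
  have hvm : ∀ a, v a ≤ m := fun a =>
    (Finset.le_sup (Finset.mem_univ a)).trans (Nat.le_add_right _ _)
  have hdl : ∀ l ≥ m, ∀ a, ∀ w ≤ m, partialD (d l) (Z a (coord p (jetVar w))) = 0 := by
    intro l hl a w hw
    have h1 : ∀ b, ∀ w ≤ m, partialD (d l) (W b (coord p (jetVar w))) = 0 := fun b w hw =>
      (hL (hW b)).2.2 m _ (coord_jetVar_mem_orderLT w hw) l hl
    exact hZd _ _ (fun a b => h1 a _ (hvm b)) (fun a => h1 a _ hw) a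
  -- Fields of `L` do not raise the order, so the coefficients of the normalized frame at these
  -- variables depend on these variables only: Frobenius' theorem applies in finite dimension.
  let s : Finset Var := insert x ((Finset.range (m + 1)).image jetVar)
  have hms : ∀ w ≤ m, jetVar w ∈ s := fun w hw => Finset.mem_insert_of_mem
    (Finset.mem_image_of_mem _ (Finset.mem_range.2 (by omega)))
  have hsc : ∀ l ∈ s, l = x ∨ ∃ w ≤ m, l = jetVar w := fun l hl => by
    rcases Finset.mem_insert.1 hl with rfl | h
    · exact Or.inl rfl
    · obtain ⟨w, hw, rfl⟩ := Finset.mem_image.1 h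
      exact Or.inr ⟨w, by simpa [Nat.lt_succ_iff] using hw, rfl⟩
  have hus : ∀ u ∉ s, (∃ k ≠ 0, u = t k) ∨ ∃ l ≥ m, u = d l := by
    intro u hu
    match u with
    | x => exact absurd (Finset.mem_insert_self _ _) hu
    | t k => exact Or.inl ⟨k, fun h => hu (h ▸ hms 0 (Nat.zero_le _)), rfl⟩
    | d l => exact Or.inr ⟨l, by
        by_contra h
        exact hu (hms (l + 1) (by omega)), rfl⟩
  have hZx : ∀ a, Z a (coord p x) = 0 := fun a => (hV _ (hZ a)).2.1
  have hc : ∀ (a : Fin r) (l : s), ∀ u ∉ s, partialD u (Z a (coord p (l : Var))) = 0 := by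
    rintro a ⟨l, hl⟩ u hu
    rcases hsc l hl with rfl | ⟨w, hw, rfl⟩
    · change partialD u (Z a (coord p x)) = 0
      rw [hZx, map_zero]
    · rcases hus u hu with ⟨k, hk, rfl⟩ | ⟨l, hl, rfl⟩
      · exact htk k hk a w
      · exact hdl l hl a w hw
  have happ : ∀ a (h : O p), (∀ u ∉ s, partialD u h = 0) →
      Z a h = ∑ l : s, Z a (coord p (l : Var)) * partialD (l : Var) h := fun a h hh => by
    rw [fields_apply_eq_sum (hV _ (hZ a)).1 s fun u hu => by rw [hh u hu, mul_zero]]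
    exact (Finset.sum_coe_sort s fun l => Z a (coord p l) * partialD l h).symm
  obtain ⟨w₀, hw₀m, hw₀⟩ : ∃ w₀ ≤ m, ∀ a, v a ≠ w₀ := by
    by_contra! hcon
    have h1 : Finset.range (m + 1) ⊆ Finset.univ.image v := fun w hw => by
      obtain ⟨a, ha⟩ := hcon w (by simpa [Nat.lt_succ_iff] using hw)
      exact Finset.mem_image.2 ⟨a, Finset.mem_univ _, ha⟩
    have h2 := (Finset.card_le_card h1).trans Finset.card_image_le
    rw [Finset.card_range, Finset.card_univ, Fintype.card_fin] at h2
    omega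
  obtain ⟨I, hI1, hI2, hI3⟩ := exists_germ_firstIntegral (s := s)
    (fun a => ⟨jetVar (v a), hms _ (hvm a)⟩) (fun a l => Z a (coord p (l : Var))) hc
    (fun a b => hZv a b)
    (fun a b l => by
      obtain ⟨l, hl⟩ := l
      rw [← happ a _ (hc b ⟨l, hl⟩), ← happ b _ (hc a ⟨l, hl⟩)]
      rcases hsc l hl with rfl | ⟨w, -, rfl⟩
      · change Z a (Z b (coord p x)) = Z b (Z a (coord p x))
        rw [hZx, hZx, map_zero, map_zero]
      · exact hZZ a b w)
    ⟨jetVar w₀, hms _ hw₀m⟩ (fun a h => hw₀ a (jetVar_injective (congrArg Subtype.val h)))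
  have hZI : ∀ a, Z a I = 0 := fun a => (happ a I hI1).trans (hI2 a)
  have hIt : ∀ k ≠ 0, partialD (t k) I = 0 := fun k hk => hI1 _ fun h => by
    rcases hsc _ h with h | ⟨w, -, h⟩
    · exact absurd h (by simp)
    · match w with
      | 0 => exact hk (by simpa [jetVar] using h)
      | w + 1 => exact absurd h (by simp [jetVar])
  refine ⟨I, fun F hF => ?_, hIt, w₀, hI3⟩
  -- After subtraction of its part along the frame, `F` has no jets, and `I` does not depend on any
  -- `t_k` with `k ≠ 0`.
  set F' := F + (-1 : O p) • ∑ a, F (coord p (jetVar (v a))) • Z a with hF'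
  have happ' : ∀ h, F' h = F h - ∑ a, F (coord p (jetVar (v a))) * Z a h := fun h => by
    rw [hF', Derivation.add_apply, Derivation.smul_apply, sum_smul_apply, smul_eq_mul]
    ring
  have hF'm : F' ∈ Submodule.span (O p) (L : Set (Derivation ℝ (O p) (O p))) :=
    Submodule.add_mem _ (Submodule.subset_span hF) (Submodule.smul_mem _ _
      (Submodule.sum_mem _ fun a _ => Submodule.smul_mem _ _ (hZ a)))
  have hjet := jets_eq_zero_of_mem_span hW hu hr hF'm fun b => by
    rw [happ']
    simp only [hZv, mul_ite, mul_one, mul_zero, Finset.sum_ite_eq', Finset.mem_univ, if_true,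
      sub_self]
  have h0 : F' I = 0 := fields_apply_eq_zero (hV _ hF'm).1 fun u => by
    match u with
    | x => rw [(hV _ hF'm).2.1, zero_mul]
    | d i => rw [show F' (coord _ (d i)) = 0 from congrFun hjet (i + 1), zero_mul]
    | t k =>
      rcases eq_or_ne k 0 with rfl | hk
      · rw [show F' (coord _ (t 0)) = 0 from congrFun hjet 0, zero_mul]
      · rw [hIt k hk, mul_zero]
  rw [happ'] at h0
  simpa [hZI] using h0

end Frames


/-! ### Sufficiency: from one site to all sites. -/

namespace Chain.Background

variable {C : Chain} {B : C.Background}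

/-- The value at the site `n` is the transport of `a` by `D^{-n}`; it is obtained by applying
`D^{-n}` to the function equal to `a` at the site `0` and zero elsewhere. -/
theorem exists_Fun_shift_eq (a : O (B.pt 0)) :
    ∃ I : B.Fun, I 0 = a ∧ ∀ n, B.shift n (I (n + 1)) = I n := by
  let h : B.Fun := Function.update 0 0 a
  refine ⟨fun n => (B.D ^ (-n)) h n, ?_, fun n => ?_⟩
  · change Function.update (0 : B.Fun) 0 a 0 = a
    rw [Function.update_self]
  · rw [← D_apply]
    change (B.D * B.D ^ (-(n + 1))) h n = _
    rw [← zpow_one_add, show 1 + -(n + 1) = -n by ring]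

/-- Induction in both directions of the lattice; only the step to the right needs the equality of
ranks. -/
theorem isInvariant_of_shift_eq {r : ℕ}
    (hr : ∀ n, ∃ (Z : Fin r → Derivation ℝ (O (B.pt n)) (O (B.pt n))) (v : Fin r → ℕ),
      (∀ a, Z a ∈ B.fullSet n) ∧ IsUnit (minor Z v))
    (hr' : ∀ n, ∀ Z : Fin (r + 1) → Derivation ℝ (O (B.pt n)) (O (B.pt n)),
      (∀ a, Z a ∈ B.fullSet n) → ∀ v, minor Z v = 0)
    {I : B.Fun} (hI : ∀ n, B.shift n (I (n + 1)) = I n) (h0 : B.IsInvariant 0 (I 0)) (n : ℤ) :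
    B.IsInvariant n (I n) := by
  have hd : ∀ m, B.IsInvariant (m + 1) (I (m + 1)) → B.IsInvariant m (I m) := fun m h =>
    hI m ▸ h.shift
  have hu : ∀ m, B.IsInvariant m (I m) → B.IsInvariant (m + 1) (I (m + 1)) := fun m h => by
    obtain ⟨Z, v, hZ, hZu⟩ := hr m
    obtain ⟨W, w, hW, hWu⟩ := hr (m + 1)
    have := h.shift_symm hZ hZu hW hWu (hr' (m + 1))
    rwa [← hI m, AlgEquiv.symm_apply_apply] at this
  let P : ℤ → Prop := fun m => B.IsInvariant m (I m)
  change P n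
  induction n using Int.induction_on with
  | zero => exact h0
  | succ i h => exact hu i h
  | pred i h => exact hd (-i - 1) (by change P _; rwa [sub_add_cancel])

theorem IsInvariant.mem_smoothGerms {n : ℤ} {a : O (B.pt n)} (ha : B.IsInvariant n a) :
    (a : Germ (𝓝 (B.pt n)) ℝ) ∈ smoothGerms ({x, t 0} ∪ Set.range d) (B.pt n) := by
  refine mem_smoothGerms_iff.2 fun v hv => ?_
  match v with
  | x => exact absurd (Or.inl (Or.inl rfl)) hv
  | d i => exact absurd (Or.inr ⟨i, rfl⟩) hv
  | t k =>
    rcases lt_trichotomy k 0 with hk | rfl | hk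
    · have := ha.X_eq_zero k.natAbs (by omega)
      rwa [X, show -(k.natAbs : ℤ) = k by omega] at this
    · exact absurd (Or.inl (Or.inr rfl)) hv
    · exact ha.partialD_eq_zero k hk

theorem exists_nontrivial_nIntegral (hB : B.IsGeneric) {N : ℕ}
    (h1 : ∀ n : ℤ, Module.Finite (O (B.pt n)) (B.Yspan n) ∧
      Module.finrank (O (B.pt n)) (B.Yspan n) = N)
    (h2 : ∀ n : ℤ, Module.Finite (O (B.pt n)) (B.charAlgebra N n)) :
    ∃ I : B.Fun, B.IsNIntegral I ∧ ¬ B.IsTrivial I := by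
  obtain ⟨K, hK⟩ := not_isUnit_minor_of_finite_Yspan B (h1 0).1
  obtain ⟨N', hN', hY⟩ := exists_Yspan_basis B hB.1 hK
  -- The given dimension coincides with the number found from minors, so the first `N` of the `Y_j`
  -- do span the envelope.
  obtain rfl : N = N' := (h1 0).2.symm.trans (hN' 0).2
  obtain ⟨s, g, hg⟩ := Submodule.fg_iff_exists_fin_generating_family.1
    (Module.Finite.iff_fg.1 (h2 0))
  have hs : ∀ Z : Fin (s + 1) → Derivation ℝ (O (B.pt 0)) (O (B.pt 0)),
      (∀ a, Z a ∈ B.fullSet 0) → ∀ v, ¬ IsUnit (minor Z v) := by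
    intro Z hZ v hv
    have := le_of_jets_mem_span (g := fun b => jets _ (g b)) hv fun a => by
      obtain ⟨Z', hZ', h⟩ := B.exists_charAlgebra_jets_eq (hY 0) (hZ a)
      rw [h]
      rw [← hg] at hZ'
      have h3 := Submodule.mem_map_of_mem (f := jets (B.pt 0)) hZ'
      rwa [Submodule.map_span, ← Set.range_comp] at h3
    omega
  obtain ⟨r, -, hr, hr'⟩ := ConstantRank.exists_rank
    (show B.ConstantRank fun n => B.fullSet n from hB.2) hs
  obtain ⟨W, v, hW, hWu⟩ := hr 0
  obtain ⟨a, ha, hat, w, hw⟩ := exists_common_firstIntegral (L := B.fullLie 0)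
    (B.fullLie_le_adapted 0) (fun k hk => by
      have := B.X_mem_fullLie 0 (j := k.natAbs) (by omega)
      rwa [X, show -(k.natAbs : ℤ) = k by omega] at this) hW hWu (hr' 0)
  obtain ⟨I, rfl, hI⟩ := exists_Fun_shift_eq a
  have hinv := isInvariant_of_shift_eq hr hr' hI
    ⟨fun j hj => ha _ (B.Y_mem_fullLie 0 hj), fun j hj => ha _ (B.X_mem_fullLie 0 hj),
      fun k hk => hat k hk.ne'⟩
  refine ⟨I, ⟨fun n => (hinv n).mem_smoothGerms, funext fun n => hI n⟩, fun htriv => hw ?_⟩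
  refine mem_smoothGerms_iff.1 (htriv 0) _ ?_
  match w with
  | 0 => simp [jetVar]
  | w + 1 => simp [jetVar]

end Chain.Background

end SemiDiscrete

/-! ### Necessity: the total derivative bounds the rank. -/

theorem Matrix.det_eq_zero_of_rows_mem_span {R : Type} [CommRing R] {m : ℕ}
    {A : Matrix (Fin (m + 1)) (Fin (m + 1)) R} {g : Fin m → Fin (m + 1) → R}
    (h : ∀ a, A a ∈ Submodule.span R (Set.range g)) : A.det = 0 := by
  simp only [Submodule.mem_span_range_iff_exists_fun] at h
  choose c hc using h
  -- The combination of `m` rows is padded with a zero row to a product of square matrices.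
  have hA : A = Matrix.of (fun a => Fin.cons 0 (c a) : Fin (m + 1) → Fin (m + 1) → R) *
      Matrix.of (Fin.cons 0 g : Fin (m + 1) → Fin (m + 1) → R) := by
    ext a b
    rw [← hc, Matrix.mul_apply, Fin.sum_univ_succ]
    simp [Finset.sum_apply]
  rw [hA, Matrix.det_mul, Matrix.det_eq_zero_of_row_eq_zero (A := Matrix.of (Fin.cons 0 g)) 0
    (fun b => by simp), mul_zero]

/-- Strong induction: each reduction to lower indices costs powers of `c`, and the sum of the
exponents below `w` suffices for all of them at once. Division by `c` is avoided because `c` need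
not be a unit. -/
theorem exists_pow_smul_mem_span {R M : Type} [CommRing R] [AddCommGroup M] [Module R M] (c : R)
    (f : ℕ → M) (m : ℕ) (h : ∀ w ≥ m, c • f w ∈ Submodule.span R (f '' Set.Iio w)) (w : ℕ) :
    ∃ e : ℕ, c ^ e • f w ∈ Submodule.span R (Set.range fun b : Fin m => f b) := by
  induction w using Nat.strong_induction_on with
  | _ w ih =>
    rcases Nat.lt_or_ge w m with hw | hw
    · exact ⟨0, by rw [pow_zero, one_smul]; exact Submodule.subset_span ⟨⟨w, hw⟩, rfl⟩⟩
    · choose! e he using ih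
      set S := Submodule.span R (Set.range fun b : Fin m => f b)
      let E := ∑ u ∈ Finset.range w, e u
      have h1 : Submodule.span R (f '' Set.Iio w) ≤ S.comap (c ^ E • LinearMap.id) := by
        refine Submodule.span_le.2 ?_
        rintro _ ⟨u, hu, rfl⟩
        change c ^ E • f u ∈ S
        have h2 : e u ≤ E := Finset.single_le_sum (f := e) (fun _ _ => Nat.zero_le _)
          (Finset.mem_range.2 hu)
        rw [← Nat.sub_add_cancel h2, pow_add, mul_smul]
        exact S.smul_mem _ (he u hu)
      refine ⟨E + 1, ?_⟩
      rw [pow_succ, mul_smul]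
      exact h1 (h w hw)

namespace SemiDiscrete

open Chain.Background Chain Var

section TopOrder

variable {p : Phase}

/-- The total derivative with respect to `x` on functions of `x, t, t_x, t_xx, …`. -/
noncomputable def totalD (p : Phase) : Derivation ℝ (O p) (O p) :=
  vectorField fun v => match v with
    | x => 1
    | t k => if k = 0 then coord p (d 0) else 0
    | d i => coord p (d (i + 1))

theorem totalD_x : totalD p (coord p x) = 1 := by rw [totalD, vectorField_coord]

theorem totalD_t (k : ℤ) : totalD p (coord p (t k)) = if k = 0 then coord p (d 0) else 0 := by
  rw [totalD, vectorField_coord]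

theorem totalD_d (i : ℕ) : totalD p (coord p (d i)) = coord p (d (i + 1)) := by
  rw [totalD, vectorField_coord]

theorem totalD_mem_fields : totalD p ∈ fields p := vectorField_mem_fields _

/-- Partial derivatives of coordinates are constants, so the bracket of `∂/∂v` with `Z` is read off
from the differentiated coefficients of `Z`. -/
theorem lie_partialD_apply {v : Var} {Z E : Derivation ℝ (O p) (O p)} (hZ : Z ∈ fields p)
    (hE : E ∈ fields p) (h : ∀ w, partialD v (Z (coord p w)) = E (coord p w)) (a : O p) :
    partialD v (Z a) = Z (partialD v a) + E a := by
  have h1 : ⁅partialD v, Z⁆ = E := fields_ext (fields_lie_mem (partialD_mem_fields v) hZ) hE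
    fun w => by
      rw [Derivation.commutator_apply, h, partialD_coord]
      split_ifs <;> simp
  have h2 := congrArg (fun F => F a) h1
  rw [Derivation.commutator_apply, sub_eq_iff_eq_add] at h2
  rw [h2, add_comm]

theorem partialD_t_totalD (k : ℤ) (a : O p) :
    partialD (t k) (totalD p a) = totalD p (partialD (t k) a) := by
  rw [lie_partialD_apply totalD_mem_fields (fields p).zero_mem (fun w => ?_) a,
    Derivation.zero_apply, add_zero]
  match w with
  | x => rw [totalD_x, Derivation.map_one_eq_zero]; rfl
  | t l =>
    rw [totalD_t]
    split_ifs
    · rw [partialD_coord, if_neg (by simp)]; rfl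
    · rw [map_zero]; rfl
  | d i => rw [totalD_d, partialD_coord, if_neg (by simp)]; rfl

theorem partialD_jetVar_totalD (i : ℕ) (a : O p) :
    partialD (jetVar (i + 1)) (totalD p a) =
      totalD p (partialD (jetVar (i + 1)) a) + partialD (jetVar i) a := by
  refine lie_partialD_apply totalD_mem_fields (partialD_mem_fields _) (fun w => ?_) a
  change partialD (d i) _ = _
  match w with
  | x => rw [totalD_x, Derivation.map_one_eq_zero, partialD_coord, if_neg]; cases i <;> simp [jetVar]
  | t l =>
    rw [totalD_t, apply_ite (partialD (d i)), map_zero, partialD_coord, partialD_coord,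
      ← ite_and]
    refine if_congr ?_ rfl rfl
    rcases i with _ | i <;> simp [jetVar, eq_comm]
  | d l =>
    rw [totalD_d, partialD_coord, partialD_coord]
    refine if_congr ?_ rfl rfl
    rcases i with _ | i <;> simp [jetVar]

/-- The bracket of `∂/∂t_{[i+1]}` with `D_x` is `∂/∂t_{[i]}`. So each application of `D_x` raises
the order by one and keeps the leading coefficient. -/
theorem totalD_iterate_top {a : O p} {m : ℕ} (ha : ∀ w > m, partialD (jetVar w) a = 0) (k : ℕ) :
    partialD (jetVar (m + k)) ((totalD p)^[k] a) = partialD (jetVar m) a ∧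
      ∀ w > m + k, partialD (jetVar w) ((totalD p)^[k] a) = 0 := by
  induction k with
  | zero => exact ⟨rfl, ha⟩
  | succ k ih =>
    rw [Function.iterate_succ_apply']
    refine ⟨?_, fun w hw => ?_⟩
    · rw [← add_assoc, partialD_jetVar_totalD, ih.2 _ (by omega), map_zero, zero_add, ih.1]
    · obtain ⟨w, rfl⟩ : ∃ l, w = l + 1 := ⟨w - 1, by omega⟩
      rw [partialD_jetVar_totalD, ih.2 _ (by omega), ih.2 _ (by omega), map_zero, zero_add]

/-- If the vector fields in `A` annihilate all `D_x`-derivatives of a function `a` whose order is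
exactly `m`, then their rank is at most `m`. -/
theorem not_isUnit_minor_of_annihilate {A : Set (Derivation ℝ (O p) (O p))}
    (hA : ∀ Z ∈ A, Z ∈ fields p ∧ Z (coord p x) = 0) {a : O p} {m : ℕ}
    (hat : ∀ k : ℕ, ∀ l ≠ 0, partialD (t l) ((totalD p)^[k] a) = 0)
    (ham : ∀ w > m, partialD (jetVar w) a = 0) (ham' : partialD (jetVar m) a ≠ 0)
    (hAa : ∀ Z ∈ A, ∀ k : ℕ, Z ((totalD p)^[k] a) = 0)
    (Z : Fin (m + 1) → Derivation ℝ (O p) (O p)) (hZ : ∀ i, Z i ∈ A) (v : Fin (m + 1) → ℕ) :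
    ¬ IsUnit (minor Z v) := by
  set c := partialD (jetVar m) a with hc
  -- The columns of the coefficient matrix. Dependence is established among columns, which is why
  -- the transposed minor appears at the end.
  let f : ℕ → Fin (m + 1) → O p := fun w i => Z i (coord p (jetVar w))
  have hf : ∀ w ≥ m, c • f w ∈ Submodule.span (O p) (f '' Set.Iio w) := by
    intro w hw
    obtain ⟨k, rfl⟩ := Nat.exists_eq_add_of_le hw
    have h1 := totalD_iterate_top ham k
    have h2 : c • f (m + k) = -∑ u ∈ Finset.range (m + k),
        partialD (jetVar u) ((totalD p)^[k] a) • f u := by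
      funext i
      have h3 := hAa _ (hZ i) k
      rw [fields_apply_eq_sum (hA _ (hZ i)).1 ((Finset.range (m + k + 1)).image jetVar) ?_,
        Finset.sum_image (fun _ _ _ _ h => jetVar_injective h), Finset.sum_range_succ, h1.1] at h3
      · rw [Pi.smul_apply, smul_eq_mul, mul_comm, eq_neg_of_add_eq_zero_right h3, Pi.neg_apply,
          Finset.sum_apply]
        refine congrArg Neg.neg (Finset.sum_congr rfl fun u _ => ?_)
        rw [Pi.smul_apply, smul_eq_mul, mul_comm]
      · intro u hu
        match u with
        | x => rw [(hA _ (hZ i)).2, zero_mul]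
        | t l =>
          rw [hat k l (fun h => hu (by rw [h]; exact Finset.mem_image.2 ⟨0, by simp, rfl⟩)),
            mul_zero]
        | d l =>
          have h4 : m + k < l + 1 := by
            by_contra h
            exact hu (Finset.mem_image.2 ⟨l + 1, Finset.mem_range.2 (by omega), rfl⟩)
          rw [show partialD (d l) ((totalD p)^[k] a) = 0 from h1.2 (l + 1) h4, mul_zero]
    rw [h2]
    exact Submodule.neg_mem _ (Submodule.sum_mem _ fun u hu => Submodule.smul_mem _ _
      (Submodule.subset_span ⟨u, Finset.mem_range.1 hu, rfl⟩))
  choose e he using exists_pow_smul_mem_span c f m hf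
  intro hu
  -- After scaling by powers of `c`, the `m + 1` chosen columns lie in the span of the first `m`.
  -- The minor times a power of `c` is therefore zero.
  have h1 := Matrix.det_eq_zero_of_rows_mem_span
    (A := Matrix.of fun b => c ^ e (v b) • f (v b)) fun b => he (v b)
  have h2 : (Matrix.of fun b => c ^ e (v b) • f (v b)) = Matrix.of fun i j =>
      c ^ e (v i) * (Matrix.of fun a b => Z a (coord p (jetVar (v b)))).transpose i j := rfl
  rw [h2, Matrix.det_mul_column, Matrix.det_transpose] at h1
  rw [show (Matrix.of fun a b => Z a (coord p (jetVar (v b)))).det = minor Z v from rfl,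
    hu.mul_left_eq_zero, Finset.prod_pow_eq_pow_sum] at h1
  exact ham' (O.eq_zero_of_pow_eq_zero h1)

end TopOrder


theorem notMem_low {i : ℕ} {v : Var}
    (hv : v ∉ ({t 0, t 1} ∪ (Finset.range (i + 1)).image d : Finset Var)) :
    v ∉ Chain.low i := by
  rintro (rfl | rfl | ⟨l, hl, rfl⟩)
  · simp at hv
  · simp at hv
  · exact hv (Finset.mem_union_right _ (Finset.mem_image_of_mem _ (Finset.mem_range.2 (by omega))))

/-! ### Total derivatives of integrals and finiteness of `L_n`. -/

namespace Chain.Background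

variable {C : Chain} {B : C.Background}

variable (B) in
/-- The total derivative with respect to `x` on functions of `x, t, t_1, t_x, t_xx, …`. -/
noncomputable def totalD₁ (n : ℤ) : Derivation ℝ (O (B.pt n)) (O (B.pt n)) :=
  totalD (B.pt n) + B.shift n (coord _ (d 0)) • partialD (t 1)

theorem totalD₁_apply (n : ℤ) (a : O (B.pt n)) :
    B.totalD₁ n a = totalD _ a + B.shift n (coord _ (d 0)) * partialD (t 1) a := rfl

theorem totalD₁_mem_fields (n : ℤ) : B.totalD₁ n ∈ fields (B.pt n) :=
  (fields _).add_mem totalD_mem_fields ((fields _).smul_mem _ (partialD_mem_fields _))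

/-- The recursion defining `fJet` is exactly this total derivative: `t_1` is differentiated into
`f`, the component carried by `totalD₁`. -/
theorem totalD₁_shift_d (n : ℤ) (i : ℕ) : B.totalD₁ n (B.shift n (coord _ (d i))) =
    B.shift n (coord _ (d (i + 1))) := by
  rw [fields_apply_eq_sum (totalD₁_mem_fields n)
    ({t 0, t 1} ∪ (Finset.range (i + 1)).image d) fun v hv => by
      rw [B.partialD_fJet_eq_zero n (notMem_low hv), mul_zero],
    Finset.sum_union (by
      rw [Finset.disjoint_left]
      intro v hv hv'
      obtain ⟨l, -, rfl⟩ := Finset.mem_image.1 hv'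
      simp at hv),
    Finset.sum_pair (by simp), Finset.sum_image (fun _ _ _ _ h => d.inj h)]
  have ht0 : B.totalD₁ n (coord _ (t 0)) = coord _ (d 0) := by
    rw [totalD₁_apply, totalD_t, if_pos rfl, partialD_coord, if_neg (by simp), mul_zero, add_zero]
  have ht1 : B.totalD₁ n (coord _ (t 1)) = B.shift n (coord _ (d 0)) := by
    rw [totalD₁_apply, totalD_t, if_neg one_ne_zero, partialD_coord, if_pos rfl, mul_one, zero_add]
  have hd : ∀ l, B.totalD₁ n (coord _ (d l)) = coord _ (d (l + 1)) := fun l => by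
    rw [totalD₁_apply, totalD_d, partialD_coord, if_neg (by simp), mul_zero, add_zero]
  simp only [ht0, ht1, hd, shift_coord_d]
  have hsm := C.smooth_fJet i _ (B.pt_mem n)
  have hco : ∀ v, SmoothIn Set.univ (B.pt n) fun y => y v := fun v =>
    smoothIn_coord (Set.mem_univ v) _
  rw [show ∑ l ∈ Finset.range (i + 1), coord (B.pt n) (d (l + 1)) * partialD (d l) (mkO (C.fJet i) hsm)
    = mkO (fun y => ∑ l ∈ Finset.range (i + 1), y (d (l + 1)) * pd (d l) (C.fJet i) y)
      (SmoothIn.sum _ fun l _ => (hco _).mul (hsm.pd _)) from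
    mkO_sum _ _ fun l => (hco (d (l + 1))).mul (hsm.pd (d l))]
  rfl

/-- On functions of `x, t, t_x, …` the operator `totalD` is conjugate under `D` to `totalD₁`. The
extra term of the latter disappears because the shifted function does not contain `t_1`. -/
theorem shift_totalD {n : ℤ} {a : O (B.pt (n + 1))} (ha : ∀ k ≠ 0, partialD (t k) a = 0)
    (ha' : partialD (t 1) (B.shift n a) = 0) :
    B.shift n (totalD _ a) = totalD _ (B.shift n a) := by
  have h1 : totalD _ a = conjD (B.shift n) (B.totalD₁ n) a := by
    rw [fields_apply totalD_mem_fields,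
      fields_apply (B.conjD_shift_mem_fields (totalD₁_mem_fields n))]
    refine finsum_congr fun v => ?_
    by_cases hv : partialD v a = 0
    · rw [hv, mul_zero, mul_zero]
    · congr 1
      rw [conjD_apply, AlgEquiv.eq_symm_apply]
      match v with
      | x => rw [shift_coord_x, totalD₁_apply, totalD_x, totalD_x, partialD_coord,
          if_neg (by simp), mul_zero, add_zero, map_one]
      | d i => rw [totalD₁_shift_d, totalD_d]
      | t k =>
        obtain rfl : k = 0 := by
          by_contra hk
          exact hv (ha k hk)
        rw [shift_coord_t, totalD₁_apply, totalD_t, totalD_t, if_pos rfl, if_neg (by norm_num),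
          partialD_coord, if_pos (by simp), mul_one, zero_add]
  rw [h1, conjD_apply, AlgEquiv.apply_symm_apply, totalD₁_apply, ha', mul_zero, add_zero]

/-- Since `D I = I`, all `D^{-j} ∂/∂t_1 D^j` kill `I` together with `∂/∂t_1`; subtracting the `X_j`
leaves the `Y_j`. -/
theorem isInvariant_of_D_eq {I : B.Fun} (hI : B.D I = I)
    (ht : ∀ n, ∀ k ≠ 0, partialD (t k) (I n) = 0) (n : ℤ) : B.IsInvariant n (I n) := by
  have hs : B.D.symm 0 = 0 := map_zero _
  have hconj : ∀ j, B.conj j I = 0 := by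
    intro j
    induction j with
    | zero => exact funext fun n => ht n 1 one_ne_zero
    | succ j ih => rw [conj_succ, hI, ih, hs]
  have hX : ∀ j ≥ 1, B.X n j (I n) = 0 := fun j hj => ht n _ (by omega)
  have hc : ∀ j, B.conjField n j (I n) = 0 := fun j => by
    rw [← conj_apply, hconj]; rfl
  refine ⟨fun j hj => ?_, hX, fun k hk => ht n k hk.ne'⟩
  rcases j with _ | _ | j
  · omega
  · rw [Y_one, hc]
  · have h1 := hc (j + 2)
    rw [← Y_add_X, Derivation.add_apply, hX (j + 1) (by omega)] at h1
    exact (add_zero _).symm.trans h1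

/-- `D_x` commutes with `D` on integrals, so every `D_x^i I` is again an integral. The equation at
one site uses the function at the next, hence the induction runs over all sites simultaneously. -/
theorem IsInvariant.totalD_iterate {I : B.Fun} (hI : B.D I = I)
    (ht : ∀ n, ∀ k ≠ 0, partialD (t k) (I n) = 0) (i : ℕ) (n : ℤ) :
    B.IsInvariant n ((totalD _)^[i] (I n)) ∧
      ∀ k ≠ 0, partialD (t k) ((totalD _)^[i] (I n)) = 0 := by
  have h : B.D (fun n => (totalD _)^[i] (I n)) = (fun n => (totalD _)^[i] (I n)) ∧
      ∀ n, ∀ k ≠ 0, partialD (t k) ((totalD _)^[i] (I n)) = 0 := by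
    induction i with
    | zero => exact ⟨hI, ht⟩
    | succ i ih =>
      simp only [Function.iterate_succ_apply']
      refine ⟨funext fun n => ?_, fun n k hk => ?_⟩
      · have h1 : B.shift n ((totalD _)^[i] (I (n + 1))) = (totalD _)^[i] (I n) :=
          congrFun ih.1 n
        rw [D_apply, shift_totalD (ih.2 (n + 1)) (by rw [h1]; exact ih.2 n 1 one_ne_zero), h1]
      · rw [partialD_t_totalD, ih.2 n k hk, map_zero]
  exact ⟨isInvariant_of_D_eq h.1 h.2 n, h.2 n⟩

/-- Nontriviality holds at some site, and the order is taken there. One such site is enough, since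
genericity transports the bound on the rank. -/
theorem exists_not_isUnit_minor_of_nIntegral {I : B.Fun} (hI : B.IsNIntegral I)
    (htriv : ¬ B.IsTrivial I) : ∃ (n : ℤ) (R : ℕ),
      ∀ Z : Fin R → Derivation ℝ (O (B.pt n)) (O (B.pt n)), (∀ a, Z a ∈ B.fullSet n) →
        ∀ v, ¬ IsUnit (minor Z v) := by
  have ht : ∀ n, ∀ k ≠ 0, partialD (t k) (I n) = 0 := fun n k hk =>
    mem_smoothGerms_iff.1 (hI.1 n) _ (by simpa using hk)
  unfold IsTrivial at htriv
  push Not at htriv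
  obtain ⟨n, hn⟩ := htriv
  rw [mem_smoothGerms_iff] at hn
  push Not at hn
  obtain ⟨v, hvx, hv⟩ := hn
  obtain ⟨w, rfl⟩ : ∃ w, v = jetVar w := by
    match v with
    | x => exact absurd rfl hvx
    | d i => exact ⟨i + 1, rfl⟩
    | t k =>
      refine ⟨0, ?_⟩
      by_contra h
      exact hv (ht n k fun hk => h (by rw [hk]; rfl))
  have hfin : {w | partialD (jetVar w) (I n) ≠ 0}.Finite :=
    (finite_support_pd (I n)).preimage jetVar_injective.injOn
  obtain ⟨m, hm, hmax⟩ := hfin.exists_maximal ⟨w, hv⟩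
  refine ⟨n, m + 1, not_isUnit_minor_of_annihilate
    (fun Z hZ => ⟨(B.mem_vanishingFields_of_mem_fullSet hZ).1,
      (B.mem_vanishingFields_of_mem_fullSet hZ).2.1⟩) (a := I n)
    (fun k l hl => (IsInvariant.totalD_iterate hI.2 ht k n).2 l hl) (fun w hw => ?_) hm
    (fun Z hZ k => (IsInvariant.totalD_iterate hI.2 ht k n).1.fullSet_eq_zero hZ)⟩
  by_contra h
  exact absurd (hmax h hw.le) (by omega)

/-- Finitely many elements of `L_n` account for all jets. What is then left of an element of `L_n`
has components only at `t_{-1}, …, t_{-N}` and is a combination of `X_1, …, X_N`. -/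
theorem finite_charAlgebra {n : ℤ} {N r : ℕ}
    (hY : ∀ j ≥ 1, B.Y n j ∈ Submodule.span (O (B.pt n)) (B.Y n '' Set.Icc 1 N))
    {W : Fin r → Derivation ℝ (O (B.pt n)) (O (B.pt n))} {v : Fin r → ℕ}
    (hW : ∀ a, W a ∈ B.fullSet n) (hu : IsUnit (minor W v))
    (hr : ∀ Z : Fin (r + 1) → Derivation ℝ (O (B.pt n)) (O (B.pt n)), (∀ a, Z a ∈ B.fullSet n) →
      ∀ v, minor Z v = 0) : Module.Finite (O (B.pt n)) (B.charAlgebra N n) := by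
  choose W' hW' hWW' using fun a => B.exists_charAlgebra_jets_eq hY (hW a)
  have hX : ∀ j ∈ Set.Icc 1 N, B.X n j ∈ B.charAlgebra N n := fun j hj =>
    Submodule.subset_span (LieSubalgebra.subset_lieSpan (Or.inr ⟨j, hj, rfl⟩))
  have hK : ∀ F ∈ B.charAlgebra N n, F ∈ vanishingFields (B.pt n) {k | k < -N ∨ 0 < k} := by
    intro F hF
    have h1 : B.charAlgebra N n ≤ vanishingFields (B.pt n) {k | k < -N ∨ 0 < k} :=
      Submodule.span_le.2 fun F hF => (B.charLie_le_adapted N n hF).1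
    exact h1 hF
  have h : B.charAlgebra N n = Submodule.span (O (B.pt n))
      (Set.range W' ∪ B.X n '' Set.Icc 1 N) := by
    refine le_antisymm (Submodule.span_le.2 fun F hF => ?_) (Submodule.span_le.2 ?_)
    · have h1 := jets_mem_span_of_minors_eq_zero hW hu hr (B.charLie_le_fullLie N n hF)
      rw [Submodule.mem_span_range_iff_exists_fun] at h1
      obtain ⟨c, hc⟩ := h1
      have hS := Submodule.sum_mem (B.charAlgebra N n)
        (fun a (_ : a ∈ Finset.univ) => Submodule.smul_mem _ (c a) (hW' a))
      have hF' : F ∈ B.charAlgebra N n := Submodule.subset_span hF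
      have hX' : ∀ c : ℕ → O (B.pt n), ∑ j ∈ Finset.Icc 1 N, c j • B.X n j ∈ B.charAlgebra N n :=
        fun c => Submodule.sum_mem _ fun j hj =>
          Submodule.smul_mem _ _ (hX j (Finset.mem_Icc.1 hj))
      let β : ℕ → O (B.pt n) := fun j =>
        F (coord _ (t (-(j : ℤ)))) - (∑ a, c a • W' a) (coord _ (t (-(j : ℤ))))
      have hβ : ∀ w, (∑ j ∈ Finset.Icc 1 N, β j • B.X n j) w =
          ∑ j ∈ Finset.Icc 1 N, β j * B.X n j w := fun w => by
        rw [← Derivation.coeFnAddMonoidHom_apply, map_sum, Finset.sum_apply]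
        rfl
      have hjet : ∀ i, F (coord _ (jetVar i)) = (∑ a, c a • W' a +
          ∑ j ∈ Finset.Icc 1 N, β j • B.X n j) (coord _ (jetVar i)) := fun i => by
        have h0 : ∑ j ∈ Finset.Icc 1 N, β j * B.X n j (coord _ (jetVar i)) = 0 :=
          Finset.sum_eq_zero fun j hj => by
            rw [show B.X n j (coord _ (jetVar i)) = 0 from
              congrFun (B.jets_X n (Finset.mem_Icc.1 hj).1) i, mul_zero]
        rw [Derivation.add_apply, hβ, h0, add_zero, sum_smul_apply, ← jets_apply, ← hc,
          Finset.sum_apply]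
        refine Finset.sum_congr rfl fun a _ => ?_
        rw [hWW']
        rfl
      have heq : F = ∑ a, c a • W' a + ∑ j ∈ Finset.Icc 1 N, β j • B.X n j := by
        refine fields_ext (hK F hF').1 (hK _ (Submodule.add_mem _ hS (hX' β))).1 fun u => ?_
        have hG := (hK _ (Submodule.add_mem _ hS (hX' β))).2
        match u with
        | x => rw [(hK F hF').2.1, hG.1]
        | d i => exact hjet (i + 1)
        | t k =>
          by_cases hk : k < -N ∨ 0 < k
          · rw [(hK F hF').2.2 k hk, hG.2 k hk]
          · rcases eq_or_ne k 0 with rfl | hk0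
            · exact hjet 0
            · obtain ⟨l, rfl⟩ : ∃ l : ℕ, k = -(l : ℤ) := ⟨k.natAbs, by omega⟩
              rw [Derivation.add_apply, hβ, Finset.sum_eq_single l]
              · rw [X_t, if_pos (by rfl), mul_one]
                exact (add_sub_cancel _ _).symm
              · intro j _ hj
                rw [X_t, if_neg (by omega), mul_zero]
              · intro h
                exact absurd (Finset.mem_Icc.2 ⟨by omega, by omega⟩) h
      rw [heq]
      exact Submodule.add_mem _
        (Submodule.sum_mem _ fun a _ => Submodule.smul_mem _ _
          (Submodule.subset_span (Or.inl ⟨a, rfl⟩)))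
        (Submodule.sum_mem _ fun j hj => Submodule.smul_mem _ _
          (Submodule.subset_span (Or.inr ⟨j, Finset.mem_Icc.1 hj, rfl⟩)))
    · rintro _ (⟨a, rfl⟩ | ⟨j, hj, rfl⟩)
      · exact hW' a
      · exact hX j hj
  rw [h]
  exact Module.Finite.span_of_finite _
    ((Set.finite_range _).union ((Set.finite_Icc 1 N).image _))

/-- The bound on unit minors for the full algebra also bounds those of the `Y_j`, which belong to
it; both finiteness conditions thus come from one rank estimate. -/
theorem finite_of_nontrivial_nIntegral (hB : B.IsGeneric) {I : B.Fun} (hI : B.IsNIntegral I)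
    (htriv : ¬ B.IsTrivial I) : ∃ N : ℕ,
      (∀ n : ℤ, Module.Finite (O (B.pt n)) (B.Yspan n) ∧
        Module.finrank (O (B.pt n)) (B.Yspan n) = N) ∧
      ∀ n : ℤ, Module.Finite (O (B.pt n)) (B.charAlgebra N n) := by
  obtain ⟨n₀, R, hR⟩ := exists_not_isUnit_minor_of_nIntegral hI htriv
  obtain ⟨r, -, hr, hr'⟩ := ConstantRank.exists_rank
    (show B.ConstantRank fun n => B.fullSet n from hB.2) hR
  obtain ⟨N, hN, hY⟩ := exists_Yspan_basis B hB.1 fun Z hZ => hR Z fun a => by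
    obtain ⟨j, hj, h⟩ := hZ a
    exact h ▸ B.Y_mem_fullSet n₀ hj.1
  refine ⟨N, hN, fun n => ?_⟩
  obtain ⟨W, v, hW, hu⟩ := hr n
  exact finite_charAlgebra (hY n) hW hu (hr' n)

end Chain.Background

end SemiDiscrete

theorem theorem1p1 (C : SemiDiscrete.Chain) (B : C.Background) (hB : B.IsGeneric) :
    (∃ I : B.Fun, B.IsNIntegral I ∧ ¬ B.IsTrivial I) ↔
      ∃ N : ℕ,
        (∀ n : ℤ, Module.Finite (SemiDiscrete.O (B.pt n)) (B.Yspan n) ∧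
          Module.finrank (SemiDiscrete.O (B.pt n)) (B.Yspan n) = N) ∧
        (∀ n : ℤ, Module.Finite (SemiDiscrete.O (B.pt n)) (B.charAlgebra N n)) :=
  ⟨fun ⟨_, hI, htriv⟩ => SemiDiscrete.Chain.Background.finite_of_nontrivial_nIntegral hB hI htriv,
    fun ⟨_, h1, h2⟩ => SemiDiscrete.Chain.Background.exists_nontrivial_nIntegral hB h1 h2⟩
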